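/- **Setting.** Let $d\in\{1,2,3\}$ and let $D\subset\mathbb R^d$ be a nonempty bounded open convex polyhedron. Equip $H^1_0(D)$ with the norm $\|w\|_{H^1_0}=\|\nabla w\|_{L_2(D)}$ and its dual $H^{-1}(D)$ with the dual norm. Let $a_0,\psi_1,\psi_2,\ldots\in L_\infty(D)$ and $0<a_{\min}\le a_{\max}<\infty$ be such that $a(x,y)=a_0(x)+\sum_{j\ge1}y_j\psi_j(x)$ satisfies, for every $y\in[-\frac12,\frac12]^{\mathbb N}$, $a_{\min}\le a(x,y)\le a_{\max}$ for almost every $x\in D$. Assume $\sum_{j\ge1}\|\psi_j\|_{L_\infty}^{p_0}<\infty$ for some $p_0\in(0,1)$, and put $b_j=\|\psi_j\|_{L_\infty}/a_{\min}$. Let $\kappa,G\in H^{-1}(D)$. For a finite-dimensional subspace $V_h\subset H^1_0(D)$ (the finite element space), $s\ge 0$ and $y\in[-\frac12,\frac12]^s$, let $u^s_h(\cdot,y)\in V_h$ be the Galerkin solution of the problem truncated to $s$ terms, $$\int_D\Big(a_0+\sum_{j=1}^s y_j\psi_j\Big)\nabla u^s_h(\cdot,y)\cdot\nabla w\,dx=\langle\kappa,w\rangle\qquad\forall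 w\in V_h,$$ and let $f(t)=G(u^s_h(\cdot,t-\frac12))$, $t\in[0,1]^s$, be the integrand (which the paper writes as $G(u^s_h)$). For weights $\gamma=(\gamma_{\mathfrak u})_{\mathfrak u\subseteq\{1:s\}}$, $\gamma_{\mathfrak u}\ge0$, the weighted unanchored Sobolev norm is $$\|f\|_\gamma=\Bigg[\sum_{\mathfrak u\subseteq\{1:s\}}\frac1{\gamma_{\mathfrak u}}\int_{[0,1]^{|\mathfrak u|}}\bigg(\int_{[0,1]^{s-|\mathfrak u|}}\frac{\partial^{|\mathfrak u|}f}{\partial y_{\mathfrak u}}(y)\,dy_{\{1:s\}\setminus\mathfrak u}\bigg)^2dy_{\mathfrak u}\Bigg]^{1/2},$$ with the conventions $0/0=0$ and $c/0=\infty$ for $c>0$. For $z\in\mathbb N^s$ and $n\ge1$ the r.m.s. error of the randomly shifted lattice rule is $$e(f)=\Bigg(\int_{[0,1]^s}\bigg|\int_{[0,1]^s}f(t)\,dt-\frac1n\sum_{i=1}^nf\Big(\Big\{\frac{iz}{n}+\Delta\Big\}\Big)\bigg|^2d\Delta\Bigg)^{1/2}.$$ The vector $z$ is *CBC-constructed*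 for $\gamma$ if, for $k=1,\ldots,s$ in turn, $z_k$ minimises, over all $1\le z_k\le n$ with $\gcd(z_k,n)=1$ and with $z_1,\ldots,z_{k-1}$ fixed, the squared shift-averaged worst-case error $$\sum_{\emptyset\ne\mathfrak u\subseteq\{1:k\}}\gamma_{\mathfrak u}\,\frac1n\sum_{i=0}^{n-1}\prod_{j\in\mathfrak u}B_2\Big(\Big\{\frac{iz_j}{n}\Big\}\Big),\qquad B_2(x)=x^2-x+\tfrac16 .$$ Put $\vartheta(\lambda)=2\zeta(2\lambda)/(2\pi^2)^\lambda$ and $$E_{n,\lambda}(\gamma)=\Bigg(\frac2n\sum_{\mathfrak u\subseteq\{1:s\}}\gamma_{\mathfrak u}^\lambda\,\vartheta(\lambda)^{|\mathfrak u|}\Bigg)^{\frac1{2\lambda}}\Bigg(\sum_{\mathfrak u\subseteq\{1:s\}}\frac{(|\mathfrak u|!)^2\prod_{j\in\mathfrak u}b_j^2}{\gamma_{\mathfrak u}}\Bigg)^{\frac12}.$$ Call $\gamma$ *admissible* if $\gamma_{\mathfrak u}\ge0$ for all $\mathfrak u$, and $\gamma_{\mathfrak u}=0$ only when $\prod_{j\in\mathfrak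 u}b_j=0$. Throughout, $n=2^m$ with $m\ge0$. **Statement.** 1. (Norm bound.) For all $V_h$ and $s$, the Galerkin solution exists for every $y\in[-\frac12,\frac12]^s$, the integrand $f$ is $C^\infty$ on $[0,1]^s$, and for all weights $\gamma_{\mathfrak u}\ge0$ $$\|f\|_\gamma\le\frac{\|\kappa\|_{H^{-1}}\|G\|_{H^{-1}}}{a_{\min}}\Bigg(\sum_{\mathfrak u\subseteq\{1:s\}}\frac{(|\mathfrak u|!)^2\prod_{j\in\mathfrak u}b_j^2}{\gamma_{\mathfrak u}}\Bigg)^{1/2}.$$ 2. (Error bound.) For all $V_h$, $s$, $n=2^m$, all admissible $\gamma$, all $z$ that are CBC-constructed for $\gamma$ and all $\lambda\in(\frac12,1]$, $$e(f)\le\frac{\|\kappa\|_{H^{-1}}\|G\|_{H^{-1}}}{a_{\min}}\,E_{n,\lambda}(\gamma).$$ 3. (POD weights.) For all $s$, $n=2^m$ and $\lambda\in(\frac12,1]$, the POD weights $$\gamma_{\mathfrak u}=\bigg(|\mathfrak u|!\prod_{j\in\mathfrak u}\frac{b_j}{\sqrt{\vartheta(\lambda)}}\bigg)^{2/(1+\lambda)}$$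 are admissible and minimise $E_{n,\lambda}$ over all admissible weights, and the minimum is $$\Big(\frac2n\Big)^{\frac1{2\lambda}}\Bigg[\sum_{\mathfrak u\subseteq\{1:s\}}\bigg(|\mathfrak u|!\prod_{j\in\mathfrak u}\big(b_j\,\vartheta(\lambda)^{1/(2\lambda)}\big)\bigg)^{\frac{2\lambda}{1+\lambda}}\Bigg]^{\frac{1+\lambda}{2\lambda}}.$$ 4. (Rate.) Let $\delta\in(0,\frac12)$, and let $\lambda=\frac1{2-2\delta}$ if $p_0\le\frac23$ and $\lambda=\frac{p_0}{2-p_0}$ if $p_0>\frac23$. There is a constant $C$, independent of $s$, of $n$ and of $V_h$, such that for all $s$ and all $n=2^m$ CBC-constructed vectors for the POD weights with this $\lambda$ exist, and each of them satisfies, for every $V_h$, $$e(f)\le C\,n^{-\min(1/p_0-1/2,\;1-\delta)} .$$ -/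

import Mathlib

open MeasureTheory Set
open scoped ENNReal ContDiff Nat

noncomputable section

namespace QMCPDE

/-- The spatial Euclidean space `ℝ^d`. -/
abbrev Space (d : ℕ) : Type := EuclideanSpace ℝ (Fin d)

/-- `D` is a nonempty bounded open convex polyhedron (automatically a Lipschitz domain): the
interior of the convex hull of finitely many points. -/
def IsConvexPolyhedralDomain {d : ℕ} (D : Set (Space d)) : Prop :=
  D.Nonempty ∧ ∃ F : Finset (Space d), D = interior (convexHull ℝ (F : Set (Space d)))

/-- `L₂(D)`. -/
abbrev L2 {d : ℕ} (D : Set (Space d)) : Type := Lp ℝ 2 (volume.restrict D)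

/-- `L₂(D; ℝ^d)`. -/
abbrev L2Vec {d : ℕ} (D : Set (Space d)) : Type := Lp (Space d) 2 (volume.restrict D)

/-- The pairs `(g, ∇g)` with `g ∈ C_c^∞(D)`. -/
def testPairs {d : ℕ} (D : Set (Space d)) : Set (L2 D × L2Vec D) :=
  {p | ∃ g : Space d → ℝ, ContDiff ℝ ∞ g ∧ HasCompactSupport g ∧ tsupport g ⊆ D ∧
    p.1 =ᵐ[volume.restrict D] g ∧ p.2 =ᵐ[volume.restrict D] gradient g}

/-- The closure of `C_c^∞(D)` in the `H¹`-topology, each function being stored together with its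
weak gradient. -/
def H10Submodule {d : ℕ} (D : Set (Space d)) : Submodule ℝ (L2 D × L2Vec D) :=
  (Submodule.span ℝ (testPairs D)).topologicalClosure

/-- The Sobolev space `H¹₀(D)`. -/
def H10 {d : ℕ} (D : Set (Space d)) : Type := H10Submodule D

instance {d : ℕ} (D : Set (Space d)) : AddCommGroup (H10 D) :=
  inferInstanceAs (AddCommGroup (H10Submodule D))

instance {d : ℕ} (D : Set (Space d)) : Module ℝ (H10 D) :=
  inferInstanceAs (Module ℝ (H10Submodule D))

/-- The weak gradient `∇ : H¹₀(D) → L₂(D; ℝ^d)`. -/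
def grad {d : ℕ} (D : Set (Space d)) : H10 D →ₗ[ℝ] L2Vec D :=
  (LinearMap.snd ℝ (L2 D) (L2Vec D)).comp (H10Submodule D).subtype

/-- `‖w‖_{H¹₀} = ‖∇w‖_{L₂}` (definite by the Poincaré inequality, as `D` is bounded). With this,
`H10 D →L[ℝ] ℝ` is the dual space `H⁻¹(D)` and its operator norm is the `H⁻¹`-norm. -/
instance {d : ℕ} (D : Set (Space d)) : SeminormedAddCommGroup (H10 D) :=
  SeminormedAddCommGroup.induced (H10 D) (L2Vec D) (grad D)

instance {d : ℕ} (D : Set (Space d)) : NormedSpace ℝ (H10 D) :=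
  NormedSpace.induced ℝ (H10 D) (L2Vec D) (grad D)

/-- `‖g‖_{L_∞(D)}`, for essentially bounded `g`. -/
def linfNorm {d : ℕ} (D : Set (Space d)) (g : Space d → ℝ) : ℝ :=
  (eLpNorm g ⊤ (volume.restrict D)).toReal

/-- `b_j = ‖ψ_j‖_{L_∞(D)} / a_min`. The index `j = 0, 1, 2, …` stands for `1, 2, 3, …`. -/
def bSeq {d : ℕ} (D : Set (Space d)) (ψ : ℕ → Space d → ℝ) (amin : ℝ) (j : ℕ) : ℝ :=
  linfNorm D (ψ j) / amin

/-- The coefficient `a(x, y) = a₀(x) + ∑_j y_j ψ_j(x)`. -/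
def coeff {d : ℕ} (a₀ : Space d → ℝ) (ψ : ℕ → Space d → ℝ) (y : ℕ → ℝ) (x : Space d) : ℝ :=
  a₀ x + ∑' j, y j * ψ j x

/-- The coefficient truncated to `s` terms. -/
def coeffTrunc {d : ℕ} (a₀ : Space d → ℝ) (ψ : ℕ → Space d → ℝ) {s : ℕ} (y : Fin s → ℝ)
    (x : Space d) : ℝ :=
  a₀ x + ∑ j : Fin s, y j * ψ j x

/-- `u` is the Galerkin solution in `V` of the weak form of `-∇·(a^s(·,y) ∇u) = κ`. -/
def IsGalerkinSolution {d : ℕ} {D : Set (Space d)} (a₀ : Space d → ℝ) (ψ : ℕ → Space d → ℝ)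
    (κ : H10 D →L[ℝ] ℝ) (V : Submodule ℝ (H10 D)) {s : ℕ} (y : Fin s → ℝ) (u : H10 D) : Prop :=
  u ∈ V ∧ ∀ w ∈ V,
    ∫ x in D, coeffTrunc a₀ ψ y x * inner ℝ (grad D u x) (grad D w x) = κ w

/-- `u^s_h(·, y)`, the Galerkin solution in the finite element space `V = V_h`. -/
def galerkinSolution {d : ℕ} {D : Set (Space d)} (a₀ : Space d → ℝ) (ψ : ℕ → Space d → ℝ)
    (κ : H10 D →L[ℝ] ℝ) (V : Submodule ℝ (H10 D)) {s : ℕ} (y : Fin s → ℝ) : H10 D :=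
  Classical.epsilon (IsGalerkinSolution a₀ ψ κ V y)

/-- The integrand `t ↦ G(u^s_h(·, t - 1/2))` on `[0,1]^s`. -/
def integrand {d : ℕ} {D : Set (Space d)} (a₀ : Space d → ℝ) (ψ : ℕ → Space d → ℝ)
    (κ G : H10 D →L[ℝ] ℝ) (V : Submodule ℝ (H10 D)) (s : ℕ) (t : Fin s → ℝ) : ℝ :=
  G (galerkinSolution a₀ ψ κ V (fun j => t j - 1 / 2))

/-- The mixed first derivative `∂^{|u|} f / ∂y_u`. -/
def mixedPartial {s : ℕ} (u : Finset (Fin s)) (f : (Fin s → ℝ) → ℝ) : (Fin s → ℝ) → ℝ :=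
  (u.sort (· ≤ ·)).foldr (fun j g y => lineDeriv ℝ g y (Pi.single j 1)) f

/-- The weighted unanchored Sobolev norm of smoothness one, with values in `[0, ∞]`: in a term
with `γ_u = 0` one has `0 / 0 = 0` and `c / 0 = ∞` for `c ≠ 0`. -/
def sobolevNorm {s : ℕ} (γ : Finset (Fin s) → ℝ) (f : (Fin s → ℝ) → ℝ) : ℝ≥0∞ :=
  (∑ u : Finset (Fin s),
    (∫⁻ yu in Icc (0 : {j // j ∈ u} → ℝ) 1, ENNReal.ofReal
      ((∫ yc in Icc (0 : {j // j ∉ u} → ℝ) 1, mixedPartial u f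
        ((Equiv.piEquivPiSubtypeProd (fun j => j ∈ u) (fun _ : Fin s => ℝ)).symm (yu, yc))) ^ 2))
      / ENNReal.ofReal (γ u)) ^ (1 / 2 : ℝ)

/-- The lattice rule with generating vector `z` and shift `Δ`. -/
def latticeRule {s : ℕ} (n : ℕ) (z : Fin s → ℕ) (Δ : Fin s → ℝ) (f : (Fin s → ℝ) → ℝ) : ℝ :=
  (1 / (n : ℝ)) * ∑ i ∈ Finset.Icc 1 n,
    f (fun j => Int.fract ((i : ℝ) * (z j : ℝ) / (n : ℝ) + Δ j))

/-- The root-mean-square error over a uniformly distributed shift `Δ ∈ [0,1]^s`. -/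
def rmsError {s : ℕ} (n : ℕ) (z : Fin s → ℕ) (f : (Fin s → ℝ) → ℝ) : ℝ≥0∞ :=
  (∫⁻ Δ in Icc (0 : Fin s → ℝ) 1, ENNReal.ofReal
    (((∫ t in Icc (0 : Fin s → ℝ) 1, f t) - latticeRule n z Δ f) ^ 2)) ^ (1 / 2 : ℝ)

/-- The CBC criterion: the squared shift-averaged worst-case error, in the weighted unanchored
Sobolev space over the variables with index at most `k`, of the lattice rule generated by those
components of `z`, namely
`∑_{∅ ≠ u ⊆ {0,…,k}} γ_u (1/n) ∑_{i<n} ∏_{j ∈ u} B₂({i z_j / n})`, `B₂(x) = x² - x + 1/6`. -/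
def cbcCriterion {s : ℕ} (n : ℕ) (γ : Finset (Fin s) → ℝ) (k : Fin s) (z : Fin s → ℕ) : ℝ :=
  ∑ u ∈ (Finset.Iic k).powerset with u.Nonempty,
    γ u * ((1 / (n : ℝ)) * ∑ i ∈ Finset.range n,
      ∏ j ∈ u, bernoulliFun 2 (Int.fract ((i : ℝ) * (z j : ℝ) / (n : ℝ))))

/-- `c` is an admissible component of a generating vector: `1 ≤ c ≤ n` and `gcd(c, n) = 1`. -/
def IsCandidate (n c : ℕ) : Prop := 1 ≤ c ∧ c ≤ n ∧ c.Coprime n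

/-- `z` is an outcome of the component-by-component construction with weights `γ`: each component
minimises the criterion for its dimension with the previous components kept fixed. -/
def IsCBC {s : ℕ} (n : ℕ) (γ : Finset (Fin s) → ℝ) (z : Fin s → ℕ) : Prop :=
  ∀ k : Fin s, IsCandidate n (z k) ∧
    ∀ c, IsCandidate n c → cbcCriterion n γ k z ≤ cbcCriterion n γ k (Function.update z k c)

/-- `ϑ(λ) = 2 ζ(2λ) / (2π²)^λ` with `ζ(a) = ∑_{k ≥ 1} k^{-a}`. -/
def vartheta (lam : ℝ) : ℝ :=
  2 * (∑' k : ℕ, ((k : ℝ) + 1) ^ (-(2 * lam))) / (2 * Real.pi ^ 2) ^ lam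

/-- The sum `∑_u (|u|!)² ∏_{j∈u} b_j² / γ_u`, with values in `[0, ∞]`. -/
def derivSum (b : ℕ → ℝ) {s : ℕ} (γ : Finset (Fin s) → ℝ) : ℝ≥0∞ :=
  ∑ u : Finset (Fin s),
    ENNReal.ofReal (((u.card ! : ℕ) : ℝ) ^ 2 * ∏ j ∈ u, b j ^ 2) / ENNReal.ofReal (γ u)

/-- The weight-dependent factor of the error bound,
`((2/n) ∑_u γ_u^λ ϑ(λ)^{|u|})^{1/(2λ)} (∑_u (|u|!)² ∏_{j∈u} b_j² / γ_u)^{1/2}`. -/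
def errorFactor (b : ℕ → ℝ) {s : ℕ} (n : ℕ) (lam : ℝ) (γ : Finset (Fin s) → ℝ) : ℝ≥0∞ :=
  ENNReal.ofReal
    ((2 / (n : ℝ) * ∑ u : Finset (Fin s), γ u ^ lam * vartheta lam ^ u.card) ^ (1 / (2 * lam)))
    * derivSum b γ ^ (1 / 2 : ℝ)

/-- Nonnegative weights that vanish at most for those `u` with `∏_{j∈u} b_j = 0`. -/
def AdmissibleWeights (b : ℕ → ℝ) {s : ℕ} (γ : Finset (Fin s) → ℝ) : Prop :=
  ∀ u, 0 ≤ γ u ∧ (γ u = 0 → ∏ j ∈ u, b j = 0)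

/-- The POD weights `γ_u = (|u|! ∏_{j∈u} b_j / √ϑ(λ))^{2/(1+λ)}`. -/
def podWeights (b : ℕ → ℝ) (lam : ℝ) (s : ℕ) (u : Finset (Fin s)) : ℝ :=
  (((u.card ! : ℕ) : ℝ) * ∏ j ∈ u, (b j / √(vartheta lam))) ^ (2 / (1 + lam))

/-- The choice of `λ` in terms of `p₀` and `δ`. -/
def lambdaChoice (p₀ δ : ℝ) : ℝ :=
  if p₀ ≤ 2 / 3 then 1 / (2 - 2 * δ) else p₀ / (2 - p₀)

end QMCPDE

end

/-! On a finite element space the Galerkin problem is a linear equation `T(y) ∇u = k`, where `T(y)`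
is multiplication by the coefficient, compressed to the space of gradients. `T` is affine in `y`.
For parameters in the cube it is coercive with constant `a_min`, hence invertible with inverse
bounded by `1 / a_min`, and invertibility persists on an open neighbourhood. Differentiating the
inverse once in each direction of `u` gives a signed sum of `|u|!` operator words, each bounded by
`(1 / a_min) ∏ b_j`. The resulting pointwise bound on mixed derivatives
(`exists_smooth_neighborhood`) gives the norm bound at once, because unit cubes have measure one.

For the error, the kernel expansion `eq_sum_integral_anovaKernel` writes the quadrature error as a
sum over `u ≠ ∅` of integrals of mixed derivatives against the lattice average of a product kernel.
Cauchy–Schwarz in `y` and in `u`, then averaging over the shift, turns the kernels into `B₂` and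
leaves the squared shift-averaged error (`rmsError_le`). The Fourier coefficients of `B₂` are
nonnegative, so this is a nonnegative sum over the dual lattice. A CBC component does at least as
well as the average over the units of `ℤ/nℤ`; averaging `λ`-th powers, with subadditivity of `x ↦
x^λ` and `sum_units_residueWeight_le`, gives the factor `1 / φ(n)`, which is at most `2 / n` for
powers of two (`shiftAveragedErrorSq_rpow_le`).

The optimal weights come from Hölder's inequality with exponents `1 + λ` and `(1 + λ) / λ`, the POD
weights being its equality case. With `p = 2λ / (1 + λ)`, the bound `e_k ≤ e_1^k / k!` for
elementary symmetric sums dominates the minimal value, uniformly in `s`, through `∑_k (k!)^(p-1)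
S^k`, which converges since `p < 1`; the choice of `λ` ensures `p₀ ≤ p`, so that `S` is finite. -/

noncomputable section

namespace QMCPDE

/-! ### Mixed derivatives of the inverse of an affine operator family. -/

section Resolvent

variable {𝔸 : Type*} [NormedRing 𝔸] [NormedAlgebra ℝ 𝔸] {s : ℕ}

/-- The affine family `y ↦ A₀ + ∑ y_j A_j` in a normed algebra. -/
def affineFamily (A₀ : 𝔸) (A : Fin s → 𝔸) (y : Fin s → ℝ) : 𝔸 := A₀ + ∑ j, y j • A j

/-- The product `R A_{w₁} R A_{w₂} ⋯ A_{w_k} R`, where `R` is the inverse of the affine family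
at `y`. -/
def resolventWord (A₀ : 𝔸) (A : Fin s → 𝔸) (y : Fin s → ℝ) : List (Fin s) → 𝔸
  | [] => Ring.inverse (affineFamily A₀ A y)
  | j :: w => Ring.inverse (affineFamily A₀ A y) * A j * resolventWord A₀ A y w

/-- The iterated derivative of the inverse of the affine family in the directions in `l`. -/
def resolventDeriv (A₀ : 𝔸) (A : Fin s → 𝔸) (l : List (Fin s)) (y : Fin s → ℝ) : 𝔸 :=
  (-1 : ℝ) ^ l.length • (l.permutations'.map (resolventWord A₀ A y)).sum

theorem resolventDeriv_nil (A₀ : 𝔸) (A : Fin s → 𝔸) (y : Fin s → ℝ) :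
    resolventDeriv A₀ A [] y = Ring.inverse (affineFamily A₀ A y) := by
  simp [resolventDeriv, resolventWord]

/-- Symmetry of the mixed derivative. It is needed because prepending a direction to a sorted list
need not leave it sorted. -/
theorem resolventDeriv_perm (A₀ : 𝔸) (A : Fin s → 𝔸) {l l' : List (Fin s)} (h : l.Perm l')
    (y : Fin s → ℝ) : resolventDeriv A₀ A l y = resolventDeriv A₀ A l' y := by
  rw [resolventDeriv, resolventDeriv, h.length_eq, (h.permutations'.map _).sum_eq]

theorem contDiff_affineFamily (A₀ : 𝔸) (A : Fin s → 𝔸) : ContDiff ℝ ∞ (affineFamily A₀ A) := by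
  unfold affineFamily
  fun_prop

theorem affineFamily_add_single (A₀ : 𝔸) (A : Fin s → 𝔸) (y : Fin s → ℝ) (i : Fin s) (t : ℝ) :
    affineFamily A₀ A (y + t • Pi.single i 1) = affineFamily A₀ A y + t • A i := by
  simp only [affineFamily, Pi.add_apply, Pi.smul_apply, add_smul, Finset.sum_add_distrib,
    ← add_assoc]
  congr 1
  rw [Finset.sum_eq_single i] <;> simp +contextual

theorem norm_resolventWord_le (A₀ : 𝔸) (A : Fin s → 𝔸) (y : Fin s → ℝ) {ρ : ℝ} {β : Fin s → ℝ}
    (hρ : ‖Ring.inverse (affineFamily A₀ A y)‖ ≤ ρ) (hβ : ∀ j, ‖A j‖ ≤ β j)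
    (w : List (Fin s)) :
    ‖resolventWord A₀ A y w‖ ≤ ρ * (w.map fun j => β j * ρ).prod := by
  have hρ0 : 0 ≤ ρ := (norm_nonneg _).trans hρ
  have hβ0 : ∀ j, 0 ≤ β j := fun j => (norm_nonneg _).trans (hβ j)
  induction w with
  | nil => simpa [resolventWord] using hρ
  | cons j w ih =>
    calc ‖resolventWord A₀ A y (j :: w)‖
        ≤ ‖Ring.inverse (affineFamily A₀ A y)‖ * ‖A j‖ * ‖resolventWord A₀ A y w‖ :=
          (norm_mul_le _ _).trans (mul_le_mul_of_nonneg_right (norm_mul_le _ _) (norm_nonneg _))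
      _ ≤ ρ * β j * (ρ * (w.map fun j => β j * ρ).prod) := by
          gcongr
          · exact mul_nonneg hρ0 (hβ0 j)
          · exact hβ j
      _ = ρ * ((j :: w).map fun j => β j * ρ).prod := by
          simp only [List.map_cons, List.prod_cons]; ring

/-- There are `l.length !` words, and they all obey the same bound because the product of the
factors `β j * ρ` does not depend on their order. -/
theorem norm_resolventDeriv_le (A₀ : 𝔸) (A : Fin s → 𝔸) (y : Fin s → ℝ) {ρ : ℝ} {β : Fin s → ℝ}
    (hρ : ‖Ring.inverse (affineFamily A₀ A y)‖ ≤ ρ) (hβ : ∀ j, ‖A j‖ ≤ β j)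
    (l : List (Fin s)) :
    ‖resolventDeriv A₀ A l y‖ ≤ ρ * ((l.length ! : ℝ) * (l.map fun j => β j * ρ).prod) := by
  have key : ∀ L : List (List (Fin s)), (∀ w ∈ L, w.Perm l) →
      ‖(L.map (resolventWord A₀ A y)).sum‖ ≤
        L.length * (ρ * (l.map fun j => β j * ρ).prod) := by
    intro L hL
    induction L with
    | nil => simp
    | cons w L ih =>
      simp only [List.map_cons, List.sum_cons, List.length_cons, Nat.cast_add, Nat.cast_one,
        add_mul, one_mul]
      rw [add_comm]
      refine (norm_add_le _ _).trans (add_le_add (ih fun w hw => hL w (by simp [hw])) ?_)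
      refine (norm_resolventWord_le A₀ A y hρ hβ w).trans_eq ?_
      rw [((hL w (by simp)).map _).prod_eq]
  have h := key l.permutations' fun w hw => List.mem_permutations'.1 hw
  rw [← (List.permutations_perm_permutations' l).length_eq, List.length_permutations] at h
  rw [resolventDeriv, norm_smul]
  simp only [norm_pow, norm_neg, norm_one, one_pow, one_mul]
  linarith

variable [CompleteSpace 𝔸]

theorem contDiffAt_inverse_affineFamily (A₀ : 𝔸) (A : Fin s → 𝔸) {y : Fin s → ℝ}
    (hy : IsUnit (affineFamily A₀ A y)) :
    ContDiffAt ℝ ∞ (fun y => Ring.inverse (affineFamily A₀ A y)) y := by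
  obtain ⟨x, hx⟩ := hy
  have := contDiffAt_ringInverse ℝ (n := ∞) x
  rw [hx] at this
  exact this.comp y (contDiff_affineFamily A₀ A).contDiffAt

theorem contDiffAt_resolventWord (A₀ : 𝔸) (A : Fin s → 𝔸) {y : Fin s → ℝ}
    (hy : IsUnit (affineFamily A₀ A y)) (w : List (Fin s)) :
    ContDiffAt ℝ ∞ (fun y => resolventWord A₀ A y w) y := by
  induction w with
  | nil => exact contDiffAt_inverse_affineFamily A₀ A hy
  | cons j w ih =>
    exact ((contDiffAt_inverse_affineFamily A₀ A hy).mul contDiffAt_const).mul ih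

theorem contDiffAt_resolventDeriv (A₀ : 𝔸) (A : Fin s → 𝔸) {y : Fin s → ℝ}
    (hy : IsUnit (affineFamily A₀ A y)) (l : List (Fin s)) :
    ContDiffAt ℝ ∞ (resolventDeriv A₀ A l) y := by
  unfold resolventDeriv
  refine ContDiffAt.const_smul _ ?_
  induction l.permutations' with
  | nil => simpa using contDiffAt_const
  | cons w L ih =>
    simp only [List.map_cons, List.sum_cons]
    exact (contDiffAt_resolventWord A₀ A hy w).add ih

theorem hasLineDerivAt_inverse_affineFamily (A₀ : 𝔸) (A : Fin s → 𝔸) {y : Fin s → ℝ}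
    (hy : IsUnit (affineFamily A₀ A y)) (i : Fin s) :
    HasLineDerivAt ℝ (fun y => Ring.inverse (affineFamily A₀ A y))
      (-(Ring.inverse (affineFamily A₀ A y) * A i * Ring.inverse (affineFamily A₀ A y))) y
      (Pi.single i 1) := by
  obtain ⟨x, hx⟩ := hy
  unfold HasLineDerivAt
  simp only [affineFamily_add_single, ← hx]
  have h1 : HasDerivAt (fun t : ℝ => (x : 𝔸) + t • A i) (A i) 0 := by
    simpa using ((hasDerivAt_id (0 : ℝ)).smul_const (A i)).const_add (x : 𝔸)
  have h2 : HasFDerivAt Ring.inverse (-ContinuousLinearMap.mulLeftRight ℝ 𝔸 ↑x⁻¹ ↑x⁻¹)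
      ((x : 𝔸) + (0 : ℝ) • A i) := by
    simpa using hasFDerivAt_ringInverse (𝕜 := ℝ) x
  have h3 := h2.comp_hasDerivAt (0 : ℝ) h1
  simpa [Function.comp_def] using h3

/-- Each occurrence of `R` in the word differentiates to `-R A_i R`. The product rule therefore
inserts the letter `i` at every possible position, which is what `permutations'Aux` enumerates. -/
theorem hasLineDerivAt_resolventWord (A₀ : 𝔸) (A : Fin s → 𝔸) {y : Fin s → ℝ}
    (hy : IsUnit (affineFamily A₀ A y)) (i : Fin s) (w : List (Fin s)) :
    HasLineDerivAt ℝ (fun y => resolventWord A₀ A y w)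
      (-((List.permutations'Aux i w).map (resolventWord A₀ A y)).sum) y (Pi.single i 1) := by
  induction w with
  | nil =>
    simpa [List.permutations'Aux, resolventWord] using
      hasLineDerivAt_inverse_affineFamily A₀ A hy i
  | cons j w ih =>
    have h1 := hasLineDerivAt_inverse_affineFamily A₀ A hy i
    unfold HasLineDerivAt at ih h1 ⊢
    have h2 := (h1.mul_const (A j)).mul ih
    have hy0 : y + (0 : ℝ) • Pi.single i (1 : ℝ) = y := by rw [zero_smul, add_zero]
    refine h2.congr_deriv ?_
    simp only [hy0]
    simp only [List.permutations'Aux, List.map_cons, List.map_map, List.sum_cons, resolventWord,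
      Function.comp_def, List.sum_map_mul_left, neg_add, mul_neg, neg_mul, mul_assoc]

/-- Inserting `i` everywhere into all permutations of `l` produces the permutations of `i :: l`, by
the recursion defining `permutations'`; the minus sign raises the power of `-1`. -/
theorem hasLineDerivAt_resolventDeriv (A₀ : 𝔸) (A : Fin s → 𝔸) {y : Fin s → ℝ}
    (hy : IsUnit (affineFamily A₀ A y)) (i : Fin s) (l : List (Fin s)) :
    HasLineDerivAt ℝ (resolventDeriv A₀ A l) (resolventDeriv A₀ A (i :: l) y) y
      (Pi.single i 1) := by
  have key : ∀ L : List (List (Fin s)), HasLineDerivAt ℝ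
      (fun y => (L.map (resolventWord A₀ A y)).sum)
      (-((L.flatMap (List.permutations'Aux i)).map (resolventWord A₀ A y)).sum) y
      (Pi.single i 1) := by
    intro L
    induction L with
    | nil => simpa [HasLineDerivAt] using hasDerivAt_const (0 : ℝ) (0 : 𝔸)
    | cons w L ih =>
      have h1 := hasLineDerivAt_resolventWord A₀ A hy i w
      simp only [List.map_cons, List.sum_cons, List.flatMap_cons, List.map_append,
        List.sum_append, neg_add]
      exact HasDerivAt.add h1 ih
  have h := HasDerivAt.const_smul ((-1 : ℝ) ^ l.length) (key l.permutations')
  unfold HasLineDerivAt resolventDeriv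
  refine h.congr_deriv ?_
  rw [List.permutations', List.length_cons, pow_succ, mul_smul, neg_one_smul]

end Resolvent

/-! ### Multiplication operators and their compressions. -/

section Multiplication

variable {d : ℕ} {D : Set (Space d)}

/-- Multiplication of `L₂` vector fields by `L_∞` functions. -/
def mulL2Vec (D : Set (Space d)) :
    Lp ℝ ∞ (volume.restrict D) →L[ℝ] L2Vec D →L[ℝ] L2Vec D :=
  (ContinuousLinearMap.lsmul ℝ ℝ : ℝ →L[ℝ] Space d →L[ℝ] Space d).holderL
    (volume.restrict D) ∞ 2 2

theorem coeFn_mulL2Vec (g : Lp ℝ ∞ (volume.restrict D)) (v : L2Vec D) :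
    mulL2Vec D g v =ᵐ[volume.restrict D] fun x => g x • v x :=
  ContinuousLinearMap.coeFn_holder _ g v

theorem norm_mulL2Vec_apply_le (g : Lp ℝ ∞ (volume.restrict D)) (v : L2Vec D) :
    ‖mulL2Vec D g v‖ ≤ ‖g‖ * ‖v‖ := by
  have h := ContinuousLinearMap.norm_holder_apply_apply_le (r := 2)
    (ContinuousLinearMap.lsmul ℝ ℝ : ℝ →L[ℝ] Space d →L[ℝ] Space d) g v
  refine h.trans ?_
  have h1 : ‖(ContinuousLinearMap.lsmul ℝ ℝ : ℝ →L[ℝ] Space d →L[ℝ] Space d)‖ ≤ 1 :=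
    ContinuousLinearMap.opNorm_lsmul_le
  calc _ ≤ 1 * ‖g‖ * ‖v‖ := by gcongr
    _ = _ := by ring

theorem inner_mulL2Vec (g : Lp ℝ ∞ (volume.restrict D)) (v w : L2Vec D) :
    inner ℝ (mulL2Vec D g v) w = ∫ x in D, g x * inner ℝ (v x) (w x) := by
  rw [L2.inner_def]
  refine integral_congr_ae ?_
  filter_upwards [coeFn_mulL2Vec g v] with x hx
  rw [hx, real_inner_smul_left]

theorem le_inner_mulL2Vec_self {c : ℝ} (g : Lp ℝ ∞ (volume.restrict D))
    (hg : ∀ᵐ x ∂(volume.restrict D), c ≤ g x) (v : L2Vec D) :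
    c * ‖v‖ ^ 2 ≤ inner ℝ (mulL2Vec D g v) v := by
  have h1 : Integrable (fun x => inner ℝ (v x) (v x)) (volume.restrict D) :=
    L2.integrable_inner v v
  have h2 : Integrable (fun x => inner ℝ (mulL2Vec D g v x) (v x)) (volume.restrict D) :=
    L2.integrable_inner (mulL2Vec D g v) v
  rw [← real_inner_self_eq_norm_sq, L2.inner_def, L2.inner_def, ← integral_const_mul]
  refine integral_mono_ae (h1.const_mul c) h2 ?_
  filter_upwards [hg, coeFn_mulL2Vec g v] with x hx hx'
  rw [hx', real_inner_smul_left]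
  exact mul_le_mul_of_nonneg_right hx real_inner_self_nonneg

/-- The compression to a subspace of the multiplication by an `L_∞` function. -/
def compressedMul (W : Submodule ℝ (L2Vec D)) [FiniteDimensional ℝ W] :
    Lp ℝ ∞ (volume.restrict D) →ₗ[ℝ] (W →L[ℝ] W) where
  toFun g := (W.orthogonalProjectionOnto.comp (mulL2Vec D g)).comp W.subtypeL
  map_add' g h := by ext; simp
  map_smul' c g := by ext; simp

variable (W : Submodule ℝ (L2Vec D)) [FiniteDimensional ℝ W]

/-- The projection is invisible when testing against elements of `W`, so the compression represents
the energy form and inherits its coercivity. -/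
theorem inner_compressedMul (g : Lp ℝ ∞ (volume.restrict D)) (v w : W) :
    inner ℝ (compressedMul W g v) w = inner ℝ (mulL2Vec D g v) (w : L2Vec D) := by
  simp [compressedMul]

theorem norm_compressedMul_le (g : Lp ℝ ∞ (volume.restrict D)) : ‖compressedMul W g‖ ≤ ‖g‖ := by
  refine ContinuousLinearMap.opNorm_le_bound _ (norm_nonneg _) fun v => ?_
  have h := W.norm_orthogonalProjectionOnto_apply_le (mulL2Vec D g v)
  exact h.trans (norm_mulL2Vec_apply_le g v)

end Multiplication

/-! ### Coercive operators in finite dimension. -/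

section Coercive

variable {W : Type*} [NormedAddCommGroup W] [InnerProductSpace ℝ W]

theorem norm_le_norm_apply_of_coercive {T : W →L[ℝ] W} {c : ℝ}
    (hT : ∀ v, c * ‖v‖ ^ 2 ≤ inner ℝ (T v) v) (v : W) : c * ‖v‖ ≤ ‖T v‖ := by
  rcases eq_or_ne v 0 with rfl | hv
  · simp
  have h1 := (hT v).trans (real_inner_le_norm _ _)
  have h2 : 0 < ‖v‖ := norm_pos_iff.2 hv
  nlinarith

theorem abs_inner_resolventDeriv_le {s : ℕ} {A₀ : W →L[ℝ] W} {A : Fin s → W →L[ℝ] W}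
    {y : Fin s → ℝ} {ρ : ℝ} {β : Fin s → ℝ} (hρ : ‖Ring.inverse (affineFamily A₀ A y)‖ ≤ ρ)
    (hβ : ∀ j, ‖A j‖ ≤ β j) (l : List (Fin s)) (g k : W) :
    |inner ℝ g (resolventDeriv A₀ A l y k)| ≤
      ‖k‖ * ‖g‖ * (ρ * ((l.length ! : ℝ) * (l.map fun j => β j * ρ).prod)) := by
  have h := norm_resolventDeriv_le A₀ A y hρ hβ l
  calc |inner ℝ g (resolventDeriv A₀ A l y k)|
      ≤ ‖g‖ * ‖resolventDeriv A₀ A l y k‖ := abs_real_inner_le_norm _ _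
    _ ≤ ‖g‖ * (‖resolventDeriv A₀ A l y‖ * ‖k‖) := by
        gcongr
        exact ContinuousLinearMap.le_opNorm _ _
    _ = ‖k‖ * ‖g‖ * ‖resolventDeriv A₀ A l y‖ := by ring
    _ ≤ _ := mul_le_mul_of_nonneg_left h (by positivity)

variable [FiniteDimensional ℝ W]

/-- Lax–Milgram in finite dimension: coercivity gives injectivity, and an injective endomorphism is
bijective. -/
theorem isUnit_of_coercive {T : W →L[ℝ] W} {c : ℝ} (hc : 0 < c)
    (hT : ∀ v, c * ‖v‖ ^ 2 ≤ inner ℝ (T v) v) : IsUnit T := by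
  have hinj : Function.Injective T := by
    refine (injective_iff_map_eq_zero T).2 fun v hv => ?_
    have := norm_le_norm_apply_of_coercive hT v
    rw [hv, norm_zero] at this
    by_contra h
    have : 0 < c * ‖v‖ := mul_pos hc (norm_pos_iff.2 h)
    linarith
  let e := (LinearEquiv.ofInjectiveEndo (T : W →ₗ[ℝ] W) hinj).toContinuousLinearEquiv
  exact ⟨ContinuousLinearEquiv.toUnit e, by ext v; rfl⟩

theorem norm_inverse_le_of_coercive {T : W →L[ℝ] W} {c : ℝ} (hc : 0 < c)
    (hT : ∀ v, c * ‖v‖ ^ 2 ≤ inner ℝ (T v) v) : ‖Ring.inverse T‖ ≤ 1 / c := by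
  refine ContinuousLinearMap.opNorm_le_bound _ (by positivity) fun v => ?_
  have h1 := norm_le_norm_apply_of_coercive hT (Ring.inverse T v)
  have h2 : T (Ring.inverse T v) = v := by
    rw [← mul_apply_eq_comp, Ring.mul_inverse_cancel _ (isUnit_of_coercive hc hT)]
    rfl
  rw [h2] at h1
  rw [div_mul_eq_mul_div, le_div_iff₀ hc]
  linarith

end Coercive

/-! ### The Galerkin problem on gradients and the regularity of the integrand. -/

section Galerkin

variable {d : ℕ} {D : Set (Space d)}

theorem norm_eq_norm_grad (v : H10 D) : ‖v‖ = ‖grad D v‖ := rfl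

/-- A bounded functional on `H¹₀(D)` induces a functional of the same norm on the gradients of a
finite element space. -/
theorem exists_functional_on_gradients (V : Submodule ℝ (H10 D)) [FiniteDimensional ℝ V]
    [FiniteDimensional ℝ (V.map (grad D))] (ℓ : H10 D →L[ℝ] ℝ) :
    ∃ k : V.map (grad D), ‖k‖ ≤ ‖ℓ‖ ∧
      ∀ v (hv : v ∈ V), inner ℝ k ⟨grad D v, Submodule.mem_map_of_mem hv⟩ = ℓ v := by
  let gV : V →ₗ[ℝ] V.map (grad D) := (grad D).submoduleMap V
  have hsurj : LinearMap.range gV = ⊤ :=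
    LinearMap.range_eq_top.2 ((grad D).submoduleMap_surjective V)
  -- Any linear right inverse will do: `ℓ` is bounded by the gradient seminorm, so it agrees on
  -- functions with equal gradients. The Poincaré inequality is therefore not needed.
  obtain ⟨L, hL⟩ := gV.exists_rightInverse_of_surjective hsurj
  have hL' : ∀ w, grad D (L w : H10 D) = w := fun w => by
    have := congrArg (fun T => ((T w : V.map (grad D)) : L2Vec D)) hL
    exact this
  let ell : V.map (grad D) →L[ℝ] ℝ := LinearMap.mkContinuous
    ((ℓ : H10 D →ₗ[ℝ] ℝ) ∘ₗ V.subtype ∘ₗ L) ‖ℓ‖ fun w => by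
      refine (ℓ.le_opNorm (L w : H10 D)).trans_eq ?_
      rw [norm_eq_norm_grad, hL']
      rfl
  refine ⟨(InnerProductSpace.toDual ℝ _).symm ell, ?_, fun v hv => ?_⟩
  · rw [LinearIsometryEquiv.norm_map]
    exact LinearMap.mkContinuous_norm_le _ (norm_nonneg _) _
  · rw [InnerProductSpace.toDual_symm_apply]
    change ℓ (L _ : H10 D) = ℓ v
    rw [← sub_eq_zero, ← map_sub, ← norm_le_zero_iff]
    refine (ℓ.le_opNorm _).trans_eq ?_
    rw [norm_eq_norm_grad, map_sub, hL', sub_self, norm_zero, mul_zero]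

variable {a₀ : Space d → ℝ} (ha₀ : MemLp a₀ ⊤ (volume.restrict D))
    {ψ : ℕ → Space d → ℝ} (hψ : ∀ j, MemLp (ψ j) ⊤ (volume.restrict D))

/-- The truncated coefficient as an element of `L_∞`. -/
def coeffTruncLp {s : ℕ} (y : Fin s → ℝ) : Lp ℝ ∞ (volume.restrict D) :=
  ha₀.toLp + ∑ j : Fin s, y j • (hψ j).toLp

theorem coeFn_coeffTruncLp {s : ℕ} (y : Fin s → ℝ) :
    coeffTruncLp ha₀ hψ y =ᵐ[volume.restrict D] coeffTrunc a₀ ψ y := by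
  have h : ∀ S : Finset (Fin s), (∑ j ∈ S, y j • (hψ j).toLp : Lp ℝ ∞ (volume.restrict D))
      =ᵐ[volume.restrict D] fun x => ∑ j ∈ S, y j * ψ j x := by
    intro S
    induction S using Finset.induction_on with
    | empty =>
      simp only [Finset.sum_empty]
      exact Lp.coeFn_zero _ _ _
    | insert i S hi ih =>
      rw [Finset.sum_insert hi]
      filter_upwards [Lp.coeFn_add (y i • (hψ i).toLp : Lp ℝ ∞ (volume.restrict D))
        (∑ j ∈ S, y j • (hψ j).toLp), Lp.coeFn_smul (y i) (hψ i).toLp, (hψ i).coeFn_toLp, ih]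
        with x h1 h2 h3 h4
      rw [h1, Pi.add_apply, h2, Pi.smul_apply, h3, h4, Finset.sum_insert hi, smul_eq_mul]
  filter_upwards [Lp.coeFn_add ha₀.toLp (∑ j : Fin s, y j • (hψ j).toLp), ha₀.coeFn_toLp,
    h Finset.univ] with x h1 h2 h3
  rw [coeffTruncLp, h1, Pi.add_apply, h2, h3, coeffTrunc]

theorem norm_toLp_eq_linfNorm (j : ℕ) :
    ‖((hψ j).toLp : Lp ℝ ∞ (volume.restrict D))‖ = linfNorm D (ψ j) :=
  Lp.norm_toLp _ _

theorem isGalerkinSolution_iff (κ : H10 D →L[ℝ] ℝ) (V : Submodule ℝ (H10 D))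
    [FiniteDimensional ℝ V] [FiniteDimensional ℝ (V.map (grad D))] {s : ℕ} (y : Fin s → ℝ)
    (k : V.map (grad D))
    (hk : ∀ v (hv : v ∈ V), inner ℝ k ⟨grad D v, Submodule.mem_map_of_mem hv⟩ = κ v) (u : H10 D) :
    IsGalerkinSolution a₀ ψ κ V y u ↔ ∃ hu : u ∈ V,
      compressedMul (V.map (grad D)) (coeffTruncLp ha₀ hψ y)
        ⟨grad D u, Submodule.mem_map_of_mem hu⟩ = k := by
  have hint : ∀ v w : H10 D, ∫ x in D, coeffTrunc a₀ ψ y x * inner ℝ (grad D v x) (grad D w x) =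
      inner ℝ (mulL2Vec D (coeffTruncLp ha₀ hψ y) (grad D v)) (grad D w) := by
    intro v w
    rw [inner_mulL2Vec]
    refine integral_congr_ae ?_
    filter_upwards [coeFn_coeffTruncLp ha₀ hψ y] with x hx
    rw [hx]
  constructor
  · rintro ⟨hu, h⟩
    refine ⟨hu, ext_inner_right ℝ ?_⟩
    rintro ⟨_, w, hw, rfl⟩
    rw [inner_compressedMul, hk w hw, ← h w hw, hint]
  · rintro ⟨hu, h⟩
    refine ⟨hu, fun w hw => ?_⟩
    rw [hint, ← hk w hw, ← h, inner_compressedMul]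

theorem coeffTruncLp_mem_Icc {amin amax : ℝ}
    (hbounds : ∀ y : ℕ → ℝ, (∀ j, y j ∈ Icc (-1 / 2 : ℝ) (1 / 2)) →
      ∀ᵐ x ∂(volume.restrict D), coeff a₀ ψ y x ∈ Icc amin amax)
    {s : ℕ} {y : Fin s → ℝ} (hy : ∀ j, y j ∈ Icc (-1 / 2 : ℝ) (1 / 2)) :
    ∀ᵐ x ∂(volume.restrict D), coeffTruncLp ha₀ hψ y x ∈ Icc amin amax := by
  -- Zero is an allowed parameter value, so padding by zeros gives an admissible sequence whose
  -- series is the truncated sum.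
  let y' : ℕ → ℝ := fun j => if h : j < s then y ⟨j, h⟩ else 0
  have hy' : ∀ j, y' j ∈ Icc (-1 / 2 : ℝ) (1 / 2) := by
    intro j
    by_cases h : j < s
    · simpa [y', h] using hy ⟨j, h⟩
    · simp only [y', h, dif_neg, not_false_eq_true]
      constructor <;> norm_num
  filter_upwards [hbounds y' hy', coeFn_coeffTruncLp ha₀ hψ y] with x hx hx'
  rw [hx']
  convert hx using 1
  rw [coeff, coeffTrunc, tsum_eq_sum (s := Finset.range s), Finset.sum_range]
  · simp [y']
  · intro j hj
    have : ¬ j < s := by simpa using hj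
    simp [y', this]

/-- Only invertibility of the operator is assumed, so the formula also holds at parameters outside
the cube. Whichever solution is chosen, its gradient solves the operator equation and `G` depends
only on the gradient. -/
theorem integrand_eq_inner (κ G : H10 D →L[ℝ] ℝ) (V : Submodule ℝ (H10 D))
    [FiniteDimensional ℝ V] [FiniteDimensional ℝ (V.map (grad D))] {s : ℕ} {y : Fin s → ℝ}
    {k g : V.map (grad D)}
    (hk : ∀ v (hv : v ∈ V), inner ℝ k ⟨grad D v, Submodule.mem_map_of_mem hv⟩ = κ v)
    (hg : ∀ v (hv : v ∈ V), inner ℝ g ⟨grad D v, Submodule.mem_map_of_mem hv⟩ = G v)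
    (hunit : IsUnit (compressedMul (V.map (grad D)) (coeffTruncLp ha₀ hψ y))) :
    IsGalerkinSolution a₀ ψ κ V y (galerkinSolution a₀ ψ κ V y) ∧
    G (galerkinSolution a₀ ψ κ V y) =
      inner ℝ g (Ring.inverse (compressedMul (V.map (grad D)) (coeffTruncLp ha₀ hψ y)) k) := by
  set T := compressedMul (V.map (grad D)) (coeffTruncLp ha₀ hψ y)
  have hex : ∃ u, IsGalerkinSolution a₀ ψ κ V y u := by
    obtain ⟨u, hu, hu'⟩ := (Ring.inverse T k).2
    refine ⟨u, (isGalerkinSolution_iff ha₀ hψ κ V y k hk u).2 ⟨hu, ?_⟩⟩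
    have : (⟨grad D u, Submodule.mem_map_of_mem hu⟩ : V.map (grad D)) = Ring.inverse T k :=
      Subtype.ext hu'
    rw [this]
    change T (Ring.inverse T k) = k
    rw [← mul_apply_eq_comp, Ring.mul_inverse_cancel _ hunit]
    rfl
  have hsol : IsGalerkinSolution a₀ ψ κ V y (galerkinSolution a₀ ψ κ V y) :=
    Classical.epsilon_spec hex
  refine ⟨hsol, ?_⟩
  obtain ⟨hu, h⟩ := (isGalerkinSolution_iff ha₀ hψ κ V y k hk _).1 hsol
  rw [← hg _ hu, ← h]
  change _ = inner ℝ g (Ring.inverse T (T _))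
  rw [← mul_apply_eq_comp (Ring.inverse T) T, Ring.inverse_mul_cancel _ hunit]
  rfl

/-- Mixed first derivatives are computed by successive differentiation along any family of
functions which is closed under partial derivatives on an open set. -/
theorem mixedPartial_eqOn {s : ℕ} {U : Set (Fin s → ℝ)} (hU : IsOpen U) {f : (Fin s → ℝ) → ℝ}
    {F : List (Fin s) → (Fin s → ℝ) → ℝ} (hf : EqOn f (F []) U)
    (hF : ∀ l i, ∀ y ∈ U, HasLineDerivAt ℝ (F l) (F (i :: l) y) y (Pi.single i 1))
    (u : Finset (Fin s)) : EqOn (mixedPartial u f) (F (u.sort (· ≤ ·))) U := by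
  unfold mixedPartial
  induction u.sort (· ≤ ·) with
  | nil => exact hf
  | cons i l ih =>
    intro y hy
    simp only [List.foldr_cons]
    have he : List.foldr (fun j g y => lineDeriv ℝ g y (Pi.single j 1)) f l =ᶠ[nhds y] F l :=
      Filter.eventuallyEq_of_mem (hU.mem_nhds hy) ih
    rw [he.lineDeriv_eq, (hF l i y hy).lineDeriv]

/-- The integrand extends smoothly across the boundary of the cube, and its mixed first
derivatives obey the bound `‖κ‖ ‖G‖ / a_min · |u|! ∏_{j ∈ u} b_j` on the cube. -/
theorem exists_smooth_neighborhood {amin amax : ℝ} (hamin : 0 < amin)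
    (ha₀ : MemLp a₀ ⊤ (volume.restrict D)) (hψ : ∀ j, MemLp (ψ j) ⊤ (volume.restrict D))
    (hbounds : ∀ y : ℕ → ℝ, (∀ j, y j ∈ Icc (-1 / 2 : ℝ) (1 / 2)) →
      ∀ᵐ x ∂(volume.restrict D), coeff a₀ ψ y x ∈ Icc amin amax)
    (κ G : H10 D →L[ℝ] ℝ) (V : Submodule ℝ (H10 D)) [FiniteDimensional ℝ V] (s : ℕ) :
    (∀ y : Fin s → ℝ, (∀ j, y j ∈ Icc (-1 / 2 : ℝ) (1 / 2)) →
      IsGalerkinSolution a₀ ψ κ V y (galerkinSolution a₀ ψ κ V y)) ∧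
    ∃ U : Set (Fin s → ℝ), IsOpen U ∧ Icc 0 1 ⊆ U ∧
      (∀ u, ContDiffOn ℝ ∞ (mixedPartial u (integrand a₀ ψ κ G V s)) U) ∧
      (∀ u, ∀ i ∉ u, ∀ y ∈ U, HasLineDerivAt ℝ (mixedPartial u (integrand a₀ ψ κ G V s))
        (mixedPartial (insert i u) (integrand a₀ ψ κ G V s) y) y (Pi.single i 1)) ∧
      (∀ u, ∀ y ∈ Icc (0 : Fin s → ℝ) 1, |mixedPartial u (integrand a₀ ψ κ G V s) y| ≤
        ‖κ‖ * ‖G‖ / amin * (((u.card ! : ℕ) : ℝ) * ∏ j ∈ u, bSeq D ψ amin j)) := by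
  have : FiniteDimensional ℝ (V.map (grad D)) :=
    Module.Finite.of_surjective _ ((grad D).submoduleMap_surjective V)
  obtain ⟨k, hkn, hk⟩ := exists_functional_on_gradients V κ
  obtain ⟨g, hgn, hg⟩ := exists_functional_on_gradients V G
  let M := compressedMul (V.map (grad D))
  have hcoer : ∀ y : Fin s → ℝ, (∀ j, y j ∈ Icc (-1 / 2 : ℝ) (1 / 2)) →
      ∀ v, amin * ‖v‖ ^ 2 ≤ inner ℝ (M (coeffTruncLp ha₀ hψ y) v) v := by
    intro y hy v
    rw [inner_compressedMul]
    refine le_inner_mulL2Vec_self _ ?_ _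
    filter_upwards [coeffTruncLp_mem_Icc ha₀ hψ hbounds hy] with x hx using hx.1
  let A : Fin s → (V.map (grad D) →L[ℝ] V.map (grad D)) := fun j => M (hψ j).toLp
  -- The subtracted half-sum absorbs the shift from `[0,1]^s` to parameters in `[-1/2, 1/2]^s`.
  let A₀ : V.map (grad D) →L[ℝ] V.map (grad D) :=
    M ha₀.toLp - ∑ j, (1 / 2 : ℝ) • A j
  have hA : ∀ t : Fin s → ℝ, affineFamily A₀ A t =
      M (coeffTruncLp ha₀ hψ fun j => t j - 1 / 2) := by
    intro t
    simp only [affineFamily, coeffTruncLp, A₀, A, map_add, map_sub, map_sum, map_smul, sub_smul,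
      Finset.sum_sub_distrib]
    abel
  have hshift : ∀ t ∈ Icc (0 : Fin s → ℝ) 1, ∀ j, t j - 1 / 2 ∈ Icc (-1 / 2 : ℝ) (1 / 2) := by
    intro t ht j
    have h1 := ht.1 j
    have h2 := ht.2 j
    simp only [Pi.zero_apply, Pi.one_apply] at h1 h2
    constructor <;> linarith
  -- Units form an open set, and coercivity puts the closed cube inside `U`; derivatives at boundary
  -- points of the cube are thus ordinary two-sided ones.
  let U : Set (Fin s → ℝ) := {t | IsUnit (affineFamily A₀ A t)}
  have hUmem : ∀ {t}, t ∈ U → IsUnit (affineFamily A₀ A t) := id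
  have hU : IsOpen U := Units.isOpen.preimage (contDiff_affineFamily A₀ A).continuous
  have hsub : Icc 0 1 ⊆ U := fun t ht => by
    change IsUnit _
    rw [hA]
    exact isUnit_of_coercive hamin (hcoer _ (hshift t ht))
  let L : (V.map (grad D) →L[ℝ] V.map (grad D)) →L[ℝ] ℝ :=
    (innerSL ℝ g).comp (ContinuousLinearMap.apply ℝ (V.map (grad D)) k)
  let F : List (Fin s) → (Fin s → ℝ) → ℝ := fun l y => L (resolventDeriv A₀ A l y)
  have hF0 : EqOn (integrand a₀ ψ κ G V s) (F []) U := by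
    intro t ht
    have ht' : IsUnit (affineFamily A₀ A t) := ht
    rw [hA] at ht'
    simp only [F, resolventDeriv_nil, hA]
    exact (integrand_eq_inner ha₀ hψ κ G V hk hg ht').2
  have hFd : ∀ l i, ∀ y ∈ U, HasLineDerivAt ℝ (F l) (F (i :: l) y) y (Pi.single i 1) :=
    fun l i y hy => L.hasFDerivAt.comp_hasDerivAt _ (hasLineDerivAt_resolventDeriv A₀ A (hUmem hy) i l)
  have hmix := mixedPartial_eqOn hU hF0 hFd
  refine ⟨fun y hy => (integrand_eq_inner ha₀ hψ κ G V hk hg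
    (isUnit_of_coercive hamin (hcoer y hy))).1, U, hU, hsub, fun u => ?_, fun u i hi y hy => ?_,
    fun u y hy => ?_⟩
  · refine ContDiffOn.congr (f := F (u.sort (· ≤ ·))) (fun y hy => ?_) (hmix u)
    exact (L.contDiff.contDiffAt.comp y
      (contDiffAt_resolventDeriv A₀ A (hUmem hy) _)).contDiffWithinAt
  · have hp : (i :: u.sort (· ≤ ·)).Perm ((insert i u).sort (· ≤ ·)) := by
      refine (List.perm_ext_iff_of_nodup ?_ (Finset.sort_nodup _ _)).2 fun j => ?_
      · simp [hi]
      · simp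
    rw [hmix _ hy]
    have h1 : F ((insert i u).sort (· ≤ ·)) y = F (i :: u.sort (· ≤ ·)) y := by
      simp only [F, resolventDeriv_perm A₀ A hp]
    rw [h1]
    exact (hFd _ i y hy).congr_of_eventuallyEq
      (Filter.eventuallyEq_of_mem (hU.mem_nhds hy) (hmix u))
  · rw [hmix u (hsub hy)]
    have hinv : ‖Ring.inverse (affineFamily A₀ A y)‖ ≤ 1 / amin := by
      rw [hA]
      exact norm_inverse_le_of_coercive hamin (hcoer _ (hshift y hy))
    have hb : ∀ j : Fin s, ‖A j‖ ≤ linfNorm D (ψ j) := fun j =>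
      (norm_compressedMul_le _ _).trans_eq (norm_toLp_eq_linfNorm hψ j)
    have h1 := abs_inner_resolventDeriv_le hinv hb (u.sort (· ≤ ·)) g k
    have h3 : ((u.sort (· ≤ ·)).map fun j : Fin s => linfNorm D (ψ j) * (1 / amin)).prod =
        ∏ j ∈ u, bSeq D ψ amin j := by
      rw [← Finset.prod_map_toList]
      refine List.Perm.prod_eq (List.Perm.trans (List.Perm.map _ (Finset.sort_perm_toList _ _)) ?_)
      simp only [bSeq, mul_one_div]
      rfl
    rw [h3, Finset.length_sort] at h1
    refine (le_of_eq rfl).trans (h1.trans ?_)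
    have h4 : 0 ≤ ∏ j ∈ u, bSeq D ψ amin j :=
      Finset.prod_nonneg fun j _ => div_nonneg ENNReal.toReal_nonneg hamin.le
    calc _ ≤ ‖κ‖ * ‖G‖ * (1 / amin * (((u.card ! : ℕ) : ℝ) * ∏ j ∈ u, bSeq D ψ amin j)) := by
          gcongr
      _ = _ := by ring

end Galerkin

/-! ### From pointwise derivative bounds to the Sobolev norm. -/

section SobolevNorm

theorem volume_Icc_zero_one {ι : Type*} [Fintype ι] : volume (Icc (0 : ι → ℝ) 1) = 1 := by
  simp [Real.volume_Icc_pi]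

theorem sobolevNorm_le_of_mixedPartial_le {s : ℕ} (γ : Finset (Fin s) → ℝ)
    {f : (Fin s → ℝ) → ℝ} {K : Finset (Fin s) → ℝ}
    (hK : ∀ u, ∀ y ∈ Icc (0 : Fin s → ℝ) 1, |mixedPartial u f y| ≤ K u) :
    sobolevNorm γ f ≤
      (∑ u, ENNReal.ofReal (K u ^ 2) / ENNReal.ofReal (γ u)) ^ (1 / 2 : ℝ) := by
  unfold sobolevNorm
  refine ENNReal.rpow_le_rpow (Finset.sum_le_sum fun u _ => ENNReal.div_le_div_right ?_ _)
    (by norm_num)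
  refine (setLIntegral_mono measurable_const
    (g := fun _ => ENNReal.ofReal (K u ^ 2)) fun yu hyu => ?_).trans_eq ?_
  · have h := norm_setIntegral_le_of_norm_le_const (μ := volume)
      (s := Icc (0 : {j // j ∉ u} → ℝ) 1) (C := K u) (f := fun yc => mixedPartial u f
        ((Equiv.piEquivPiSubtypeProd (fun j => j ∈ u) (fun _ : Fin s => ℝ)).symm (yu, yc)))
      (by rw [volume_Icc_zero_one]; simp) (fun yc hyc => by
        refine hK u _ ⟨fun j => ?_, fun j => ?_⟩ <;>
        by_cases hj : j ∈ u <;> simp only [Equiv.piEquivPiSubtypeProd, Equiv.coe_fn_symm_mk, hj,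
          dif_pos, dif_neg, not_false_eq_true]
        · exact hyu.1 ⟨j, hj⟩
        · exact hyc.1 ⟨j, hj⟩
        · exact hyu.2 ⟨j, hj⟩
        · exact hyc.2 ⟨j, hj⟩)
    rw [measureReal_def, volume_Icc_zero_one, ENNReal.toReal_one, mul_one, Real.norm_eq_abs] at h
    exact ENNReal.ofReal_le_ofReal (sq_le_sq' (abs_le.1 h).1 (abs_le.1 h).2)
  · rw [setLIntegral_const, volume_Icc_zero_one, mul_one]

/-- Factoring out `c` in `[0, ∞]` needs no case distinction for vanishing weights. -/
theorem sum_ofReal_mul_sq_div_rpow_half {s : ℕ} (b : ℕ → ℝ) (γ : Finset (Fin s) → ℝ) {c : ℝ}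
    (hc : 0 ≤ c) :
    (∑ u : Finset (Fin s),
      ENNReal.ofReal ((c * (((u.card ! : ℕ) : ℝ) * ∏ j ∈ u, b j)) ^ 2) / ENNReal.ofReal (γ u))
        ^ (1 / 2 : ℝ) = ENNReal.ofReal c * derivSum b γ ^ (1 / 2 : ℝ) := by
  have h : ∀ u : Finset (Fin s),
      ENNReal.ofReal ((c * (((u.card ! : ℕ) : ℝ) * ∏ j ∈ u, b j)) ^ 2) / ENNReal.ofReal (γ u) =
      ENNReal.ofReal (c ^ 2) * (ENNReal.ofReal (((u.card ! : ℕ) : ℝ) ^ 2 * ∏ j ∈ u, b j ^ 2) /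
        ENNReal.ofReal (γ u)) := by
    intro u
    rw [← mul_div_assoc, ← ENNReal.ofReal_mul (by positivity), mul_pow, mul_pow, Finset.prod_pow]
  simp only [h, ← Finset.mul_sum]
  rw [ENNReal.mul_rpow_of_nonneg _ _ (by norm_num), derivSum,
    ENNReal.ofReal_rpow_of_nonneg (by positivity) (by norm_num), ← Real.sqrt_eq_rpow,
    Real.sqrt_sq hc]

end SobolevNorm

/-! ### Resampling a coordinate of the unit cube. -/

section UnitCube

/-- Lebesgue measure on the unit interval. -/
abbrev unitMeasure : Measure ℝ := volume.restrict (Icc 0 1)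

/-- Lebesgue measure on the unit cube. -/
abbrev cubeMeasure (s : ℕ) : Measure (Fin s → ℝ) := Measure.pi fun _ => unitMeasure

instance : IsProbabilityMeasure unitMeasure := ⟨by simp [unitMeasure]⟩

theorem volume_restrict_cube (s : ℕ) :
    (volume : Measure (Fin s → ℝ)).restrict (Icc 0 1) = cubeMeasure s := by
  rw [cubeMeasure, ← Measure.restrict_pi_pi, ← Set.pi_univ_Icc]
  rfl

theorem ae_mem_cube (s : ℕ) : ∀ᵐ y ∂(cubeMeasure s), y ∈ Icc (0 : Fin s → ℝ) 1 := by
  rw [← volume_restrict_cube]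
  exact ae_restrict_mem measurableSet_Icc

theorem measurable_update_uncurry {s : ℕ} (k : Fin s) :
    Measurable fun p : (Fin s → ℝ) × ℝ => Function.update p.1 k p.2 := by
  refine measurable_pi_lambda _ fun j => ?_
  rcases eq_or_ne j k with rfl | h
  · simpa using measurable_snd
  · simp only [Function.update_of_ne h]
    fun_prop

/-- Resampling one coordinate preserves the uniform distribution on the cube. -/
theorem measurePreserving_update {s : ℕ} (k : Fin s) :
    MeasurePreserving (fun p : (Fin s → ℝ) × ℝ => Function.update p.1 k p.2)
      ((cubeMeasure s).prod unitMeasure) (cubeMeasure s) := by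
  refine ⟨measurable_update_uncurry k, (Measure.pi_eq fun A hA => ?_).symm⟩
  rw [Measure.map_apply (measurable_update_uncurry k) (MeasurableSet.univ_pi hA)]
  have h : (fun p : (Fin s → ℝ) × ℝ => Function.update p.1 k p.2) ⁻¹' univ.pi A =
      (univ.pi (Function.update A k univ)) ×ˢ A k := by
    ext p
    simp only [mem_preimage, mem_univ_pi, mem_prod]
    constructor
    · refine fun h => ⟨fun j => ?_, by simpa using h k⟩
      rcases eq_or_ne j k with rfl | hj
      · simp
      · simpa [hj] using h j
    · rintro ⟨h, hk⟩ j
      rcases eq_or_ne j k with rfl | hj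
      · simpa using hk
      · simpa [hj] using h j
  rw [h, Measure.prod_prod, Measure.pi_pi, ← Finset.mul_prod_erase _ _ (Finset.mem_univ k),
    ← Finset.mul_prod_erase (Finset.univ) (fun i => unitMeasure (A i)) (Finset.mem_univ k)]
  rw [Function.update_self, measure_univ, one_mul, mul_comm]
  congr 1
  refine Finset.prod_congr rfl fun j hj => ?_
  rw [Function.update_of_ne (Finset.ne_of_mem_erase hj)]

/-- This form of Fubini allows a one-variable identity to be used in coordinate `k` without
splitting the cube as a product. -/
theorem integral_update {s : ℕ} (k : Fin s) {H : (Fin s → ℝ) → ℝ}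
    (hH : Integrable H (cubeMeasure s)) :
    ∫ y, ∫ t, H (Function.update y k t) ∂unitMeasure ∂(cubeMeasure s) =
      ∫ y, H y ∂(cubeMeasure s) := by
  have hmp := measurePreserving_update k
  have h1 : Integrable (fun p : (Fin s → ℝ) × ℝ => H (Function.update p.1 k p.2))
      ((cubeMeasure s).prod unitMeasure) := hmp.integrable_comp_of_integrable hH
  have h2 : AEStronglyMeasurable H (((cubeMeasure s).prod unitMeasure).map
      fun p : (Fin s → ℝ) × ℝ => Function.update p.1 k p.2) := by
    rw [hmp.map_eq]
    exact hH.aestronglyMeasurable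
  rw [← integral_prod _ h1, ← integral_map hmp.measurable.aemeasurable h2, hmp.map_eq]

end UnitCube

/-! ### ANOVA-type kernel representation. -/

section Representation

/-- The kernel of the representation `g(x) = ∫ g + ∫ g'(t) η(x, t) dt` on `[0,1]`. -/
def anovaKernel (x t : ℝ) : ℝ := t - if x < t then 1 else 0

theorem measurable_anovaKernel : Measurable fun p : ℝ × ℝ => anovaKernel p.1 p.2 :=
  measurable_snd.sub (Measurable.ite (measurableSet_lt measurable_fst measurable_snd)
    measurable_const measurable_const)

theorem measurable_anovaKernel_right (x : ℝ) : Measurable (anovaKernel x) :=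
  measurable_anovaKernel.comp (measurable_const.prodMk measurable_id)

theorem abs_anovaKernel_le (x : ℝ) {t : ℝ} (ht : t ∈ Icc (0 : ℝ) 1) : |anovaKernel x t| ≤ 1 := by
  unfold anovaKernel
  rw [abs_le]
  split_ifs <;> constructor <;> linarith [ht.1, ht.2]

theorem integral_unitMeasure (g : ℝ → ℝ) : ∫ t, g t ∂unitMeasure = ∫ t in (0 : ℝ)..1, g t := by
  rw [intervalIntegral.integral_of_le zero_le_one, ← integral_Icc_eq_integral_Ioc]

theorem integral_mul_anovaKernel {g : ℝ → ℝ} {x : ℝ} (hx : x ∈ Icc (0 : ℝ) 1)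
    (hg : ContinuousOn g (Icc 0 1)) :
    ∫ t, g t * anovaKernel x t ∂unitMeasure =
      (∫ t in (0 : ℝ)..1, g t * t) - ∫ t in x..1, g t := by
  have hgt : IntegrableOn (fun t => g t * t) (Icc 0 1) :=
    (hg.mul continuousOn_id).integrableOn_Icc
  have hgi : IntegrableOn g (Icc 0 1) := hg.integrableOn_Icc
  have h1 : ∀ t, g t * anovaKernel x t = g t * t - (Ioi x).indicator g t := by
    intro t
    by_cases h : x < t <;> simp [anovaKernel, h, mul_sub]
  simp only [h1]
  rw [integral_sub hgt (hgi.integrable.indicator measurableSet_Ioi),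
    integral_unitMeasure, integral_indicator measurableSet_Ioi,
    Measure.restrict_restrict measurableSet_Ioi, intervalIntegral.integral_of_le hx.2]
  have h2 : Ioi x ∩ Icc 0 1 = Ioc x 1 := by
    ext t
    simp only [mem_inter_iff, mem_Ioi, mem_Icc, mem_Ioc]
    exact ⟨fun h => ⟨h.1, h.2.2⟩, fun h => ⟨h.1, (hx.1.trans_lt h.1).le, h.2⟩⟩
  rw [h2]

/-- Integration by parts gives `∫ t g'(t) dt = g(1) - ∫ g`, while the indicator part of the kernel
contributes `∫_x^1 g' = g(1) - g(x)`; the difference is `g(x) - ∫ g`. -/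
theorem eq_integral_add_integral_anovaKernel {g g' : ℝ → ℝ} {x : ℝ} (hx : x ∈ Icc (0 : ℝ) 1)
    (hd : ∀ t ∈ Icc (0 : ℝ) 1, HasDerivAt g (g' t) t) (hg' : ContinuousOn g' (Icc 0 1)) :
    g x = (∫ t, g t ∂unitMeasure) + ∫ t, g' t * anovaKernel x t ∂unitMeasure := by
  have hi : IntervalIntegrable g' volume 0 1 := by
    apply ContinuousOn.intervalIntegrable
    rwa [uIcc_of_le zero_le_one]
  have hi' : IntervalIntegrable g' volume x 1 := by
    apply ContinuousOn.intervalIntegrable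
    rw [uIcc_of_le hx.2]
    exact hg'.mono (Icc_subset_Icc_left hx.1)
  have h1 : ∫ t in x..1, g' t = g 1 - g x := by
    refine intervalIntegral.integral_eq_sub_of_hasDerivAt (fun t ht => hd t ?_) hi'
    rw [uIcc_of_le hx.2] at ht
    exact ⟨hx.1.trans ht.1, ht.2⟩
  have h2 : ∫ t in (0 : ℝ)..1, t * g' t = 1 * g 1 - 0 * g 0 - ∫ t in (0 : ℝ)..1, 1 * g t := by
    refine intervalIntegral.integral_mul_deriv_eq_deriv_mul (u := id) (u' := fun _ => 1)
      (fun t _ => hasDerivAt_id t) (fun t ht => hd t ?_) intervalIntegrable_const hi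
    rwa [uIcc_of_le zero_le_one] at ht
  rw [integral_mul_anovaKernel hx hg', integral_unitMeasure, h1]
  simp only [mul_comm (g' _)]
  rw [h2]
  simp

theorem measurable_prod_anovaKernel {s : ℕ} (x : Fin s → ℝ) (u : Finset (Fin s)) :
    Measurable fun y : Fin s → ℝ => ∏ j ∈ u, anovaKernel (x j) (y j) :=
  Finset.measurable_prod _ fun j _ =>
    (measurable_anovaKernel_right (x j)).comp (measurable_pi_apply j)

theorem abs_prod_anovaKernel_le {s : ℕ} (x : Fin s → ℝ) (u : Finset (Fin s)) {y : Fin s → ℝ}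
    (hy : y ∈ Icc (0 : Fin s → ℝ) 1) : |∏ j ∈ u, anovaKernel (x j) (y j)| ≤ 1 := by
  rw [Finset.abs_prod]
  exact Finset.prod_le_one (fun _ _ => abs_nonneg _)
    fun j _ => abs_anovaKernel_le _ ⟨hy.1 j, hy.2 j⟩

theorem integrable_mul_prod_anovaKernel {s : ℕ} {F : (Fin s → ℝ) → ℝ}
    (hF : ContinuousOn F (Icc 0 1)) (x : Fin s → ℝ) (u : Finset (Fin s)) :
    Integrable (fun y => F y * ∏ j ∈ u, anovaKernel (x j) (y j)) (cubeMeasure s) := by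
  have h : Integrable F (cubeMeasure s) := by
    rw [← volume_restrict_cube]
    exact hF.integrableOn_compact isCompact_Icc
  refine h.mul_bdd (c := 1) (measurable_prod_anovaKernel x u).aestronglyMeasurable ?_
  filter_upwards [ae_mem_cube s] with y hy
  exact abs_prod_anovaKernel_le x u hy

theorem piecewise_mem_cube {s : ℕ} {x y : Fin s → ℝ} (hx : x ∈ Icc (0 : Fin s → ℝ) 1)
    (hy : y ∈ Icc (0 : Fin s → ℝ) 1) (S : Finset (Fin s)) :
    S.piecewise y x ∈ Icc (0 : Fin s → ℝ) 1 := by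
  constructor <;> intro j <;> by_cases hj : j ∈ S <;> simp only [hj, Finset.piecewise_eq_of_mem,
    Finset.piecewise_eq_of_notMem, not_false_eq_true]
  exacts [hy.1 j, hx.1 j, hy.2 j, hx.2 j]

theorem update_mem_cube {s : ℕ} {y : Fin s → ℝ} (hy : y ∈ Icc (0 : Fin s → ℝ) 1) (k : Fin s)
    {t : ℝ} (ht : t ∈ Icc (0 : ℝ) 1) : Function.update y k t ∈ Icc (0 : Fin s → ℝ) 1 := by
  constructor <;> intro j <;> rcases eq_or_ne j k with rfl | hj
  · simpa using ht.1
  · simpa [hj] using hy.1 j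
  · simpa using ht.2
  · simpa [hj] using hy.2 j

theorem continuous_piecewise_left {s : ℕ} (x : Fin s → ℝ) (S : Finset (Fin s)) :
    Continuous fun y : Fin s → ℝ => S.piecewise y x := by
  refine continuous_pi fun j => ?_
  by_cases hj : j ∈ S <;> simp only [hj, Finset.piecewise_eq_of_mem,
    Finset.piecewise_eq_of_notMem, not_false_eq_true] <;> fun_prop

theorem hasDerivAt_comp_update {s : ℕ} {f : (Fin s → ℝ) → ℝ} {y : Fin s → ℝ} {k : Fin s}
    {t f' : ℝ} (h : HasLineDerivAt ℝ f f' (Function.update y k t) (Pi.single k 1)) :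
    HasDerivAt (fun τ => f (Function.update y k τ)) f' t := by
  have h1 : HasDerivAt (fun τ : ℝ => f (Function.update y k t + τ • Pi.single k 1)) f' (t - t) := by
    simpa [HasLineDerivAt] using h
  refine (h1.comp_sub_const t t).congr_of_eventuallyEq (Filter.Eventually.of_forall fun τ => ?_)
  change f _ = f _
  congr 1
  ext j
  rcases eq_or_ne j k with rfl | hj <;> simp [*]

/-- The representation of a function with continuous mixed first derivatives `F u` on the cube by
its ANOVA-type kernel expansion, performed in the coordinates in `S`. -/
theorem eq_sum_integral_piecewise {s : ℕ} {F : Finset (Fin s) → (Fin s → ℝ) → ℝ}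
    (hc : ∀ u, ContinuousOn (F u) (Icc 0 1))
    (hd : ∀ u, ∀ i ∉ u, ∀ y ∈ Icc (0 : Fin s → ℝ) 1,
      HasLineDerivAt ℝ (F u) (F (insert i u) y) y (Pi.single i 1))
    {x : Fin s → ℝ} (hx : x ∈ Icc (0 : Fin s → ℝ) 1) (S : Finset (Fin s)) :
    F ∅ x = ∑ u ∈ S.powerset,
      ∫ y, F u (S.piecewise y x) * ∏ j ∈ u, anovaKernel (x j) (y j) ∂(cubeMeasure s) := by
  induction S using Finset.induction_on with
  | empty => simp
  | insert k S hk ih =>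
    -- The subsets of `insert k S` come in pairs `u`, `insert k u`; the one-variable formula in
    -- coordinate `k` splits the term of `u` into this pair.
    rw [ih, Finset.sum_powerset_insert hk, ← Finset.sum_add_distrib]
    refine Finset.sum_congr rfl fun u hu => ?_
    have hku : k ∉ u := fun h => hk (Finset.mem_powerset.1 hu h)
    have hcont : ∀ v, ContinuousOn (fun y => F v ((insert k S).piecewise y x)) (Icc 0 1) :=
      fun v => (hc v).comp (continuous_piecewise_left x _).continuousOn
        fun y hy => piecewise_mem_cube hx hy _
    have hi := fun v => integrable_mul_prod_anovaKernel (hcont v) x v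
    have hmp := measurePreserving_update k
    have hi' := fun v => (hmp.integrable_comp_of_integrable (hi v)).integral_prod_left
    simp only [Function.comp_def] at hi'
    rw [← integral_update k (hi u), ← integral_update k (hi (insert k u)),
      ← integral_add (hi' u) (hi' (insert k u))]
    refine integral_congr_ae ?_
    filter_upwards [ae_mem_cube s] with y hy
    have hP := piecewise_mem_cube hx hy S
    have hupd : ∀ t, (insert k S).piecewise (Function.update y k t) x =
        Function.update (S.piecewise y x) k t := by
      intro t
      ext j
      rcases eq_or_ne j k with rfl | hj
      · simp
      · by_cases hjS : j ∈ S <;> simp [hj, hjS, Finset.piecewise]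
    have hprod : ∀ t, ∏ j ∈ u, anovaKernel (x j) (Function.update y k t j) =
        ∏ j ∈ u, anovaKernel (x j) (y j) := by
      refine fun t => Finset.prod_congr rfl fun j hj => ?_
      rw [Function.update_of_ne]
      rintro rfl
      exact hku hj
    simp only [hupd, Finset.prod_insert hku, hprod, Function.update_self]
    have hcu : Continuous fun t : ℝ => Function.update (S.piecewise y x) k t :=
      continuous_const.update k continuous_id
    have hrep := eq_integral_add_integral_anovaKernel
      (g := fun t => F u (Function.update (S.piecewise y x) k t))
      (g' := fun t => F (insert k u) (Function.update (S.piecewise y x) k t))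
      (x := x k) ⟨hx.1 k, hx.2 k⟩
      (fun t ht => hasDerivAt_comp_update (hd u k hku _ (update_mem_cube hP k ht)))
      ((hc _).comp hcu.continuousOn
        fun t ht => update_mem_cube hP k ht)
    -- As `k ∉ S`, coordinate `k` still carries `x k`, so the one-variable formula is evaluated
    -- exactly there.
    have hself : Function.update (S.piecewise y x) k (x k) = S.piecewise y x := by
      rw [Function.update_eq_self_iff, Finset.piecewise_eq_of_notMem _ _ _ hk]
    rw [hself] at hrep
    rw [hrep, add_mul, ← integral_mul_const, ← integral_mul_const]
    simp only [mul_assoc]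

theorem eq_sum_integral_anovaKernel {s : ℕ} {F : Finset (Fin s) → (Fin s → ℝ) → ℝ}
    (hc : ∀ u, ContinuousOn (F u) (Icc 0 1))
    (hd : ∀ u, ∀ i ∉ u, ∀ y ∈ Icc (0 : Fin s → ℝ) 1,
      HasLineDerivAt ℝ (F u) (F (insert i u) y) y (Pi.single i 1))
    {x : Fin s → ℝ} (hx : x ∈ Icc (0 : Fin s → ℝ) 1) :
    F ∅ x = ∑ u, ∫ y, F u y * ∏ j ∈ u, anovaKernel (x j) (y j) ∂(cubeMeasure s) := by
  simpa using eq_sum_integral_piecewise hc hd hx Finset.univ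

end Representation

/-! ### Integrals of coordinatewise products. -/

section Products

theorem prod_mem_eq_prod_ite {s : ℕ} (u : Finset (Fin s)) (h : Fin s → ℝ → ℝ) (y : Fin s → ℝ) :
    ∏ j ∈ u, h j (y j) = ∏ j, (if j ∈ u then h j else fun _ => 1) (y j) := by
  rw [← Finset.prod_subset (Finset.subset_univ u)]
  · exact Finset.prod_congr rfl fun j hj => by simp [hj]
  · intro j _ hj
    simp [hj]

theorem integral_prod_mem {s : ℕ} (u : Finset (Fin s)) (h : Fin s → ℝ → ℝ) :
    ∫ y, ∏ j ∈ u, h j (y j) ∂(cubeMeasure s) = ∏ j ∈ u, ∫ t, h j t ∂unitMeasure := by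
  rw [integral_congr_ae (Filter.Eventually.of_forall (prod_mem_eq_prod_ite u h)),
    integral_fintype_prod_eq_prod,
    ← Finset.prod_subset (Finset.subset_univ u)]
  · exact Finset.prod_congr rfl fun j hj => by simp [hj]
  · intro j _ hj
    simp [hj]

theorem integrable_prod_mem {s : ℕ} (u : Finset (Fin s)) {h : Fin s → ℝ → ℝ}
    (hh : ∀ j, Integrable (h j) unitMeasure) :
    Integrable (fun y => ∏ j ∈ u, h j (y j)) (cubeMeasure s) := by
  refine Integrable.congr ?_
    (Filter.Eventually.of_forall fun y => (prod_mem_eq_prod_ite u h y).symm)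
  refine Integrable.fintype_prod fun j => ?_
  by_cases hj : j ∈ u
  · simpa [hj] using hh j
  · simp [hj]

end Products

/-! ### Averaging the kernel over a random shift. -/

section ShiftAverage

theorem integrable_anovaKernel_mul (a b : ℝ) :
    Integrable (fun t => anovaKernel a t * anovaKernel b t) unitMeasure := by
  refine Integrable.of_bound (C := 1) ((measurable_anovaKernel_right a).mul
    (measurable_anovaKernel_right b)).aestronglyMeasurable ?_
  filter_upwards [ae_restrict_mem measurableSet_Icc] with t ht
  rw [norm_mul]
  exact mul_le_one₀ (abs_anovaKernel_le a ht) (norm_nonneg _) (abs_anovaKernel_le b ht)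

theorem setIntegral_indicator_Ioi {g : ℝ → ℝ} {c : ℝ} (hc : c ∈ Icc (0 : ℝ) 1) :
    ∫ t, (Ioi c).indicator g t ∂unitMeasure = ∫ t in c..1, g t := by
  rw [integral_indicator measurableSet_Ioi, Measure.restrict_restrict measurableSet_Ioi,
    intervalIntegral.integral_of_le hc.2]
  have h2 : Ioi c ∩ Icc 0 1 = Ioc c 1 := by
    ext t
    simp only [mem_inter_iff, mem_Ioi, mem_Icc, mem_Ioc]
    exact ⟨fun h => ⟨h.1, h.2.2⟩, fun h => ⟨h.1, (hc.1.trans_lt h.1).le, h.2⟩⟩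
  rw [h2]

/-- The reproducing-type kernel obtained by integrating out the ANOVA kernel. -/
def gramKernel (a b : ℝ) : ℝ := 1 / 3 + (a ^ 2 + b ^ 2) / 2 - max a b

theorem integral_anovaKernel_mul {a b : ℝ} (ha : a ∈ Icc (0 : ℝ) 1) (hb : b ∈ Icc (0 : ℝ) 1) :
    ∫ t, anovaKernel a t * anovaKernel b t ∂unitMeasure = gramKernel a b := by
  -- The product of the two indicators is the indicator of `t > max a b`, which is where the maximum
  -- in `gramKernel` comes from.
  have h1 : ∀ t, anovaKernel a t * anovaKernel b t =
      t ^ 2 - (Ioi a).indicator (fun t => t) t - (Ioi b).indicator (fun t => t) t +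
        (Ioi (max a b)).indicator (fun _ => 1) t := by
    intro t
    simp only [anovaKernel, indicator_apply, mem_Ioi, max_lt_iff]
    by_cases h : a < t <;> by_cases h' : b < t <;> simp only [h, h', and_self, and_true,
      and_false, if_true, if_false] <;> ring
  have hm : max a b ∈ Icc (0 : ℝ) 1 := ⟨le_max_of_le_left ha.1, max_le ha.2 hb.2⟩
  have hi : ∀ {g : ℝ → ℝ}, Continuous g → Integrable g unitMeasure := fun hg =>
    hg.continuousOn.integrableOn_Icc
  have i1 : Integrable (fun t : ℝ => t ^ 2) unitMeasure := hi (by fun_prop)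
  have i2 : ∀ c : ℝ, Integrable ((Ioi c).indicator (fun t : ℝ => t)) unitMeasure :=
    fun c => (hi continuous_id).indicator measurableSet_Ioi
  have i3 : Integrable ((Ioi (max a b)).indicator (fun _ : ℝ => (1 : ℝ))) unitMeasure :=
    (hi continuous_const).indicator measurableSet_Ioi
  have i4 : Integrable (fun t => t ^ 2 - (Ioi a).indicator (fun t => t) t) unitMeasure :=
    i1.sub (i2 a)
  have i5 : Integrable (fun t => t ^ 2 - (Ioi a).indicator (fun t => t) t -
      (Ioi b).indicator (fun t => t) t) unitMeasure := i4.sub (i2 b)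
  simp only [h1]
  rw [integral_add i5 i3, integral_sub i4 (i2 b), integral_sub i1 (i2 a), setIntegral_indicator_Ioi ha, setIntegral_indicator_Ioi hb,
    setIntegral_indicator_Ioi hm, integral_unitMeasure, integral_pow, integral_id, integral_id,
    intervalIntegral.integral_const, gramKernel, smul_eq_mul]
  norm_num
  ring

theorem fract_mem_unit (x : ℝ) : Int.fract x ∈ Icc (0 : ℝ) 1 :=
  ⟨Int.fract_nonneg x, (Int.fract_lt_one x).le⟩

theorem measurable_gramKernel_fract (x x' : ℝ) :
    Measurable fun t => gramKernel (Int.fract (x + t)) (Int.fract (x' + t)) := by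
  unfold gramKernel
  have h1 : Measurable fun t : ℝ => Int.fract (x + t) := measurable_fract.comp (by fun_prop)
  have h2 : Measurable fun t : ℝ => Int.fract (x' + t) := measurable_fract.comp (by fun_prop)
  exact ((((h1.pow_const 2).add (h2.pow_const 2)).div_const 2).const_add _).sub (h1.max h2)

theorem abs_gramKernel_le {a b : ℝ} (ha : a ∈ Icc (0 : ℝ) 1) (hb : b ∈ Icc (0 : ℝ) 1) :
    |gramKernel a b| ≤ 2 := by
  have hm : max a b ∈ Icc (0 : ℝ) 1 := ⟨le_max_of_le_left ha.1, max_le ha.2 hb.2⟩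
  unfold gramKernel
  rw [abs_le]
  obtain ⟨h1, h2⟩ := ha
  obtain ⟨h3, h4⟩ := hb
  obtain ⟨h5, h6⟩ := hm
  constructor <;> nlinarith

theorem integrable_gramKernel_fract (x x' : ℝ) :
    Integrable (fun t => gramKernel (Int.fract (x + t)) (Int.fract (x' + t))) unitMeasure :=
  Integrable.of_bound (C := 2) (measurable_gramKernel_fract x x').aestronglyMeasurable
    (Filter.Eventually.of_forall fun _ => abs_gramKernel_le (fract_mem_unit _) (fract_mem_unit _))

/-- Averaging the Gram kernel over a common shift gives the second Bernoulli polynomial. -/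
theorem integral_gramKernel_fract (x x' : ℝ) :
    ∫ t, gramKernel (Int.fract (x + t)) (Int.fract (x' + t)) ∂unitMeasure =
      bernoulliFun 2 (Int.fract (x - x')) := by
  set r := Int.fract (x - x') with hr
  have hr0 : 0 ≤ r := Int.fract_nonneg _
  have hr1 : r < 1 := Int.fract_lt_one _
  let h : ℝ → ℝ := fun t => gramKernel (Int.fract (x + t)) (Int.fract (x' + t))
  have hper : Function.Periodic h 1 := fun t => by
    simp only [h, ← add_assoc, Int.fract_add_one]
  -- By periodicity the shift can be translated by `-x'`, so that only the difference `r` of the two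
  -- points remains.
  have e1 : ∫ t, h t ∂unitMeasure = ∫ t in (0 : ℝ)..1, h (t - x') := by
    rw [integral_unitMeasure, intervalIntegral.integral_comp_sub_right]
    have := hper.intervalIntegral_add_eq 0 (0 - x')
    rw [zero_add] at this
    rw [this]
    congr 1
    ring
  have e2 : ∀ t, h (t - x') = gramKernel (Int.fract (r + t)) (Int.fract t) := by
    intro t
    simp only [h]
    congr 1
    · rw [hr, Int.fract_eq_fract]
      refine ⟨⌊x - x'⌋, ?_⟩
      rw [Int.fract]
      ring
    · congr 1
      ring
  have hint : ∀ a b : ℝ, a ≤ b → 0 ≤ a → b ≤ 1 →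
      IntervalIntegrable (fun t => h (t - x')) volume a b := by
    intro a b hab ha hb
    rw [intervalIntegrable_iff_integrableOn_Icc_of_le hab]
    refine Integrable.of_bound (C := 2) ((measurable_gramKernel_fract x x').comp
      (measurable_id.sub_const x')).aestronglyMeasurable
      (Filter.Eventually.of_forall fun _ => abs_gramKernel_le (fract_mem_unit _) (fract_mem_unit _))
  change ∫ t, h t ∂unitMeasure = _
  -- At `t = 1 - r` the point `r + t` wraps around and the order of the two arguments flips; on
  -- either side the integrand is a quadratic polynomial.
  rw [e1, ← intervalIntegral.integral_add_adjacent_intervals (b := 1 - r)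
    (hint _ _ (by linarith) le_rfl (by linarith)) (hint _ _ (by linarith) (by linarith) le_rfl)]
  have e3 : ∫ t in (0 : ℝ)..(1 - r), h (t - x') =
      ∫ t in (0 : ℝ)..(1 - r), (1 / 3 + r ^ 2 / 2 - r) + (r - 1) * t + t ^ 2 := by
    refine intervalIntegral.integral_congr_Ioo_of_le (by linarith) fun t ht => ?_
    have h1 : Int.fract (r + t) = r + t :=
      Int.fract_eq_self.2 ⟨by linarith [ht.1], by linarith [ht.2]⟩
    have h2 : Int.fract t = t := Int.fract_eq_self.2 ⟨by linarith [ht.1], by linarith [ht.2]⟩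
    rw [e2, h1, h2, gramKernel, max_eq_left (by linarith)]
    ring
  have e4 : ∫ t in (1 - r)..1, h (t - x') =
      ∫ t in (1 - r)..1, (1 / 3 + (r - 1) ^ 2 / 2) + (r - 2) * t + t ^ 2 := by
    refine intervalIntegral.integral_congr_Ioo_of_le (by linarith) fun t ht => ?_
    have h1 : Int.fract (r + t) = r + t - 1 := by
      rw [Int.fract_eq_iff]
      exact ⟨by linarith [ht.1], by linarith [ht.2], 1, by push_cast; ring⟩
    have h2 : Int.fract t = t := Int.fract_eq_self.2 ⟨by linarith [ht.1], by linarith [ht.2]⟩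
    rw [e2, h1, h2, gramKernel, max_eq_right (by linarith)]
    ring
  have e5 : ∀ a b c e : ℝ, ∫ t in a..b, c + e * t + t ^ 2 =
      c * (b - a) + e * ((b ^ 2 - a ^ 2) / 2) + (b ^ 3 - a ^ 3) / 3 := by
    intro a b c e
    rw [intervalIntegral.integral_add (Continuous.intervalIntegrable (by fun_prop) _ _)
      (Continuous.intervalIntegrable (by fun_prop) _ _), intervalIntegral.integral_add
      (Continuous.intervalIntegrable (by fun_prop) _ _)
      (Continuous.intervalIntegrable (by fun_prop) _ _), intervalIntegral.integral_const,
      intervalIntegral.integral_const_mul, integral_id, integral_pow, smul_eq_mul]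
    norm_num
    ring
  rw [e3, e4, e5, e5, bernoulliFun_two]
  ring

end ShiftAverage

/-! ### Lattice sums over residues modulo `n`. -/

section PeriodicSums

variable {n : ℕ} [NeZero n]

/-- The second Bernoulli polynomial at `c / n`, as a function on `ℤ/nℤ`. -/
def bernoulliZMod (n : ℕ) (c : ZMod n) : ℝ := bernoulliFun 2 ((c.val : ℝ) / n)

theorem bernoulliFun_fract_intCast_div (k : ℤ) :
    bernoulliFun 2 (Int.fract ((k : ℝ) / n)) = bernoulliZMod n k := by
  rw [bernoulliZMod, Int.fract_div_intCast_eq_div_intCast_mod, ← ZMod.val_intCast]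
  simp

theorem bernoulliFun_fract_natCast_mul_div (i c : ℕ) :
    bernoulliFun 2 (Int.fract ((i : ℝ) * (c : ℝ) / n)) = bernoulliZMod n (i * c) := by
  have := bernoulliFun_fract_intCast_div (n := n) ((i * c : ℕ) : ℤ)
  push_cast at this
  exact this

theorem sum_range_eq_sum_zmod (g : ZMod n → ℝ) :
    ∑ i ∈ Finset.range n, g i = ∑ a, g a := by
  refine Finset.sum_bij' (fun i _ => (i : ZMod n)) (fun a _ => a.val) (by simp)
    (fun a _ => Finset.mem_range.2 a.val_lt) (fun i hi => ?_) (fun a _ => by simp)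
    (fun _ _ => rfl)
  exact ZMod.val_cast_of_lt (Finset.mem_range.1 hi)

theorem sum_Icc_one_eq_sum_zmod (g : ZMod n → ℝ) :
    ∑ i ∈ Finset.Icc 1 n, g i = ∑ a, g a := by
  rw [← Equiv.sum_comp (Equiv.addRight (1 : ZMod n)), ← sum_range_eq_sum_zmod,
    Finset.range_eq_Ico, ← Finset.Ico_add_one_right_eq_Icc]
  rw [show 1 = 0 + 1 from rfl, ← Finset.sum_Ico_add' (fun i : ℕ => g i) 0 n 1]
  simp

end PeriodicSums

/-! ### The root-mean-square error and the shift-averaged worst-case error. -/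

section RmsError

/-- The squared shift-averaged worst-case error of the lattice rule. -/
def shiftAveragedErrorSq {s : ℕ} (n : ℕ) (γ : Finset (Fin s) → ℝ) (z : Fin s → ℕ) : ℝ :=
  ∑ u : Finset (Fin s) with u.Nonempty, γ u * ((1 / (n : ℝ)) * ∑ i ∈ Finset.range n,
    ∏ j ∈ u, bernoulliFun 2 (Int.fract ((i : ℝ) * (z j : ℝ) / (n : ℝ))))

/-- The `i`-th point of the shifted lattice. -/
def latticePoint {s : ℕ} (n : ℕ) (z : Fin s → ℕ) (Δ : Fin s → ℝ) (i : ℕ) : Fin s → ℝ :=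
  fun j => Int.fract ((i : ℝ) * (z j : ℝ) / (n : ℝ) + Δ j)

/-- The quadrature error of the ANOVA kernel with index set `u`. -/
def kernelError {s : ℕ} (n : ℕ) (z : Fin s → ℕ) (u : Finset (Fin s)) (Δ y : Fin s → ℝ) : ℝ :=
  (1 / (n : ℝ)) * ∑ i ∈ Finset.Icc 1 n, ∏ j ∈ u, anovaKernel (latticePoint n z Δ i j) (y j)

theorem latticePoint_mem_cube {s : ℕ} (n : ℕ) (z : Fin s → ℕ) (Δ : Fin s → ℝ) (i : ℕ) :
    latticePoint n z Δ i ∈ Icc (0 : Fin s → ℝ) 1 :=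
  ⟨fun _ => (fract_mem_unit _).1, fun _ => (fract_mem_unit _).2⟩

theorem measurable_kernelError {s : ℕ} (n : ℕ) (z : Fin s → ℕ) (u : Finset (Fin s))
    (Δ : Fin s → ℝ) : Measurable (kernelError n z u Δ) :=
  (Finset.measurable_sum _ fun _ _ => measurable_prod_anovaKernel _ u).const_mul _

theorem kernelError_sq {s : ℕ} (n : ℕ) (z : Fin s → ℕ) (u : Finset (Fin s)) (Δ y : Fin s → ℝ) :
    kernelError n z u Δ y ^ 2 = (1 / (n : ℝ)) ^ 2 * ∑ i ∈ Finset.Icc 1 n, ∑ i' ∈ Finset.Icc 1 n,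
      ∏ j ∈ u, (anovaKernel (latticePoint n z Δ i j) (y j) *
        anovaKernel (latticePoint n z Δ i' j) (y j)) := by
  simp only [kernelError, mul_pow, sq (∑ _ ∈ _, _), Finset.sum_mul_sum, Finset.prod_mul_distrib]

theorem integrable_kernelError_sq {s : ℕ} (n : ℕ) (z : Fin s → ℕ) (u : Finset (Fin s))
    (Δ : Fin s → ℝ) : Integrable (fun y => kernelError n z u Δ y ^ 2) (cubeMeasure s) := by
  simp only [kernelError_sq]
  exact (integrable_finsetSum _ fun i _ => integrable_finsetSum _ fun i' _ =>
    integrable_prod_mem u fun j => integrable_anovaKernel_mul _ _).const_mul _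

theorem integral_kernelError_sq {s : ℕ} (n : ℕ) (z : Fin s → ℕ) (u : Finset (Fin s))
    (Δ : Fin s → ℝ) :
    ∫ y, kernelError n z u Δ y ^ 2 ∂(cubeMeasure s) =
      (1 / (n : ℝ)) ^ 2 * ∑ i ∈ Finset.Icc 1 n, ∑ i' ∈ Finset.Icc 1 n,
        ∏ j ∈ u, gramKernel (latticePoint n z Δ i j) (latticePoint n z Δ i' j) := by
  have hi : ∀ i i', Integrable (fun y : Fin s → ℝ => ∏ j ∈ u,
      (anovaKernel (latticePoint n z Δ i j) (y j) *
        anovaKernel (latticePoint n z Δ i' j) (y j))) (cubeMeasure s) :=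
    fun i i' => integrable_prod_mem u fun j => integrable_anovaKernel_mul _ _
  simp only [kernelError_sq]
  rw [integral_const_mul, integral_finsetSum _ fun i _ => integrable_finsetSum _ fun i' _ =>
    hi i i']
  congr 1
  refine Finset.sum_congr rfl fun i _ => ?_
  rw [integral_finsetSum _ fun i' _ => hi i i']
  refine Finset.sum_congr rfl fun i' _ => ?_
  rw [integral_prod_mem u fun j t => anovaKernel (latticePoint n z Δ i j) t *
    anovaKernel (latticePoint n z Δ i' j) t]
  exact Finset.prod_congr rfl fun j _ =>
    integral_anovaKernel_mul (fract_mem_unit _) (fract_mem_unit _)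

theorem integrable_integral_kernelError_sq {s : ℕ} (n : ℕ) (z : Fin s → ℕ)
    (u : Finset (Fin s)) :
    Integrable (fun Δ => ∫ y, kernelError n z u Δ y ^ 2 ∂(cubeMeasure s)) (cubeMeasure s) := by
  simp only [integral_kernelError_sq]
  exact (integrable_finsetSum _ fun i _ => integrable_finsetSum _ fun i' _ =>
    integrable_prod_mem u fun j => integrable_gramKernel_fract _ _).const_mul _

/-- After averaging, the `(i, i')` term depends only on `i - i'` modulo `n`, so the double sum is
`n` copies of a single sum and `1 / n²` becomes `1 / n`. -/
theorem integral_integral_kernelError_sq {s n : ℕ} [NeZero n] (z : Fin s → ℕ)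
    (u : Finset (Fin s)) :
    ∫ Δ, ∫ y, kernelError n z u Δ y ^ 2 ∂(cubeMeasure s) ∂(cubeMeasure s) =
      (1 / (n : ℝ)) * ∑ i ∈ Finset.range n,
        ∏ j ∈ u, bernoulliFun 2 (Int.fract ((i : ℝ) * (z j : ℝ) / (n : ℝ))) := by
  have hi : ∀ i i', Integrable (fun Δ : Fin s → ℝ => ∏ j ∈ u,
      gramKernel (latticePoint n z Δ i j) (latticePoint n z Δ i' j)) (cubeMeasure s) :=
    fun i i' => integrable_prod_mem u fun j => integrable_gramKernel_fract _ _
  have hval : ∀ i i' : ℕ, ∫ Δ : Fin s → ℝ, ∏ j ∈ u,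
      gramKernel (latticePoint n z Δ i j) (latticePoint n z Δ i' j) ∂(cubeMeasure s) =
      ∏ j ∈ u, bernoulliZMod n (((i : ZMod n) - i') * z j) := by
    intro i i'
    refine (integral_prod_mem u fun j t => gramKernel
      (Int.fract ((i : ℝ) * (z j : ℝ) / (n : ℝ) + t))
      (Int.fract ((i' : ℝ) * (z j : ℝ) / (n : ℝ) + t))).trans ?_
    refine Finset.prod_congr rfl fun j _ => ?_
    rw [integral_gramKernel_fract]
    have := bernoulliFun_fract_intCast_div (n := n) (((i : ℤ) - i') * z j)
    push_cast at this
    rw [← this]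
    congr 2
    ring
  simp only [integral_kernelError_sq]
  rw [integral_const_mul, integral_finsetSum _ fun i _ => integrable_finsetSum _ fun i' _ =>
    hi i i']
  have hsum : ∀ i, ∫ Δ : Fin s → ℝ, ∑ i' ∈ Finset.Icc 1 n, ∏ j ∈ u,
      gramKernel (latticePoint n z Δ i j) (latticePoint n z Δ i' j) ∂(cubeMeasure s) =
      ∑ a : ZMod n, ∏ j ∈ u, bernoulliZMod n (a * z j) := by
    intro i
    rw [integral_finsetSum _ fun i' _ => hi i i']
    simp only [hval]
    rw [sum_Icc_one_eq_sum_zmod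
        fun a : ZMod n => ∏ j ∈ u, bernoulliZMod n (((i : ZMod n) - a) * z j),
      ← Equiv.sum_comp (Equiv.subLeft (i : ZMod n))]
    simp
  simp only [hsum, bernoulliFun_fract_natCast_mul_div]
  rw [sum_range_eq_sum_zmod fun a : ZMod n => ∏ j ∈ u, bernoulliZMod n (a * z j),
    Finset.sum_const, Nat.card_Icc, nsmul_eq_mul]
  have hn : (n : ℝ) ≠ 0 := Nat.cast_ne_zero.2 (NeZero.ne n)
  simp only [Nat.add_sub_cancel]
  field_simp

/-- This is nonnegativity of the variance of `|g|`, the cube carrying a probability measure. -/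
theorem sq_integral_le_integral_sq {s : ℕ} {g : (Fin s → ℝ) → ℝ} (hg : Measurable g)
    (hg2 : Integrable (fun y => g y ^ 2) (cubeMeasure s)) :
    (∫ y, |g y| ∂(cubeMeasure s)) ^ 2 ≤ ∫ y, g y ^ 2 ∂(cubeMeasure s) := by
  have hm : MemLp (fun y => |g y|) 2 (cubeMeasure s) := by
    rw [memLp_two_iff_integrable_sq (by fun_prop)]
    simpa using hg2
  have h := ProbabilityTheory.variance_nonneg (fun y => |g y|) (cubeMeasure s)
  rw [ProbabilityTheory.variance_eq_sub hm] at h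
  simpa using h

variable {s n : ℕ} [NeZero n] {z : Fin s → ℕ} {F : Finset (Fin s) → (Fin s → ℝ) → ℝ}
  {K γ : Finset (Fin s) → ℝ}

/-- The quadrature error in terms of the mixed first derivatives. -/
theorem integral_sub_latticeRule_eq (hc : ∀ u, ContinuousOn (F u) (Icc 0 1))
    (hd : ∀ u, ∀ i ∉ u, ∀ y ∈ Icc (0 : Fin s → ℝ) 1,
      HasLineDerivAt ℝ (F u) (F (insert i u) y) y (Pi.single i 1)) (Δ : Fin s → ℝ) :
    (∫ t in Icc (0 : Fin s → ℝ) 1, F ∅ t) - latticeRule n z Δ (F ∅) =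
      -∑ u with u.Nonempty, ∫ y, F u y * kernelError n z u Δ y ∂(cubeMeasure s) := by
  have hn : (n : ℝ) ≠ 0 := Nat.cast_ne_zero.2 (NeZero.ne n)
  have h1 : latticeRule n z Δ (F ∅) =
      ∑ u, ∫ y, F u y * kernelError n z u Δ y ∂(cubeMeasure s) := by
    have h2 : ∀ i : ℕ, F ∅ (fun j => Int.fract ((i : ℝ) * (z j : ℝ) / (n : ℝ) + Δ j)) =
        ∑ u, ∫ y, F u y * ∏ j ∈ u, anovaKernel (latticePoint n z Δ i j) (y j)
          ∂(cubeMeasure s) :=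
      fun i => eq_sum_integral_anovaKernel hc hd (latticePoint_mem_cube n z Δ i)
    simp only [latticeRule, h2]
    rw [Finset.sum_comm, Finset.mul_sum]
    refine Finset.sum_congr rfl fun u _ => ?_
    rw [← integral_finsetSum _ fun i _ => integrable_mul_prod_anovaKernel (hc u) _ u,
      ← integral_const_mul]
    refine integral_congr_ae (Filter.Eventually.of_forall fun y => ?_)
    simp only [kernelError, Finset.mul_sum]
    exact Finset.sum_congr rfl fun i _ => by ring
  have h3 : (Finset.univ.filter fun u : Finset (Fin s) => u.Nonempty) =
      Finset.univ.erase ∅ := by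
    ext u
    simp [Finset.nonempty_iff_ne_empty]
  rw [h1, h3, ← Finset.add_sum_erase _ _ (Finset.mem_univ ∅), volume_restrict_cube]
  -- The term of the empty set is the exact integral, which cancels.
  have h4 : ∀ y, kernelError n z ∅ Δ y = 1 := by
    intro y
    simp [kernelError, hn]
  simp [h4]

/-- Cauchy–Schwarz is used twice: in `y` for each `u`, and over `u` after inserting `γ u` and its
inverse. -/
theorem sq_integral_sub_latticeRule_le (hc : ∀ u, ContinuousOn (F u) (Icc 0 1))
    (hd : ∀ u, ∀ i ∉ u, ∀ y ∈ Icc (0 : Fin s → ℝ) 1,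
      HasLineDerivAt ℝ (F u) (F (insert i u) y) y (Pi.single i 1))
    (hK : ∀ u, ∀ y ∈ Icc (0 : Fin s → ℝ) 1, |F u y| ≤ K u)
    (hγ : ∀ u, 0 ≤ γ u ∧ (γ u = 0 → K u = 0)) (Δ : Fin s → ℝ) :
    ((∫ t in Icc (0 : Fin s → ℝ) 1, F ∅ t) - latticeRule n z Δ (F ∅)) ^ 2 ≤
      (∑ u, K u ^ 2 / γ u) *
        ∑ u with u.Nonempty, γ u * ∫ y, kernelError n z u Δ y ^ 2 ∂(cubeMeasure s) := by
  have hK0 : ∀ u, 0 ≤ K u := fun u =>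
    (abs_nonneg _).trans (hK u 0 ⟨le_rfl, fun _ => zero_le_one⟩)
  have hint : ∀ u, 0 ≤ ∫ y, kernelError n z u Δ y ^ 2 ∂(cubeMeasure s) := fun u =>
    integral_nonneg fun _ => sq_nonneg _
  rw [integral_sub_latticeRule_eq hc hd, neg_sq]
  have h1 : ∀ u, |∫ y, F u y * kernelError n z u Δ y ∂(cubeMeasure s)| ≤
      K u * √(∫ y, kernelError n z u Δ y ^ 2 ∂(cubeMeasure s)) := by
    intro u
    have hsq := sq_integral_le_integral_sq (measurable_kernelError n z u Δ)
      (integrable_kernelError_sq n z u Δ)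
    have hm : MemLp (kernelError n z u Δ) 2 (cubeMeasure s) :=
      (memLp_two_iff_integrable_sq (measurable_kernelError n z u Δ).aestronglyMeasurable).2
        (integrable_kernelError_sq n z u Δ)
    have hi : Integrable (fun y => K u * |kernelError n z u Δ y|) (cubeMeasure s) :=
      (hm.integrable (by norm_num)).abs.const_mul _
    calc |∫ y, F u y * kernelError n z u Δ y ∂(cubeMeasure s)|
        ≤ ∫ y, K u * |kernelError n z u Δ y| ∂(cubeMeasure s) := by
          rw [← Real.norm_eq_abs]
          refine norm_integral_le_of_norm_le hi ?_
          filter_upwards [ae_mem_cube s] with y hy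
          rw [norm_mul]
          exact mul_le_mul_of_nonneg_right (hK u y hy) (abs_nonneg _)
      _ = K u * ∫ y, |kernelError n z u Δ y| ∂(cubeMeasure s) := integral_const_mul _ _
      _ ≤ _ := mul_le_mul_of_nonneg_left (Real.le_sqrt_of_sq_le hsq) (hK0 u)
  have h2 : |∑ u with u.Nonempty, ∫ y, F u y * kernelError n z u Δ y ∂(cubeMeasure s)| ≤
      ∑ u with u.Nonempty, K u * √(∫ y, kernelError n z u Δ y ^ 2 ∂(cubeMeasure s)) :=
    (Finset.abs_sum_le_sum_abs _ _).trans (Finset.sum_le_sum fun u _ => h1 u)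
  have h3 := pow_le_pow_left₀ (abs_nonneg _) h2 2
  rw [sq_abs] at h3
  refine h3.trans ?_
  refine (Finset.sum_sq_le_sum_mul_sum_of_sq_le_mul _ (f := fun u => K u ^ 2 / γ u)
    (g := fun u => γ u * ∫ y, kernelError n z u Δ y ^ 2 ∂(cubeMeasure s))
    (fun u _ => div_nonneg (sq_nonneg _) (hγ u).1) (fun u _ => mul_nonneg (hγ u).1 (hint u))
    fun u _ => ?_).trans ?_
  · rw [mul_pow, Real.sq_sqrt (hint u)]
    -- A vanishing weight forces `K u = 0`, so the convention `0 / 0 = 0` loses nothing.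
    rcases eq_or_ne (γ u) 0 with h | h
    · simp [h, (hγ u).2 h]
    · field_simp
      exact le_rfl
  · refine mul_le_mul_of_nonneg_right ?_
      (Finset.sum_nonneg fun u _ => mul_nonneg (hγ u).1 (hint u))
    exact Finset.sum_le_sum_of_subset_of_nonneg (Finset.filter_subset _ _)
      fun u _ _ => div_nonneg (sq_nonneg _) (hγ u).1

theorem rmsError_le (hc : ∀ u, ContinuousOn (F u) (Icc 0 1))
    (hd : ∀ u, ∀ i ∉ u, ∀ y ∈ Icc (0 : Fin s → ℝ) 1,
      HasLineDerivAt ℝ (F u) (F (insert i u) y) y (Pi.single i 1))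
    (hK : ∀ u, ∀ y ∈ Icc (0 : Fin s → ℝ) 1, |F u y| ≤ K u)
    (hγ : ∀ u, 0 ≤ γ u ∧ (γ u = 0 → K u = 0)) :
    rmsError n z (F ∅) ≤
      ENNReal.ofReal (√((∑ u, K u ^ 2 / γ u) * shiftAveragedErrorSq n γ z)) := by
  have hi : Integrable (fun Δ => (∑ u, K u ^ 2 / γ u) *
      ∑ u with u.Nonempty, γ u * ∫ y, kernelError n z u Δ y ^ 2 ∂(cubeMeasure s))
      (cubeMeasure s) :=
    (integrable_finsetSum _ fun u _ =>
      (integrable_integral_kernelError_sq n z u).const_mul _).const_mul _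
  have hle := sq_integral_sub_latticeRule_le (n := n) (z := z) hc hd hK hγ
  have hval : ∫ Δ, (∑ u, K u ^ 2 / γ u) *
      ∑ u with u.Nonempty, γ u * ∫ y, kernelError n z u Δ y ^ 2 ∂(cubeMeasure s)
      ∂(cubeMeasure s) = (∑ u, K u ^ 2 / γ u) * shiftAveragedErrorSq n γ z := by
    rw [integral_const_mul, integral_finsetSum _ fun u _ =>
      (integrable_integral_kernelError_sq n z u).const_mul _]
    congr 1
    refine Finset.sum_congr rfl fun u _ => ?_
    rw [integral_const_mul, integral_integral_kernelError_sq]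
  -- Nonnegativity is read off from the integral of an upper bound for a square; the `B₂` sums do
  -- not show it directly.
  have h0 : 0 ≤ (∑ u, K u ^ 2 / γ u) * shiftAveragedErrorSq n γ z := by
    rw [← hval]
    exact integral_nonneg fun Δ => (sq_nonneg _).trans (hle Δ)
  rw [rmsError, Real.sqrt_eq_rpow, ← ENNReal.ofReal_rpow_of_nonneg h0 (by norm_num)]
  refine ENNReal.rpow_le_rpow ?_ (by norm_num)
  rw [← hval, ofReal_integral_eq_lintegral_ofReal hi
    (Filter.Eventually.of_forall fun Δ => (sq_nonneg _).trans (hle Δ)), volume_restrict_cube]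
  exact lintegral_mono fun Δ => ENNReal.ofReal_le_ofReal (by
    simpa only [volume_restrict_cube] using hle Δ)

end RmsError

/-! ### Subadditivity of `x ↦ x^p` for `0 < p ≤ 1`. -/

section RealPowers

theorem rpow_sum_le_sum_rpow {ι : Type*} (S : Finset ι) {f : ι → ℝ} {p : ℝ} (hp : 0 < p)
    (hp1 : p ≤ 1) (hf : ∀ i ∈ S, 0 ≤ f i) : (∑ i ∈ S, f i) ^ p ≤ ∑ i ∈ S, f i ^ p := by
  classical
  induction S using Finset.induction_on with
  | empty => simp [Real.zero_rpow hp.ne']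
  | insert i S hi ih =>
    rw [Finset.sum_insert hi, Finset.sum_insert hi]
    have h1 : 0 ≤ f i := hf i (by simp)
    have h2 : ∀ j ∈ S, 0 ≤ f j := fun j hj => hf j (by simp [hj])
    exact (Real.rpow_add_le_add_rpow h1 (Finset.sum_nonneg h2) hp.le hp1).trans
      (add_le_add_right (ih h2) _)

theorem rpow_tsum_le_tsum_rpow {ι : Type*} {f : ι → ℝ} {p : ℝ} (hp : 0 < p)
    (hp1 : p ≤ 1) (hf : ∀ i, 0 ≤ f i) (hs : Summable f) (hs' : Summable fun i => f i ^ p) :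
    (∑' i, f i) ^ p ≤ ∑' i, f i ^ p := by
  have h1 := (Real.continuousAt_rpow_const (∑' i, f i) p (Or.inr hp.le)).tendsto.comp hs.hasSum
  refine le_of_tendsto h1 (Filter.Eventually.of_forall fun S => ?_)
  exact (rpow_sum_le_sum_rpow S hp hp1 fun i _ => hf i).trans
    (hs'.sum_le_tsum S fun i _ => Real.rpow_nonneg (hf i) p)

end RealPowers

/-! ### Fourier coefficients of `B₂`, grouped by residue classes. -/

section FourierWeights

/-- The `λ`-th power of the Fourier coefficients of the second Bernoulli polynomial. -/
def fourierWeight (lam : ℝ) (h : ℤ) : ℝ := (1 / (2 * Real.pi ^ 2 * (h : ℝ) ^ 2)) ^ lam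

theorem fourierWeight_nonneg (lam : ℝ) (h : ℤ) : 0 ≤ fourierWeight lam h := by
  unfold fourierWeight
  positivity

theorem fourierWeight_eq {lam : ℝ} (hlam : 0 < lam) (h : ℤ) :
    fourierWeight lam h = |(h : ℝ)| ^ (-(2 * lam)) / (2 * Real.pi ^ 2) ^ lam := by
  unfold fourierWeight
  -- At frequency zero both sides vanish by the conventions `1 / 0 = 0` and `0 ^ x = 0` for `x ≠ 0`,
  -- in agreement with `B₂` having mean zero.
  rcases eq_or_ne h 0 with rfl | hh
  · simp [Real.zero_rpow hlam.ne', Real.zero_rpow (show -(2 * lam) ≠ 0 by linarith)]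
  · have h0 : 0 < |(h : ℝ)| := abs_pos.2 (Int.cast_ne_zero.2 hh)
    rw [← sq_abs (h : ℝ), Real.div_rpow zero_le_one (by positivity), Real.one_rpow,
      Real.mul_rpow (by positivity) (by positivity), Real.rpow_neg h0.le, Real.rpow_mul h0.le,
      Real.rpow_two]
    field_simp

theorem summable_fourierWeight {lam : ℝ} (hlam : 1 / 2 < lam) :
    Summable (fourierWeight lam) := by
  have h := (Real.summable_abs_int_rpow (b := 2 * lam) (by linarith)).div_const
    ((2 * Real.pi ^ 2) ^ lam)
  exact h.congr fun h => (fourierWeight_eq (by linarith) h).symm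

theorem tsum_fourierWeight {lam : ℝ} (hlam : 1 / 2 < lam) :
    ∑' h, fourierWeight lam h = vartheta lam := by
  have hl : 0 < lam := by linarith
  have hs : Summable fun k : ℕ => ((k : ℝ) + 1) ^ (-(2 * lam)) := by
    have := (summable_nat_add_iff 1).2
      (Real.summable_nat_rpow (p := -(2 * lam)) |>.2 (by linarith))
    simpa using this
  have hn : HasSum (fun k : ℕ => fourierWeight lam (k + 1 : ℤ))
      ((∑' k : ℕ, ((k : ℝ) + 1) ^ (-(2 * lam))) / (2 * Real.pi ^ 2) ^ lam) := by
    refine (hs.hasSum.div_const _).congr_fun fun k => ?_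
    rw [fourierWeight_eq hl]
    push_cast
    rw [abs_of_nonneg (by positivity)]
  have hn' : HasSum (fun k : ℕ => fourierWeight lam (-(k + 1 : ℤ)))
      ((∑' k : ℕ, ((k : ℝ) + 1) ^ (-(2 * lam))) / (2 * Real.pi ^ 2) ^ lam) := by
    refine hn.congr_fun fun k => ?_
    simp only [fourierWeight]
    push_cast
    rw [neg_sq]
  have h0 : fourierWeight lam 0 = 0 := by
    simp [fourierWeight, Real.zero_rpow hl.ne']
  have hn0 : HasSum (fun k : ℕ => fourierWeight lam (k : ℤ))
      ((∑' k : ℕ, ((k : ℝ) + 1) ^ (-(2 * lam))) / (2 * Real.pi ^ 2) ^ lam) := by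
    rw [← hasSum_nat_add_iff' 1]
    simpa [h0] using hn
  rw [(hn0.of_nat_of_neg_add_one hn').tsum_eq, vartheta]
  ring

theorem vartheta_pos {lam : ℝ} (hlam : 1 / 2 < lam) : 0 < vartheta lam := by
  rw [← tsum_fourierWeight hlam]
  refine (summable_fourierWeight hlam).tsum_pos (fourierWeight_nonneg lam) 1 ?_
  unfold fourierWeight
  positivity

theorem fourierWeight_mul {lam : ℝ} (hlam : 0 < lam) (g : ℕ) (h : ℤ) :
    fourierWeight lam (g * h) = (g : ℝ) ^ (-(2 * lam)) * fourierWeight lam h := by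
  rw [fourierWeight_eq hlam, fourierWeight_eq hlam]
  push_cast
  rw [abs_mul, Real.mul_rpow (abs_nonneg _) (abs_nonneg _), Nat.abs_cast]
  ring

variable {n : ℕ}

/-- The total Fourier weight of a residue class modulo `n`. -/
def residueWeight (n : ℕ) (lam : ℝ) (a : ZMod n) : ℝ :=
  ∑' h : ℤ, if (h : ZMod n) = a then fourierWeight lam h else 0

theorem summable_residue {lam : ℝ} (hlam : 1 / 2 < lam) (a : ZMod n) :
    Summable fun h : ℤ => if (h : ZMod n) = a then fourierWeight lam h else 0 := by
  refine Summable.of_nonneg_of_le (fun h => ?_) (fun h => ?_) (summable_fourierWeight hlam)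
  · split_ifs <;> simp [fourierWeight_nonneg]
  · split_ifs <;> simp [fourierWeight_nonneg]

theorem residueWeight_nonneg (lam : ℝ) (a : ZMod n) : 0 ≤ residueWeight n lam a :=
  tsum_nonneg fun h => by split_ifs <;> simp [fourierWeight_nonneg]

theorem residueWeight_one_rpow_le {lam : ℝ} (hlam : lam ∈ Ioc (1 / 2 : ℝ) 1) (a : ZMod n) :
    residueWeight n 1 a ^ lam ≤ residueWeight n lam a := by
  have hl : 0 < lam := by linarith [hlam.1]
  have hpow : ∀ h : ℤ, (if (h : ZMod n) = a then fourierWeight 1 h else 0) ^ lam =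
      if (h : ZMod n) = a then fourierWeight lam h else 0 := by
    intro h
    split_ifs
    · simp [fourierWeight]
    · exact Real.zero_rpow hl.ne'
  have := rpow_tsum_le_tsum_rpow
    (f := fun h : ℤ => if (h : ZMod n) = a then fourierWeight 1 h else 0)
    hl hlam.2 (fun h => by split_ifs <;> simp [fourierWeight_nonneg])
    (summable_residue (by norm_num) a) (by simpa only [hpow] using summable_residue hlam.1 a)
  simp only [hpow] at this
  exact this

variable [NeZero n]

theorem sum_residueWeight {lam : ℝ} (hlam : 1 / 2 < lam) :
    ∑ a, residueWeight n lam a = vartheta lam := by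
  rw [← tsum_fourierWeight hlam]
  have h := hasSum_sum (s := Finset.univ) fun a _ => (summable_residue (n := n) hlam a).hasSum
  simp only [Finset.sum_ite_eq, Finset.mem_univ, if_true] at h
  exact h.tsum_eq.symm

/-- The discrete Fourier expansion of the second Bernoulli polynomial. -/
theorem bernoulliZMod_eq_sum (c : ZMod n) :
    (bernoulliZMod n c : ℂ) = ∑ a, (residueWeight n 1 a : ℂ) * ZMod.stdAddChar (a * c) := by
  have hn : (n : ℝ) ≠ 0 := Nat.cast_ne_zero.2 (NeZero.ne n)
  have hx : (c.val : ℝ) / n ∈ Icc (0 : ℝ) 1 := by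
    refine ⟨by positivity, div_le_one_of_le₀ ?_ (by positivity)⟩
    exact_mod_cast c.val_lt.le
  have h1 := (hasSum_one_div_pow_mul_fourier_mul_bernoulliFun (k := 2) le_rfl hx).mul_left
    (1 / (2 * (Real.pi : ℂ) ^ 2))
  have hpi : (Real.pi : ℂ) ≠ 0 := by exact_mod_cast Real.pi_ne_zero
  have hval : 1 / (2 * (Real.pi : ℂ) ^ 2) * (-(2 * Real.pi * Complex.I) ^ 2 / (2 ! : ℕ) *
      bernoulliFun 2 (c.val / n : ℝ)) = (bernoulliZMod n c : ℂ) := by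
    rw [bernoulliZMod, mul_pow, Complex.I_sq]
    push_cast [Nat.factorial]
    field_simp
  rw [hval] at h1
  -- At the points `c / n` the exponential depends only on the residue of the frequency, so the
  -- series can be grouped into `n` classes.
  have h2 : HasSum (fun h : ℤ => ∑ a : ZMod n,
      ((if (h : ZMod n) = a then fourierWeight 1 h else 0 : ℝ) : ℂ) * ZMod.stdAddChar (a * c))
      (∑ a, (residueWeight n 1 a : ℂ) * ZMod.stdAddChar (a * c)) :=
    hasSum_sum fun a _ => (Complex.hasSum_ofReal.2
      (summable_residue (n := n) (lam := 1) (by norm_num) a).hasSum).mul_right _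
  refine h1.unique (h2.congr_fun fun h => ?_)
  have h3 : ∀ a : ZMod n, ((if (h : ZMod n) = a then fourierWeight 1 h else 0 : ℝ) : ℂ) *
      ZMod.stdAddChar (a * c) = if (h : ZMod n) = a then
        (fourierWeight 1 h : ℂ) * ZMod.stdAddChar ((h : ZMod n) * c) else 0 := by
    intro a
    split_ifs with hh
    · rw [hh]
    · simp
  simp only [h3, Finset.sum_ite_eq, Finset.mem_univ, if_true]
  have h4 : (h : ZMod n) * c = ((h * c.val : ℤ) : ZMod n) := by
    push_cast
    rw [ZMod.natCast_zmod_val]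
  rw [h4, ZMod.stdAddChar_coe, fourier_coe_apply, fourierWeight, Real.rpow_one, ← mul_assoc]
  congr 1
  · push_cast
    ring
  · congr 1
    push_cast
    ring

/-- If `v` and `w` are solutions, `h` annihilates `v - w`, hence so does `t = h w`, and by Bézout so
does `gcd(t, n)`. A cyclic group has at most `g` elements annihilated by `g`. -/
theorem card_units_mul_eq_le (h : ZMod n) (t : ZMod n) :
    (Finset.univ.filter fun v : (ZMod n)ˣ => h * v = t).card ≤ Nat.gcd t.val n := by
  classical
  have hg : 0 < Nat.gcd t.val n := Nat.gcd_pos_of_pos_right _ (NeZero.pos n)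
  rcases (Finset.univ.filter fun v : (ZMod n)ˣ => h * v = t).eq_empty_or_nonempty with h0 | ⟨w, hw⟩
  · rw [h0, Finset.card_empty]
    exact Nat.zero_le _
  · rw [Finset.mem_filter] at hw
    refine le_trans ?_ (IsAddCyclic.card_nsmul_eq_zero_le (α := ZMod n) hg)
    refine Finset.card_le_card_of_injOn (fun v => (v : ZMod n) - w) ?_ ?_
    · intro v hv
      simp only [Finset.coe_filter, Finset.mem_univ, true_and, mem_ofPred_eq] at hv ⊢
      have hb : ((Nat.gcd t.val n : ℕ) : ZMod n) = t * ((Nat.gcdA t.val n : ℤ) : ZMod n) := by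
        have := congrArg (Int.cast : ℤ → ZMod n) (Nat.gcd_eq_gcd_ab t.val n)
        push_cast at this
        simpa using this
      rw [nsmul_eq_mul, hb]
      have : h * ((v : ZMod n) - w) = 0 := by rw [mul_sub, hv, hw.2, sub_self]
      calc t * ((Nat.gcdA t.val n : ℤ) : ZMod n) * ((v : ZMod n) - w)
          = w * ((Nat.gcdA t.val n : ℤ) : ZMod n) * (h * ((v : ZMod n) - w)) := by
            rw [← hw.2]; ring
        _ = 0 := by rw [this, mul_zero]
    · intro v _ v' _ hvv
      simpa [Units.ext_iff] using hvv

theorem gcd_dvd_of_mul_unit_eq {h : ℤ} {t : ZMod n} {v : (ZMod n)ˣ} (hv : (h : ZMod n) * v = t) :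
    ((Nat.gcd t.val n : ℕ) : ℤ) ∣ h := by
  have h1 : (h : ZMod n) = ((t.val * (v⁻¹ : (ZMod n)ˣ).val.val : ℤ) : ZMod n) := by
    push_cast
    rw [ZMod.natCast_zmod_val, ZMod.natCast_zmod_val, ← hv, mul_assoc]
    simp
  rw [ZMod.intCast_eq_intCast_iff_dvd_sub] at h1
  have h2 : ((Nat.gcd t.val n : ℕ) : ℤ) ∣ (n : ℤ) :=
    Int.natCast_dvd_natCast.2 (Nat.gcd_dvd_right _ _)
  have h3 : ((Nat.gcd t.val n : ℕ) : ℤ) ∣ (t.val : ℤ) :=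
    Int.natCast_dvd_natCast.2 (Nat.gcd_dvd_left _ _)
  exact (dvd_sub_right (h3.mul_right _)).1 (h2.trans h1)

/-- Averaging the residue weights over the units: the key estimate of the
component-by-component construction. -/
theorem sum_units_residueWeight_le {lam : ℝ} (hlam : 1 / 2 < lam) (t : ZMod n) :
    ∑ v : (ZMod n)ˣ, ∑ a, (if a * v = t then residueWeight n lam a else 0) ≤ vartheta lam := by
  classical
  have hl : 0 < lam := by linarith
  set g := Nat.gcd t.val n with hgdef
  have hg : 0 < g := Nat.gcd_pos_of_pos_right _ (NeZero.pos n)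
  have e1 : ∀ v : (ZMod n)ˣ, HasSum
      (fun h : ℤ => if (h : ZMod n) * v = t then fourierWeight lam h else 0)
      (∑ a, (if a * v = t then residueWeight n lam a else 0)) := by
    intro v
    have hu : ∀ a : ZMod n, a * v = t ↔ a = t * (v⁻¹ : (ZMod n)ˣ) := fun a => by
      rw [Units.eq_mul_inv_iff_mul_eq]
    simp only [hu, Finset.sum_ite_eq', Finset.mem_univ, if_true]
    exact (summable_residue hlam _).hasSum
  have e2 := hasSum_sum (s := Finset.univ) fun v _ => e1 v
  -- Summing over the units first, a frequency `h` is counted at most `g` times, and only if `g ∣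
  -- h`.
  have e3 : ∀ h : ℤ, ∑ v : (ZMod n)ˣ, (if (h : ZMod n) * v = t then fourierWeight lam h else 0) ≤
      (range fun h' : ℤ => (g : ℤ) * h').indicator (fun h => g * fourierWeight lam h) h := by
    intro h
    rw [← Finset.sum_filter, Finset.sum_const, nsmul_eq_mul]
    by_cases hh : h ∈ range fun h' : ℤ => (g : ℤ) * h'
    · rw [indicator_of_mem hh]
      exact mul_le_mul_of_nonneg_right (by exact_mod_cast card_units_mul_eq_le _ t)
        (fourierWeight_nonneg _ _)
    · rw [indicator_of_notMem hh, Finset.card_eq_zero.2, Nat.cast_zero, zero_mul]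
      refine Finset.filter_eq_empty_iff.2 fun v _ hv => hh ?_
      obtain ⟨h', hh'⟩ := gcd_dvd_of_mul_unit_eq hv
      exact ⟨h', hh'.symm⟩
  have hinj : Function.Injective fun h' : ℤ => (g : ℤ) * h' :=
    mul_right_injective₀ (by exact_mod_cast hg.ne')
  have e4 : HasSum ((range fun h' : ℤ => (g : ℤ) * h').indicator
      fun h => g * fourierWeight lam h) (g * ((g : ℝ) ^ (-(2 * lam)) * vartheta lam)) := by
    rw [← hasSum_subtype_iff_indicator]
    refine (hinj.hasSum_range_iff (f := fun h => g * fourierWeight lam h)).2 ?_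
    simp only [Function.comp_def, fourierWeight_mul hl]
    rw [← tsum_fourierWeight hlam]
    exact ((summable_fourierWeight hlam).hasSum.mul_left _).mul_left _
  refine (hasSum_le e3 e2 e4).trans ?_
  rw [← mul_assoc]
  refine mul_le_of_le_one_left (vartheta_pos hlam).le ?_
  -- The multiples of `g` contribute `g * g^(-2λ) * ϑ(λ)`; the factor `g^(1-2λ)` is at most one
  -- because `λ > 1/2`.
  have hg1 : (1 : ℝ) ≤ g := by exact_mod_cast hg
  calc (g : ℝ) * (g : ℝ) ^ (-(2 * lam)) = (g : ℝ) ^ (1 + -(2 * lam)) := by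
        rw [Real.rpow_add (by positivity), Real.rpow_one]
    _ ≤ 1 := Real.rpow_le_one_of_one_le_of_nonpos hg1 (by linarith)

end FourierWeights

/-! ### Dual-lattice sums. -/

section CharacterSums

variable {n : ℕ} [NeZero n]

theorem stdAddChar_sum {ι : Type*} (S : Finset ι) (f : ι → ZMod n) :
    (ZMod.stdAddChar (∑ i ∈ S, f i) : ℂ) = ∏ i ∈ S, (ZMod.stdAddChar (f i) : ℂ) := by
  classical
  induction S using Finset.induction_on with
  | empty => simp
  | insert i S hi ih => rw [Finset.sum_insert hi, Finset.prod_insert hi, AddChar.map_add_eq_mul, ih]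

/-- The dual-lattice expression of the lattice average of a product of Bernoulli polynomials. -/
theorem average_prod_bernoulliZMod {ι : Type*} [Fintype ι] [DecidableEq ι] (w : ι → ZMod n) :
    (1 / (n : ℝ)) * ∑ a : ZMod n, ∏ j, bernoulliZMod n (a * w j) =
      ∑ r : ι → ZMod n, if ∑ j, r j * w j = 0 then ∏ j, residueWeight n 1 (r j) else 0 := by
  have hn : (n : ℂ) ≠ 0 := Nat.cast_ne_zero.2 (NeZero.ne n)
  rw [← Complex.ofReal_inj]
  push_cast
  have h1 : ∀ a : ZMod n, ∏ j, (bernoulliZMod n (a * w j) : ℂ) =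
      ∑ r : ι → ZMod n, (∏ j, (residueWeight n 1 (r j) : ℂ)) *
        ZMod.stdAddChar (a * ∑ j, r j * w j) := by
    intro a
    simp only [bernoulliZMod_eq_sum]
    rw [Finset.prod_univ_sum, Fintype.piFinset_univ]
    refine Finset.sum_congr rfl fun r _ => ?_
    rw [Finset.prod_mul_distrib, Finset.mul_sum, stdAddChar_sum]
    congr 1
    exact Finset.prod_congr rfl fun j _ => by congr 1; ring
  simp only [h1]
  rw [Finset.sum_comm, Finset.mul_sum]
  refine Finset.sum_congr rfl fun r _ => ?_
  -- Orthogonality of characters: the sum over `a` is `n` on the dual lattice and `0` off it.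
  rw [← Finset.mul_sum, AddChar.sum_mulShift _ (ZMod.isPrimitive_stdAddChar n), ZMod.card]
  split_ifs
  · push_cast
    field_simp
  · simp

/-- Once the other frequencies are fixed, the dual condition reads `r_k v = t` for a determined `t`.
Averaging over the units bounds the sum over `r_k` by `ϑ(λ)` uniformly in `t`, and each remaining
free coordinate contributes another `ϑ(λ)`. -/
theorem sum_units_dual_le {lam : ℝ} (hlam : 1 / 2 < lam) {ι : Type*} [Fintype ι] [DecidableEq ι]
    (k : ι) (w : ι → ZMod n) :
    ∑ v : (ZMod n)ˣ, ∑ r : ι → ZMod n,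
      (if ∑ j, r j * Function.update w k (v : ZMod n) j = 0 then
        ∏ j, residueWeight n lam (r j) else 0) ≤ vartheta lam ^ Fintype.card ι := by
  have h1 : ∀ v : (ZMod n)ˣ, ∑ r : ι → ZMod n,
      (if ∑ j, r j * Function.update w k (v : ZMod n) j = 0 then
        ∏ j, residueWeight n lam (r j) else 0) =
      ∑ r' : {j // j ≠ k} → ZMod n, (∏ j, residueWeight n lam (r' j)) *
        ∑ a, if a * v = -∑ j, r' j * w j then residueWeight n lam a else 0 := by
    intro v
    rw [← Equiv.sum_comp (Equiv.funSplitAt k (ZMod n)).symm, Fintype.sum_prod_type_right]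
    refine Finset.sum_congr rfl fun r' _ => ?_
    rw [Finset.mul_sum]
    refine Finset.sum_congr rfl fun a _ => ?_
    rw [Fintype.sum_eq_add_sum_subtype_ne _ k, Fintype.prod_eq_mul_prod_subtype_ne _ k]
    have h2 : ∀ j : {j // j ≠ k}, (Equiv.funSplitAt k (ZMod n)).symm (a, r') j = r' j := by
      intro j
      simp [Equiv.funSplitAt, Equiv.piSplitAt, j.2]
    have h3 : (Equiv.funSplitAt k (ZMod n)).symm (a, r') k = a := by
      simp [Equiv.funSplitAt, Equiv.piSplitAt]
    have h4 : ∀ j : {j // j ≠ k}, Function.update w k (v : ZMod n) j = w j :=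
      fun j => Function.update_of_ne j.2 _ _
    simp only [h2, h3, h4, Function.update_self, ← eq_neg_iff_add_eq_zero]
    split_ifs
    · ring
    · simp
  simp only [h1]
  rw [Finset.sum_comm]
  have hpos : ∀ r' : {j // j ≠ k} → ZMod n, 0 ≤ ∏ j, residueWeight n lam (r' j) :=
    fun r' => Finset.prod_nonneg fun j _ => residueWeight_nonneg _ _
  calc _ ≤ ∑ r' : {j // j ≠ k} → ZMod n, (∏ j, residueWeight n lam (r' j)) * vartheta lam := by
        refine Finset.sum_le_sum fun r' _ => ?_
        rw [← Finset.mul_sum]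
        exact mul_le_mul_of_nonneg_left (sum_units_residueWeight_le hlam _) (hpos r')
    _ = vartheta lam ^ Fintype.card ι := by
        rw [← Finset.sum_mul]
        have h5 := Finset.prod_univ_sum (ι := {j // j ≠ k})
          (fun _ => (Finset.univ : Finset (ZMod n)))
          (fun _ a => residueWeight n lam a)
        rw [Fintype.piFinset_univ] at h5
        rw [← h5, Finset.prod_const, sum_residueWeight hlam, ← pow_succ]
        congr 1
        rw [Finset.card_univ, Fintype.card_subtype_compl, Fintype.card_subtype_eq]
        exact Nat.sub_add_cancel (Fintype.card_pos_iff.2 ⟨k⟩)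

end CharacterSums

/-! ### The component-by-component construction. -/

section CBC

variable {s n : ℕ} [NeZero n]

/-- The lattice average of `∏_{j ∈ u} B₂`, for a generating vector over `ℤ/nℤ`. -/
def latticeAverage (n : ℕ) [NeZero n] (u : Finset (Fin s)) (w : Fin s → ZMod n) : ℝ :=
  (1 / (n : ℝ)) * ∑ a : ZMod n, ∏ j ∈ u, bernoulliZMod n (a * w j)

theorem latticeAverage_eq (u : Finset (Fin s)) (z : Fin s → ℕ) :
    (1 / (n : ℝ)) * ∑ i ∈ Finset.range n,
      ∏ j ∈ u, bernoulliFun 2 (Int.fract ((i : ℝ) * (z j : ℝ) / (n : ℝ))) =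
    latticeAverage n u fun j => (z j : ZMod n) := by
  simp only [bernoulliFun_fract_natCast_mul_div, latticeAverage]
  rw [sum_range_eq_sum_zmod fun a : ZMod n => ∏ j ∈ u, bernoulliZMod n (a * z j)]

theorem latticeAverage_eq_dual (u : Finset (Fin s)) (w : Fin s → ZMod n) :
    latticeAverage n u w = ∑ r : u → ZMod n, if ∑ j, r j * w j = 0 then
      ∏ j, residueWeight n 1 (r j) else 0 := by
  rw [← average_prod_bernoulliZMod fun j : u => w j, latticeAverage]
  congr 1
  refine Finset.sum_congr rfl fun a _ => ?_
  exact (Finset.prod_coe_sort u fun j => bernoulliZMod n (a * w j)).symm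

/-- `B₂` changes sign; positivity is visible only in the dual expression. -/
theorem latticeAverage_nonneg (u : Finset (Fin s)) (w : Fin s → ZMod n) :
    0 ≤ latticeAverage n u w := by
  rw [latticeAverage_eq_dual]
  refine Finset.sum_nonneg fun r _ => ?_
  split_ifs
  · exact Finset.prod_nonneg fun j _ => residueWeight_nonneg _ _
  · exact le_rfl

theorem latticeAverage_rpow_le {lam : ℝ} (hlam : lam ∈ Ioc (1 / 2 : ℝ) 1) (u : Finset (Fin s))
    (w : Fin s → ZMod n) :
    latticeAverage n u w ^ lam ≤ ∑ r : u → ZMod n, if ∑ j, r j * w j = 0 then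
      ∏ j, residueWeight n lam (r j) else 0 := by
  have hl : 0 < lam := by linarith [hlam.1]
  have hpos : ∀ r : u → ZMod n, 0 ≤ ∏ j, residueWeight n 1 (r j) :=
    fun r => Finset.prod_nonneg fun j _ => residueWeight_nonneg _ _
  rw [latticeAverage_eq_dual]
  refine (rpow_sum_le_sum_rpow _ hl hlam.2 fun r _ => ?_).trans
    (Finset.sum_le_sum fun r _ => ?_)
  · split_ifs
    exacts [hpos r, le_rfl]
  · split_ifs
    · rw [← Real.finsetProd_rpow _ _ fun j _ => residueWeight_nonneg _ _]
      exact Finset.prod_le_prod (fun j _ => Real.rpow_nonneg (residueWeight_nonneg _ _) _)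
        fun j _ => residueWeight_one_rpow_le hlam _
    · rw [Real.zero_rpow hl.ne']

theorem sum_units_latticeAverage_rpow_le {lam : ℝ} (hlam : lam ∈ Ioc (1 / 2 : ℝ) 1)
    {u : Finset (Fin s)} {k : Fin s} (hk : k ∈ u) (w : Fin s → ZMod n) :
    ∑ v : (ZMod n)ˣ, latticeAverage n u (Function.update w k (v : ZMod n)) ^ lam ≤
      vartheta lam ^ u.card := by
  have h := sum_units_dual_le (n := n) hlam.1 (⟨k, hk⟩ : u) (fun j => w j)
  rw [Fintype.card_coe] at h
  refine (Finset.sum_le_sum fun v _ => latticeAverage_rpow_le hlam u _).trans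
    (le_of_eq_of_le ?_ h)
  refine Finset.sum_congr rfl fun v _ => ?_
  have h1 : ∀ j : u, Function.update w k (v : ZMod n) j =
      Function.update (fun j : u => w j) ⟨k, hk⟩ (v : ZMod n) j := by
    intro j
    rcases eq_or_ne j ⟨k, hk⟩ with rfl | hj
    · simp
    · rw [Function.update_of_ne hj, Function.update_of_ne fun h => hj (Subtype.ext h)]
  simp only [h1]

/-- The part of the criterion contributed by the sets with largest element `k`. -/
def criterionIncrement (γ : Finset (Fin s) → ℝ) (k : Fin s) (w : Fin s → ZMod n) : ℝ :=
  ∑ u ∈ (Finset.Iic k).powerset with k ∈ u, γ u * latticeAverage n u w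

theorem latticeAverage_update_of_notMem {u : Finset (Fin s)} {k : Fin s} (hk : k ∉ u)
    (w : Fin s → ZMod n) (c : ZMod n) :
    latticeAverage n u (Function.update w k c) = latticeAverage n u w := by
  unfold latticeAverage
  congr 1
  refine Finset.sum_congr rfl fun a _ => Finset.prod_congr rfl fun j hj => ?_
  rw [Function.update_of_ne]
  rintro rfl
  exact hk hj

/-- Sets without `k` do not see `z k`, so minimising the criterion over `z k` is the same as
minimising the increment. -/
theorem cbcCriterion_eq (γ : Finset (Fin s) → ℝ) (k : Fin s) (z : Fin s → ℕ) :
    cbcCriterion n γ k z =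
      (∑ u ∈ (Finset.Iic k).powerset with (u.Nonempty ∧ k ∉ u),
        γ u * latticeAverage n u fun j => (z j : ZMod n)) +
      criterionIncrement γ k fun j => (z j : ZMod n) := by
  simp only [cbcCriterion, latticeAverage_eq, criterionIncrement]
  rw [← Finset.sum_filter_add_sum_filter_not _ (fun u => k ∉ u), Finset.filter_filter,
    Finset.filter_filter]
  congr 1
  refine Finset.sum_congr (Finset.filter_congr fun u _ => ?_) fun _ _ => rfl
  simp only [not_not]
  exact ⟨fun h => h.2, fun h => ⟨⟨k, h⟩, h⟩⟩

theorem exists_candidate (v : (ZMod n)ˣ) : ∃ c, IsCandidate n c ∧ (c : ZMod n) = v := by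
  -- For `n = 1` the least residue is `0`, which is not a candidate; the representative `1` is used
  -- instead.
  rcases eq_or_ne n 1 with rfl | hn
  · exact ⟨1, ⟨le_rfl, le_rfl, by simp⟩, Subsingleton.elim _ _⟩
  · have hc : (v : ZMod n).val.Coprime n := ZMod.val_coe_unit_coprime v
    refine ⟨(v : ZMod n).val, ⟨?_, (ZMod.val_lt _).le, hc⟩, ZMod.natCast_zmod_val _⟩
    rw [Nat.one_le_iff_ne_zero]
    intro h0
    rw [h0, Nat.coprime_zero_left] at hc
    exact hn hc

theorem criterionIncrement_le_of_isCBC {γ : Finset (Fin s) → ℝ} {z : Fin s → ℕ}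
    (hz : IsCBC n γ z) (k : Fin s) (v : (ZMod n)ˣ) :
    criterionIncrement γ k (fun j => (z j : ZMod n)) ≤
      criterionIncrement γ k (Function.update (fun j => (z j : ZMod n)) k (v : ZMod n)) := by
  obtain ⟨c, hc, hcv⟩ := exists_candidate v
  have h := (hz k).2 c hc
  rw [cbcCriterion_eq, cbcCriterion_eq] at h
  have h1 : (fun j => (Function.update z k c j : ZMod n)) =
      Function.update (fun j => (z j : ZMod n)) k (v : ZMod n) := by
    ext j
    rcases eq_or_ne j k with rfl | hj
    · simp [hcv]
    · simp [hj]
  rw [h1] at h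
  have h2 : ∑ u ∈ (Finset.Iic k).powerset with (u.Nonempty ∧ k ∉ u), γ u * latticeAverage n u
      (Function.update (fun j => (z j : ZMod n)) k (v : ZMod n)) =
      ∑ u ∈ (Finset.Iic k).powerset with (u.Nonempty ∧ k ∉ u),
        γ u * latticeAverage n u fun j => (z j : ZMod n) := by
    refine Finset.sum_congr rfl fun u hu => ?_
    rw [latticeAverage_update_of_notMem (Finset.mem_filter.1 hu).2.2]
  rw [h2] at h
  exact le_of_add_le_add_left h

theorem mem_Iic_powerset_filter_iff {u : Finset (Fin s)} (hu : u.Nonempty) (k : Fin s) :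
    u ∈ (Finset.Iic k).powerset.filter (fun u => k ∈ u) ↔ k = u.max' hu := by
  rw [Finset.mem_filter, Finset.mem_powerset]
  constructor
  · rintro ⟨h1, h2⟩
    exact le_antisymm (u.le_max' k h2) (Finset.mem_Iic.1 (h1 (u.max'_mem hu)))
  · rintro rfl
    exact ⟨fun j hj => Finset.mem_Iic.2 (u.le_max' j hj), u.max'_mem hu⟩

theorem sum_nonempty_eq_sum_max (f : Finset (Fin s) → ℝ) :
    ∑ u with u.Nonempty, f u = ∑ k, ∑ u ∈ (Finset.Iic k).powerset with k ∈ u, f u := by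
  have h : ∀ k : Fin s, ∑ u ∈ (Finset.Iic k).powerset with k ∈ u, f u =
      ∑ u with u.Nonempty, if u ∈ (Finset.Iic k).powerset.filter (fun u => k ∈ u) then f u
        else 0 := by
    intro k
    rw [← Finset.sum_filter]
    refine Finset.sum_congr ?_ fun _ _ => rfl
    ext u
    rw [Finset.mem_filter (p := fun u => u ∈ _), iff_and_self, Finset.mem_filter,
      Finset.mem_filter]
    exact fun hu => ⟨Finset.mem_univ _, k, hu.2⟩
  simp only [h]
  rw [Finset.sum_comm]
  refine Finset.sum_congr rfl fun u hu => ?_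
  simp only [mem_Iic_powerset_filter_iff (Finset.mem_filter.1 hu).2, Finset.sum_ite_eq',
    Finset.mem_univ, if_true]

/-- The error bound of the component-by-component construction. -/
theorem shiftAveragedErrorSq_rpow_le {γ : Finset (Fin s) → ℝ} (hγ : ∀ u, 0 ≤ γ u)
    {z : Fin s → ℕ} (hz : IsCBC n γ z) {lam : ℝ} (hlam : lam ∈ Ioc (1 / 2 : ℝ) 1) :
    0 ≤ shiftAveragedErrorSq n γ z ∧ shiftAveragedErrorSq n γ z ^ lam ≤
      1 / (Nat.totient n : ℝ) * ∑ u : Finset (Fin s), γ u ^ lam * vartheta lam ^ u.card := by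
  have hl : 0 < lam := by linarith [hlam.1]
  have hterm : ∀ u (w : Fin s → ZMod n), 0 ≤ γ u * latticeAverage n u w :=
    fun u w => mul_nonneg (hγ u) (latticeAverage_nonneg u w)
  have hinc : ∀ k (w : Fin s → ZMod n), 0 ≤ criterionIncrement γ k w :=
    fun k w => Finset.sum_nonneg fun u _ => hterm u w
  set w : Fin s → ZMod n := fun j => (z j : ZMod n)
  have h1 : shiftAveragedErrorSq n γ z = ∑ k, criterionIncrement γ k w := by
    simp only [shiftAveragedErrorSq, latticeAverage_eq]
    exact sum_nonempty_eq_sum_max _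
  have hphi : (0 : ℝ) < Nat.totient n := by exact_mod_cast Nat.totient_pos.2 (NeZero.pos n)
  have h2 : ∀ k, criterionIncrement γ k w ^ lam ≤ 1 / (Nat.totient n : ℝ) *
      ∑ u ∈ (Finset.Iic k).powerset with k ∈ u, γ u ^ lam * vartheta lam ^ u.card := by
    intro k
    rw [div_mul_eq_mul_div, one_mul, le_div_iff₀ hphi]
    -- The minimum is at most the average over all units; taking the average after raising to the
    -- power `λ` keeps the smaller exponent.
    calc criterionIncrement γ k w ^ lam * (Nat.totient n : ℝ)
        = ∑ v : (ZMod n)ˣ, criterionIncrement γ k w ^ lam := by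
          rw [Finset.sum_const, Finset.card_univ, ZMod.card_units_eq_totient, nsmul_eq_mul,
            mul_comm]
      _ ≤ ∑ v : (ZMod n)ˣ, criterionIncrement γ k (Function.update w k (v : ZMod n)) ^ lam :=
          Finset.sum_le_sum fun v _ => Real.rpow_le_rpow (hinc k w)
            (criterionIncrement_le_of_isCBC hz k v) hl.le
      _ ≤ ∑ v : (ZMod n)ˣ, ∑ u ∈ (Finset.Iic k).powerset with k ∈ u,
            γ u ^ lam * latticeAverage n u (Function.update w k (v : ZMod n)) ^ lam := by
          refine Finset.sum_le_sum fun v _ => ?_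
          refine (rpow_sum_le_sum_rpow _ hl hlam.2 fun u _ => hterm u _).trans_eq ?_
          exact Finset.sum_congr rfl fun u _ =>
            Real.mul_rpow (hγ u) (latticeAverage_nonneg u _)
      _ ≤ _ := by
          rw [Finset.sum_comm]
          refine Finset.sum_le_sum fun u hu => ?_
          rw [← Finset.mul_sum]
          exact mul_le_mul_of_nonneg_left
            (sum_units_latticeAverage_rpow_le hlam (Finset.mem_filter.1 hu).2 w)
            (Real.rpow_nonneg (hγ u) _)
  refine ⟨h1 ▸ Finset.sum_nonneg fun k _ => hinc k w, ?_⟩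
  calc shiftAveragedErrorSq n γ z ^ lam ≤ ∑ k, criterionIncrement γ k w ^ lam := by
        rw [h1]
        exact rpow_sum_le_sum_rpow _ hl hlam.2 fun k _ => hinc k w
    _ ≤ 1 / (Nat.totient n : ℝ) *
          ∑ u with u.Nonempty, γ u ^ lam * vartheta lam ^ u.card := by
        rw [sum_nonempty_eq_sum_max, Finset.mul_sum]
        exact Finset.sum_le_sum fun k _ => h2 k
    _ ≤ _ := by
        refine mul_le_mul_of_nonneg_left ?_ (by positivity)
        exact Finset.sum_le_sum_of_subset_of_nonneg (Finset.filter_subset _ _) fun u _ _ =>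
          mul_nonneg (Real.rpow_nonneg (hγ u) _) (pow_nonneg (vartheta_pos hlam.1).le _)

theorem cbcCriterion_congr {s n : ℕ} (γ : Finset (Fin s) → ℝ) {k : Fin s} {z z' : Fin s → ℕ}
    (h : ∀ j ≤ k, z j = z' j) : cbcCriterion n γ k z = cbcCriterion n γ k z' := by
  unfold cbcCriterion
  refine Finset.sum_congr rfl fun u hu => ?_
  congr 2
  refine Finset.sum_congr rfl fun i _ => Finset.prod_congr rfl fun j hj => ?_
  rw [h j (Finset.mem_Iic.1 (Finset.mem_powerset.1 (Finset.mem_filter.1 hu).1 hj))]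

theorem exists_isCBC (γ : Finset (Fin s) → ℝ) : ∃ z : Fin s → ℕ, IsCBC n γ z := by
  have key : ∀ r : ℕ, ∃ z : Fin s → ℕ, ∀ k : Fin s, (k : ℕ) < r → IsCandidate n (z k) ∧
      ∀ c, IsCandidate n c → cbcCriterion n γ k z ≤ cbcCriterion n γ k (Function.update z k c) := by
    intro r
    induction r with
    | zero => exact ⟨fun _ => 0, fun k hk => absurd hk (Nat.not_lt_zero _)⟩
    | succ r ih =>
      obtain ⟨z, hz⟩ := ih
      by_cases hr : r < s
      · let k₀ : Fin s := ⟨r, hr⟩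
        have hfin : {c | IsCandidate n c}.Finite :=
          (finite_Iic n).subset fun c hc => hc.2.1
        have hne : {c | IsCandidate n c}.Nonempty :=
          ⟨1, le_rfl, NeZero.one_le, Nat.coprime_one_left n⟩
        obtain ⟨c₀, hc₀, hmin⟩ := hfin.exists_minimalFor
          (fun c => cbcCriterion n γ k₀ (Function.update z k₀ c)) _ hne
        refine ⟨Function.update z k₀ c₀, fun k hk => ?_⟩
        rcases eq_or_ne k k₀ with rfl | hkk
        · refine ⟨by simpa using hc₀, fun c hc => ?_⟩
          rw [Function.update_idem]
          rcases le_total (cbcCriterion n γ k₀ (Function.update z k₀ c₀))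
            (cbcCriterion n γ k₀ (Function.update z k₀ c)) with h | h
          · exact h
          · exact hmin hc h
        · have hlt : k < k₀ := lt_of_le_of_ne (Nat.lt_succ_iff.1 hk) hkk
          obtain ⟨h1, h2⟩ := hz k hlt
          refine ⟨by simpa [hkk] using h1, fun c hc => ?_⟩
          -- The criterion of index `k` reads only components up to `k`, so fixing a later component
          -- does not spoil earlier minimality.
          have e : ∀ y : Fin s → ℕ, cbcCriterion n γ k (Function.update y k₀ c₀) =
              cbcCriterion n γ k y := fun y => cbcCriterion_congr γ fun j hj =>
            Function.update_of_ne (hj.trans_lt hlt).ne _ _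
          rw [Function.update_comm hkk.symm, e, e]
          exact h2 c hc
      · exact ⟨z, fun k _ => hz k (k.2.trans_le (not_lt.1 hr))⟩
  obtain ⟨z, hz⟩ := key s
  exact ⟨z, fun k => hz k k.2⟩

end CBC

/-! ### Optimal weights. -/

section Weights

variable {s : ℕ} {b : ℕ → ℝ}

/-- `|u|! ∏_{j ∈ u} b_j`. -/
def factorialProd (b : ℕ → ℝ) (u : Finset (Fin s)) : ℝ := ((u.card ! : ℕ) : ℝ) * ∏ j ∈ u, b j

theorem factorialProd_nonneg (hb : ∀ j, 0 ≤ b j) (u : Finset (Fin s)) : 0 ≤ factorialProd b u :=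
  mul_nonneg (Nat.cast_nonneg _) (Finset.prod_nonneg fun j _ => hb j)

theorem factorialProd_eq_zero_iff (u : Finset (Fin s)) :
    factorialProd b u = 0 ↔ ∏ j ∈ u, b j = 0 := by
  simp [factorialProd, Nat.factorial_ne_zero]

theorem derivSum_eq_ofReal {γ : Finset (Fin s) → ℝ} (hγ : AdmissibleWeights b γ) :
    derivSum b γ = ENNReal.ofReal (∑ u, factorialProd b u ^ 2 / γ u) := by
  rw [derivSum, ENNReal.ofReal_sum_of_nonneg fun u _ => div_nonneg (sq_nonneg _) (hγ u).1]
  refine Finset.sum_congr rfl fun u _ => ?_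
  have h1 : ((u.card ! : ℕ) : ℝ) ^ 2 * ∏ j ∈ u, b j ^ 2 = factorialProd b u ^ 2 := by
    rw [factorialProd, mul_pow, Finset.prod_pow]
  rw [h1]
  rcases (hγ u).1.eq_or_lt with h | h
  · have h2 := (factorialProd_eq_zero_iff u).2 ((hγ u).2 h.symm)
    simp [h2]
  · rw [ENNReal.ofReal_div_of_pos h]

theorem errorFactor_eq_ofReal {γ : Finset (Fin s) → ℝ} (hγ : AdmissibleWeights b γ) (n : ℕ)
    {lam : ℝ} (hlam : 1 / 2 < lam) :
    errorFactor b n lam γ = ENNReal.ofReal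
      ((2 / (n : ℝ) * ∑ u : Finset (Fin s), γ u ^ lam * vartheta lam ^ u.card) ^ (1 / (2 * lam)) *
        (∑ u, factorialProd b u ^ 2 / γ u) ^ (1 / 2 : ℝ)) := by
  have h1 : 0 ≤ ∑ u, factorialProd b u ^ 2 / γ u :=
    Finset.sum_nonneg fun u _ => div_nonneg (sq_nonneg _) (hγ u).1
  have h2 : 0 ≤ 2 / (n : ℝ) * ∑ u : Finset (Fin s), γ u ^ lam * vartheta lam ^ u.card :=
    mul_nonneg (by positivity) (Finset.sum_nonneg fun u _ =>
      mul_nonneg (Real.rpow_nonneg (hγ u).1 _) (pow_nonneg (vartheta_pos hlam).le _))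
  rw [errorFactor, derivSum_eq_ofReal hγ, ENNReal.ofReal_rpow_of_nonneg h1 (by norm_num),
    ENNReal.ofReal_mul (Real.rpow_nonneg h2 _)]

/-- The summand of the optimal value, `(B ϑ^{|u|/(2λ)})^{2λ/(1+λ)}` with `B = |u|! ∏ b_j`. -/
def optimalTerm (lam B v : ℝ) : ℝ := B ^ (2 * lam / (1 + lam)) * v ^ (1 / (1 + lam))

theorem optimalTerm_nonneg {lam B v : ℝ} (hB : 0 ≤ B) (hv : 0 ≤ v) : 0 ≤ optimalTerm lam B v :=
  mul_nonneg (Real.rpow_nonneg hB _) (Real.rpow_nonneg hv _)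

theorem factorialProd_mul_const_rpow {lam t : ℝ} (hlam : 0 < lam) (ht : 0 < t)
    (hb : ∀ j, 0 ≤ b j) (u : Finset (Fin s)) :
    (((u.card ! : ℕ) : ℝ) * ∏ j ∈ u, (b j * t ^ (1 / (2 * lam)))) ^ (2 * lam / (1 + lam)) =
      optimalTerm lam (factorialProd b u) (t ^ u.card) := by
  rw [Finset.prod_mul_distrib, Finset.prod_const, ← mul_assoc, ← factorialProd, optimalTerm,
    Real.mul_rpow (factorialProd_nonneg hb u) (by positivity)]
  congr 1
  rw [← Real.rpow_natCast, ← Real.rpow_mul ht.le, ← Real.rpow_mul ht.le, ← Real.rpow_natCast,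
    ← Real.rpow_mul ht.le]
  congr 1
  field_simp

theorem podWeights_eq {lam : ℝ} (hlam : 1 / 2 < lam) (u : Finset (Fin s)) :
    podWeights b lam s u =
      (factorialProd b u / √(vartheta lam ^ u.card)) ^ (2 / (1 + lam)) := by
  rw [podWeights, Finset.prod_div_distrib, Finset.prod_const, factorialProd, ← mul_div_assoc,
    Real.sqrt_eq_rpow, Real.sqrt_eq_rpow, ← Real.rpow_natCast, ← Real.rpow_natCast,
    ← Real.rpow_mul (vartheta_pos hlam).le, ← Real.rpow_mul (vartheta_pos hlam).le,
    mul_comm (1 / 2 : ℝ)]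

/-- Together with `sq_div_pod` this shows that at the POD weights the two weight sums agree term by
term, which is the equality case of Hölder's inequality. -/
theorem pod_rpow_mul {lam B v : ℝ} (hlam : 0 < lam) (hB : 0 ≤ B) (hv : 0 < v) :
    ((B / √v) ^ (2 / (1 + lam))) ^ lam * v = optimalTerm lam B v := by
  rw [← Real.rpow_mul (by positivity), Real.div_rpow hB (by positivity), Real.sqrt_eq_rpow,
    ← Real.rpow_mul hv.le, optimalTerm, div_mul_eq_mul_div, mul_div_assoc]
  congr 1
  · congr 1
    ring
  · nth_rewrite 1 [← Real.rpow_one v]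
    rw [← Real.rpow_sub hv]
    congr 1
    field_simp
    ring

theorem sq_div_pod {lam B v : ℝ} (hlam : 0 < lam) (hB : 0 ≤ B) (hv : 0 < v) :
    B ^ 2 / (B / √v) ^ (2 / (1 + lam)) = optimalTerm lam B v := by
  rcases hB.eq_or_lt with rfl | hB'
  · have : 2 * lam / (1 + lam) ≠ 0 := by positivity
    simp [optimalTerm, Real.zero_rpow this]
  · rw [Real.div_rpow hB (by positivity), Real.sqrt_eq_rpow, ← Real.rpow_mul hv.le, optimalTerm,
      div_div_eq_mul_div, mul_div_right_comm, ← Real.rpow_two, ← Real.rpow_sub hB']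
    congr 2
    · field_simp
      ring
    · field_simp

/-- With these exponents the powers of the weight `g` cancel, so the Hölder lower bound is the same
for all weights. -/
theorem rpow_mul_rpow_eq_optimalTerm {lam B v g : ℝ} (hlam : 0 < lam) (hB : 0 ≤ B) (hv : 0 < v)
    (hg : 0 ≤ g) (hgB : g = 0 → B = 0) :
    (g ^ lam * v) ^ (1 / (1 + lam)) * (B ^ 2 / g) ^ (lam / (1 + lam)) = optimalTerm lam B v := by
  rcases hg.eq_or_lt with rfl | hg'
  · have h1 : 2 * lam / (1 + lam) ≠ 0 := by positivity
    have h2 : lam / (1 + lam) ≠ 0 := by positivity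
    simp [optimalTerm, hgB rfl, Real.zero_rpow h1, Real.zero_rpow h2]
  · rw [Real.mul_rpow (by positivity) hv.le, Real.div_rpow (by positivity) hg, ← Real.rpow_mul hg,
      optimalTerm, ← Real.rpow_two, ← Real.rpow_mul hB, mul_one_div, ← mul_div_assoc 2]
    have : g ^ (lam / (1 + lam)) ≠ 0 := (Real.rpow_pos_of_pos hg' _).ne'
    field_simp

/-- The weight sums are bounded below by the optimal value (Hölder's inequality). -/
theorem sum_optimalTerm_rpow_le {ι : Type*} (S : Finset ι) {lam : ℝ} (hlam : 0 < lam)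
    {B v g : ι → ℝ} (hB : ∀ i ∈ S, 0 ≤ B i) (hv : ∀ i ∈ S, 0 < v i) (hg : ∀ i ∈ S, 0 ≤ g i)
    (hgB : ∀ i ∈ S, g i = 0 → B i = 0) :
    (∑ i ∈ S, optimalTerm lam (B i) (v i)) ^ ((1 + lam) / (2 * lam)) ≤
      (∑ i ∈ S, g i ^ lam * v i) ^ (1 / (2 * lam)) * (∑ i ∈ S, B i ^ 2 / g i) ^ (1 / 2 : ℝ) := by
  have hpq : (1 + lam).HolderConjugate ((1 + lam) / lam) := by
    rw [Real.holderConjugate_iff]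
    refine ⟨by linarith, ?_⟩
    field_simp
  have h1 : ∀ i ∈ S, 0 ≤ g i ^ lam * v i :=
    fun i hi => mul_nonneg (Real.rpow_nonneg (hg i hi) _) (hv i hi).le
  have h2 : ∀ i ∈ S, 0 ≤ B i ^ 2 / g i := fun i hi => div_nonneg (sq_nonneg _) (hg i hi)
  have h := Real.inner_le_Lp_mul_Lq_of_nonneg S hpq
    (f := fun i => (g i ^ lam * v i) ^ (1 / (1 + lam)))
    (g := fun i => (B i ^ 2 / g i) ^ (lam / (1 + lam)))
    (fun i hi => Real.rpow_nonneg (h1 i hi) _) (fun i hi => Real.rpow_nonneg (h2 i hi) _)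
  rw [Finset.sum_congr rfl fun i hi => rpow_mul_rpow_eq_optimalTerm hlam (hB i hi) (hv i hi)
    (hg i hi) (hgB i hi)] at h
  have e1 : ∀ i ∈ S, ((g i ^ lam * v i) ^ (1 / (1 + lam))) ^ (1 + lam) = g i ^ lam * v i :=
    fun i hi => by
      rw [← Real.rpow_mul (h1 i hi), one_div_mul_cancel (by positivity), Real.rpow_one]
  have e2 : ∀ i ∈ S, ((B i ^ 2 / g i) ^ (lam / (1 + lam))) ^ ((1 + lam) / lam) = B i ^ 2 / g i :=
    fun i hi => by
      rw [← Real.rpow_mul (h2 i hi), div_mul_div_cancel₀ (by positivity), div_self hlam.ne',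
        Real.rpow_one]
  rw [Finset.sum_congr rfl e1, Finset.sum_congr rfl e2] at h
  have s1 := Finset.sum_nonneg h1
  have s2 := Finset.sum_nonneg h2
  have s0 : 0 ≤ ∑ i ∈ S, optimalTerm lam (B i) (v i) :=
    Finset.sum_nonneg fun i hi => optimalTerm_nonneg (hB i hi) (hv i hi).le
  refine (Real.rpow_le_rpow s0 h (by positivity)).trans_eq ?_
  rw [Real.mul_rpow (Real.rpow_nonneg s1 _) (Real.rpow_nonneg s2 _), ← Real.rpow_mul s1,
    ← Real.rpow_mul s2]
  congr 2
  · field_simp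
  · field_simp

theorem admissible_podWeights {lam : ℝ} (hlam : 1 / 2 < lam) (hb : ∀ j, 0 ≤ b j) :
    AdmissibleWeights b (podWeights b lam s) := by
  intro u
  rw [podWeights_eq hlam]
  have h0 : 0 ≤ factorialProd b u / √(vartheta lam ^ u.card) :=
    div_nonneg (factorialProd_nonneg hb u) (Real.sqrt_nonneg _)
  have h1 : √(vartheta lam ^ u.card) ≠ 0 := (Real.sqrt_pos.2 (pow_pos (vartheta_pos hlam) _)).ne'
  refine ⟨Real.rpow_nonneg h0 _, fun h => ?_⟩
  have h2 : 2 / (1 + lam) ≠ 0 := by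
    have : 0 < 1 + lam := by linarith
    positivity
  rw [Real.rpow_eq_zero h0 h2, div_eq_zero_iff, or_iff_left h1] at h
  exact (factorialProd_eq_zero_iff u).1 h

theorem errorFactor_podWeights {lam : ℝ} (hlam : 1 / 2 < lam) (hb : ∀ j, 0 ≤ b j) (n : ℕ) :
    errorFactor b n lam (podWeights b lam s) = ENNReal.ofReal ((2 / (n : ℝ)) ^ (1 / (2 * lam)) *
      (∑ u : Finset (Fin s), optimalTerm lam (factorialProd b u) (vartheta lam ^ u.card)) ^
        ((1 + lam) / (2 * lam))) := by
  have hl : 0 < lam := by linarith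
  have hv : ∀ u : Finset (Fin s), 0 < vartheta lam ^ u.card :=
    fun u => pow_pos (vartheta_pos hlam) _
  have hB := factorialProd_nonneg (s := s) hb
  rw [errorFactor_eq_ofReal (admissible_podWeights hlam hb) n hlam]
  simp only [podWeights_eq hlam, pod_rpow_mul hl (hB _) (hv _), sq_div_pod hl (hB _) (hv _)]
  have s0 : 0 ≤ ∑ u : Finset (Fin s), optimalTerm lam (factorialProd b u)
      (vartheta lam ^ u.card) := Finset.sum_nonneg fun u _ => optimalTerm_nonneg (hB u) (hv u).le
  congr 1
  -- Both factors are powers of the same sum, with exponents adding up to `1/(2λ) + 1/2 =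
  -- (1+λ)/(2λ)`.
  rw [Real.mul_rpow (by positivity) s0, mul_assoc, ← Real.rpow_add_of_nonneg s0 (by positivity)
    (by norm_num)]
  congr 2
  field_simp

theorem errorFactor_podWeights_le {lam : ℝ} (hlam : 1 / 2 < lam) (hb : ∀ j, 0 ≤ b j) (n : ℕ)
    {γ : Finset (Fin s) → ℝ} (hγ : AdmissibleWeights b γ) :
    errorFactor b n lam (podWeights b lam s) ≤ errorFactor b n lam γ := by
  have hl : 0 < lam := by linarith
  have hv : ∀ u : Finset (Fin s), 0 < vartheta lam ^ u.card :=
    fun u => pow_pos (vartheta_pos hlam) _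
  rw [errorFactor_podWeights hlam hb, errorFactor_eq_ofReal hγ n hlam]
  refine ENNReal.ofReal_le_ofReal ?_
  rw [Real.mul_rpow (by positivity) (Finset.sum_nonneg fun u _ =>
    mul_nonneg (Real.rpow_nonneg (hγ u).1 _) (hv u).le), mul_assoc]
  refine mul_le_mul_of_nonneg_left ?_ (by positivity)
  exact sum_optimalTerm_rpow_le _ hl (fun u _ => factorialProd_nonneg hb u) (fun u _ => hv u)
    (fun u _ => (hγ u).1) fun u _ h => (factorialProd_eq_zero_iff u).2 ((hγ u).2 h)

end Weights

/-! ### Dimension-independent bounds through elementary symmetric sums. -/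

section SymmetricSums

/-- Each `(k+1)`-set is counted once for each of its elements `j`. Removing `j` is injective for
fixed `j`; the inequality comes from also admitting `k`-sets that contain `j`. -/
theorem succ_mul_sum_powersetCard_le {ι : Type*} [DecidableEq ι] (T : Finset ι) {x : ι → ℝ}
    (hx : ∀ i, 0 ≤ x i) (k : ℕ) :
    (k + 1 : ℝ) * ∑ u ∈ T.powersetCard (k + 1), ∏ j ∈ u, x j ≤
      (∑ j ∈ T, x j) * ∑ u ∈ T.powersetCard k, ∏ j ∈ u, x j := by
  have hpos : ∀ u : Finset ι, 0 ≤ ∏ j ∈ u, x j := fun u => Finset.prod_nonneg fun j _ => hx j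
  have h1 : (k + 1 : ℝ) * ∑ u ∈ T.powersetCard (k + 1), ∏ j ∈ u, x j =
      ∑ j ∈ T, ∑ u ∈ T.powersetCard (k + 1) with j ∈ u, x j * ∏ i ∈ u.erase j, x i := by
    rw [Finset.mul_sum]
    simp only [Finset.sum_filter]
    rw [Finset.sum_comm]
    refine Finset.sum_congr rfl fun u hu => ?_
    obtain ⟨huT, hcard⟩ := Finset.mem_powersetCard.1 hu
    rw [← Finset.sum_filter, Finset.filter_mem_eq_inter, Finset.inter_eq_right.2 huT,
      Finset.sum_congr rfl fun j hj => Finset.mul_prod_erase u x hj, Finset.sum_const, hcard,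
      nsmul_eq_mul]
    push_cast
    ring
  rw [h1, Finset.sum_mul]
  refine Finset.sum_le_sum fun j _ => ?_
  rw [← Finset.mul_sum]
  refine mul_le_mul_of_nonneg_left ?_ (hx j)
  have hinj : InjOn (fun u : Finset ι => u.erase j)
      ((T.powersetCard (k + 1)).filter fun u => j ∈ u) := by
    intro u hu u' hu' h
    have e := congrArg (insert j) h
    simp only [Finset.coe_filter, mem_ofPred_eq] at hu hu'
    simpa [Finset.insert_erase hu.2, Finset.insert_erase hu'.2] using e
  rw [← Finset.sum_image (f := fun u => ∏ i ∈ u, x i) hinj]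
  refine Finset.sum_le_sum_of_subset_of_nonneg ?_ fun u _ _ => hpos u
  intro v hv
  obtain ⟨u, hu, rfl⟩ := Finset.mem_image.1 hv
  obtain ⟨hu1, hj⟩ := Finset.mem_filter.1 hu
  obtain ⟨huT, hcard⟩ := Finset.mem_powersetCard.1 hu1
  refine Finset.mem_powersetCard.2 ⟨(Finset.erase_subset _ _).trans huT, ?_⟩
  rw [Finset.card_erase_of_mem hj, hcard, Nat.add_sub_cancel]

theorem sum_powersetCard_prod_le {ι : Type*} (T : Finset ι) {x : ι → ℝ} (hx : ∀ i, 0 ≤ x i)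
    (k : ℕ) : ∑ u ∈ T.powersetCard k, ∏ j ∈ u, x j ≤ (∑ j ∈ T, x j) ^ k / (k ! : ℕ) := by
  classical
  induction k with
  | zero => simp
  | succ k ih =>
    have h := (succ_mul_sum_powersetCard_le T hx k).trans
      (mul_le_mul_of_nonneg_left ih (Finset.sum_nonneg fun j _ => hx j))
    have hk : (0 : ℝ) < k + 1 := by positivity
    rw [mul_comm, ← le_div_iff₀ hk] at h
    refine h.trans_eq ?_
    rw [Nat.factorial_succ, pow_succ']
    push_cast
    field_simp

theorem summable_factorial_rpow_mul_pow {p S : ℝ} (hp : p < 1) (hS : 0 < S) :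
    Summable fun k : ℕ => ((k ! : ℕ) : ℝ) ^ (p - 1) * S ^ k := by
  have hpos : ∀ k : ℕ, 0 < ((k ! : ℕ) : ℝ) ^ (p - 1) * S ^ k := fun k =>
    mul_pos (Real.rpow_pos_of_pos (by exact_mod_cast Nat.factorial_pos k) _) (pow_pos hS k)
  refine summable_of_ratio_test_tendsto_lt_one (l := 0) zero_lt_one
    (Filter.Eventually.of_forall fun k => (hpos k).ne') ?_
  have h1 : ∀ k : ℕ, ‖(((k + 1) ! : ℕ) : ℝ) ^ (p - 1) * S ^ (k + 1)‖ /
      ‖((k ! : ℕ) : ℝ) ^ (p - 1) * S ^ k‖ = ((k + 1 : ℕ) : ℝ) ^ (-(1 - p)) * S := by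
    intro k
    rw [Real.norm_of_nonneg (hpos _).le, Real.norm_of_nonneg (hpos _).le,
      div_eq_iff (hpos k).ne', Nat.factorial_succ]
    push_cast
    rw [Real.mul_rpow (by positivity) (by positivity), pow_succ, neg_sub]
    ring
  simp only [h1]
  have h2 := (((tendsto_rpow_neg_atTop (y := 1 - p) (by linarith)).comp
    tendsto_natCast_atTop_atTop).comp (Filter.tendsto_add_atTop_nat 1)).mul_const S
  simpa [Function.comp_def] using h2

/-- Uniformly in the dimension, `∑_u (|u|! ∏_{j ∈ u} c_j)^p` is bounded, provided that `p < 1` and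
`∑_j c_j^p < ∞`. -/
theorem exists_bound_sum_factorialProd_rpow {c : ℕ → ℝ} (hc : ∀ j, 0 ≤ c j) {p : ℝ}
    (hp : p < 1) (hs : Summable fun j => c j ^ p) :
    ∃ M : ℝ, ∀ s : ℕ, ∑ u : Finset (Fin s), factorialProd c u ^ p ≤ M := by
  -- Adding one keeps `S` positive even if all `c j` vanish, as the ratio test requires.
  set S := (∑' j, c j ^ p) + 1
  have hx : ∀ j, 0 ≤ c j ^ p := fun j => Real.rpow_nonneg (hc j) p
  have hS : 0 < S := add_pos_of_nonneg_of_pos (tsum_nonneg hx) one_pos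
  have hsum := summable_factorial_rpow_mul_pow hp hS
  have hterm : ∀ k : ℕ, 0 ≤ ((k ! : ℕ) : ℝ) ^ (p - 1) * S ^ k := fun k => by positivity
  refine ⟨∑' k : ℕ, ((k ! : ℕ) : ℝ) ^ (p - 1) * S ^ k, fun s => ?_⟩
  refine le_trans ?_ (hsum.sum_le_tsum (Finset.range (s + 1)) fun k _ => hterm k)
  have h1 : ∑ u : Finset (Fin s), factorialProd c u ^ p =
      ∑ k ∈ Finset.range (s + 1), ∑ u ∈ (Finset.univ : Finset (Fin s)).powersetCard k,
        factorialProd c u ^ p := by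
    rw [← Finset.powerset_univ, Finset.sum_powerset, Finset.card_univ, Fintype.card_fin]
  rw [h1]
  refine Finset.sum_le_sum fun k _ => ?_
  have hk : (0 : ℝ) < (k ! : ℕ) := by exact_mod_cast Nat.factorial_pos k
  have h2 : ∀ u ∈ (Finset.univ : Finset (Fin s)).powersetCard k, factorialProd c u ^ p =
      ((k ! : ℕ) : ℝ) ^ p * ∏ j ∈ u, c j ^ p := by
    intro u hu
    rw [factorialProd, (Finset.mem_powersetCard.1 hu).2,
      Real.mul_rpow hk.le (Finset.prod_nonneg fun (j : Fin s) _ => hc j),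
      ← Real.finsetProd_rpow _ _ fun (j : Fin s) _ => hc j]
  rw [Finset.sum_congr rfl h2, ← Finset.mul_sum]
  have h3 : ∑ j : Fin s, c j ^ p ≤ S := by
    rw [Fin.sum_univ_eq_sum_range fun j => c j ^ p]
    exact (hs.sum_le_tsum _ fun j _ => hx j).trans (by simp [S])
  calc ((k ! : ℕ) : ℝ) ^ p * ∑ u ∈ (Finset.univ : Finset (Fin s)).powersetCard k, ∏ j ∈ u, c j ^ p
      ≤ ((k ! : ℕ) : ℝ) ^ p * (S ^ k / (k ! : ℕ)) := by
        refine mul_le_mul_of_nonneg_left ?_ (by positivity)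
        refine (sum_powersetCard_prod_le _ (fun j : Fin s => hx j) k).trans ?_
        have := Finset.sum_nonneg fun (j : Fin s) (_ : j ∈ Finset.univ) => hx j
        gcongr
    _ = ((k ! : ℕ) : ℝ) ^ (p - 1) * S ^ k := by
        rw [Real.rpow_sub_one hk.ne']
        ring

/-- Eventually `c j ≤ 1`, and then a larger exponent gives a smaller power. -/
theorem summable_rpow_of_le {c : ℕ → ℝ} (hc : ∀ j, 0 ≤ c j) {p q : ℝ} (hp : 0 < p) (hpq : p ≤ q)
    (hs : Summable fun j => c j ^ p) : Summable fun j => c j ^ q := by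
  refine Summable.of_norm_bounded_eventually_nat hs ?_
  have h1 := hs.tendsto_atTop_zero.eventually (gt_mem_nhds (zero_lt_one))
  filter_upwards [h1] with j hj
  rw [Real.norm_of_nonneg (Real.rpow_nonneg (hc j) _)]
  rcases (hc j).eq_or_lt with h0 | h0
  · rw [← h0, Real.zero_rpow hp.ne', Real.zero_rpow (hp.trans_le hpq).ne']
  · refine Real.rpow_le_rpow_of_exponent_ge h0 ?_ hpq
    by_contra hlt
    exact absurd (Real.one_lt_rpow (not_le.1 hlt) hp) (not_lt.2 hj.le)

end SymmetricSums

/-! ### Error bound, choice of `λ` and convergence rate. -/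

section Assembly

theorem bSeq_nonneg {d : ℕ} {D : Set (Space d)} {ψ : ℕ → Space d → ℝ} {amin : ℝ}
    (hamin : 0 < amin) (j : ℕ) : 0 ≤ bSeq D ψ amin j :=
  div_nonneg ENNReal.toReal_nonneg hamin.le

theorem summable_bSeq_rpow {d : ℕ} {D : Set (Space d)} {ψ : ℕ → Space d → ℝ} {amin p : ℝ}
    (hamin : 0 < amin) (hsum : Summable fun j => linfNorm D (ψ j) ^ p) :
    Summable fun j => bSeq D ψ amin j ^ p := by
  refine (hsum.div_const (amin ^ p)).congr fun j => ?_
  have h0 : 0 ≤ linfNorm D (ψ j) := ENNReal.toReal_nonneg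
  rw [bSeq, Real.div_rpow h0 hamin.le]

/-- This is the source of the factor `2 / n`: it is an equality for `m ≥ 1`, where `φ(2^m) =
2^(m-1)`. -/
theorem one_div_totient_two_pow_le (m : ℕ) :
    1 / (Nat.totient (2 ^ m) : ℝ) ≤ 2 / ((2 ^ m : ℕ) : ℝ) := by
  cases m with
  | zero => norm_num
  | succ m =>
    rw [Nat.totient_prime_pow_succ Nat.prime_two]
    push_cast
    rw [pow_succ]
    norm_num
    field_simp
    exact le_rfl

theorem rmsError_integrand_le {d : ℕ} {D : Set (Space d)} {a₀ : Space d → ℝ}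
    {ψ : ℕ → Space d → ℝ} {amin amax : ℝ} (hamin : 0 < amin)
    (ha₀ : MemLp a₀ ⊤ (volume.restrict D)) (hψ : ∀ j, MemLp (ψ j) ⊤ (volume.restrict D))
    (hbounds : ∀ y : ℕ → ℝ, (∀ j, y j ∈ Icc (-1 / 2 : ℝ) (1 / 2)) →
      ∀ᵐ x ∂(volume.restrict D), coeff a₀ ψ y x ∈ Icc amin amax)
    (κ G : H10 D →L[ℝ] ℝ) (V : Submodule ℝ (H10 D)) [FiniteDimensional ℝ V] {s m : ℕ}
    {γ : Finset (Fin s) → ℝ} (hγ : AdmissibleWeights (bSeq D ψ amin) γ) {z : Fin s → ℕ}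
    (hz : IsCBC (2 ^ m) γ z) {lam : ℝ} (hlam : lam ∈ Ioc (1 / 2 : ℝ) 1) :
    rmsError (2 ^ m) z (integrand a₀ ψ κ G V s) ≤
      ENNReal.ofReal (‖κ‖ * ‖G‖ / amin) * errorFactor (bSeq D ψ amin) (2 ^ m) lam γ := by
  have hl : 0 < lam := by linarith [hlam.1]
  have hc : 0 ≤ ‖κ‖ * ‖G‖ / amin := by positivity
  set c := ‖κ‖ * ‖G‖ / amin
  obtain ⟨-, U, hU, hsub, hsmooth, hderiv, hbound⟩ :=
    exists_smooth_neighborhood hamin ha₀ hψ hbounds κ G V s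
  have hrms := rmsError_le (n := 2 ^ m) (z := z)
    (F := fun u => mixedPartial u (integrand a₀ ψ κ G V s))
    (K := fun u => c * factorialProd (bSeq D ψ amin) u) (γ := γ)
    (fun u => ((hsmooth u).mono hsub).continuousOn)
    (fun u i hi y hy => hderiv u i hi y (hsub hy)) hbound
    (fun u => ⟨(hγ u).1, fun h => by
      rw [(factorialProd_eq_zero_iff u).2 ((hγ u).2 h), mul_zero]⟩)
  have h0 : mixedPartial ∅ (integrand a₀ ψ κ G V s) = integrand a₀ ψ κ G V s := by
    simp [mixedPartial]
  rw [h0] at hrms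
  refine hrms.trans ?_
  rw [errorFactor_eq_ofReal hγ _ hlam.1, ← ENNReal.ofReal_mul hc]
  refine ENNReal.ofReal_le_ofReal ?_
  obtain ⟨he0, he⟩ := shiftAveragedErrorSq_rpow_le (fun u => (hγ u).1) hz hlam
  have hA : 0 ≤ ∑ u : Finset (Fin s), γ u ^ lam * vartheta lam ^ u.card :=
    Finset.sum_nonneg fun u _ =>
      mul_nonneg (Real.rpow_nonneg (hγ u).1 _) (pow_nonneg (vartheta_pos hlam.1).le _)
  have hS : 0 ≤ ∑ u, factorialProd (bSeq D ψ amin) u ^ 2 / γ u :=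
    Finset.sum_nonneg fun u _ => div_nonneg (sq_nonneg _) (hγ u).1
  have he2 := he.trans (mul_le_mul_of_nonneg_right (one_div_totient_two_pow_le m) hA)
  have he3 : √(shiftAveragedErrorSq (2 ^ m) γ z) ≤ (2 / ((2 ^ m : ℕ) : ℝ) *
      ∑ u : Finset (Fin s), γ u ^ lam * vartheta lam ^ u.card) ^ (1 / (2 * lam)) := by
    have h := Real.rpow_le_rpow (Real.rpow_nonneg he0 _) he2
      (show 0 ≤ 1 / (2 * lam) by positivity)
    rwa [← Real.rpow_mul he0, show lam * (1 / (2 * lam)) = 1 / 2 by field_simp,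
      ← Real.sqrt_eq_rpow] at h
  have hsum : ∑ u, (c * factorialProd (bSeq D ψ amin) u) ^ 2 / γ u =
      c ^ 2 * ∑ u, factorialProd (bSeq D ψ amin) u ^ 2 / γ u := by
    rw [Finset.mul_sum]
    exact Finset.sum_congr rfl fun u _ => by ring
  rw [hsum, Real.sqrt_mul (by positivity), Real.sqrt_mul (by positivity), Real.sqrt_sq hc,
    ← Real.sqrt_eq_rpow, mul_assoc, mul_comm (√(∑ u, _))]
  gcongr

/-- In the second case `2λ/(1+λ) = p₀` and `1/(2λ) = 1/p₀ - 1/2` exactly. In the first, `λ > 1/2`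
gives `2λ/(1+λ) > 2/3 ≥ p₀`, and `1/(2λ) = 1 - δ`. -/
theorem lambdaChoice_spec {p₀ δ : ℝ} (hp₀ : p₀ ∈ Ioo (0 : ℝ) 1) (hδ : δ ∈ Ioo (0 : ℝ) (1 / 2)) :
    lambdaChoice p₀ δ ∈ Ioo (1 / 2 : ℝ) 1 ∧
    2 * lambdaChoice p₀ δ / (1 + lambdaChoice p₀ δ) < 1 ∧
    p₀ ≤ 2 * lambdaChoice p₀ δ / (1 + lambdaChoice p₀ δ) ∧
    min (1 / p₀ - 1 / 2) (1 - δ) ≤ 1 / (2 * lambdaChoice p₀ δ) := by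
  obtain ⟨h1, h2⟩ := hp₀
  obtain ⟨h3, h4⟩ := hδ
  have hlt : lambdaChoice p₀ δ ∈ Ioo (1 / 2 : ℝ) 1 := by
    unfold lambdaChoice
    split_ifs with h
    · have : 0 < 2 - 2 * δ := by linarith
      exact ⟨by rw [div_lt_div_iff₀ two_pos this]; linarith, by rw [div_lt_one this]; linarith⟩
    · have : 0 < 2 - p₀ := by linarith
      exact ⟨by rw [div_lt_div_iff₀ two_pos this]; linarith, by rw [div_lt_one this]; linarith⟩
  have hpos : 0 < 1 + lambdaChoice p₀ δ := by linarith [hlt.1]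
  refine ⟨hlt, by rw [div_lt_one hpos]; linarith [hlt.2], ?_, ?_⟩
  · rw [le_div_iff₀ hpos]
    unfold lambdaChoice at hlt ⊢
    split_ifs at hlt ⊢ with h
    · nlinarith [hlt.1]
    · have : 2 - p₀ ≠ 0 := by linarith
      refine le_of_eq ?_
      field_simp
      ring
  · unfold lambdaChoice
    split_ifs with h
    · refine (min_le_right _ _).trans_eq ?_
      have : 1 - δ ≠ 0 := by linarith
      field_simp
    · refine (min_le_left _ _).trans_eq ?_
      have : 2 - p₀ ≠ 0 := by linarith
      field_simp

theorem exists_bound_errorFactor_podWeights {b : ℕ → ℝ} (hb : ∀ j, 0 ≤ b j) {lam : ℝ}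
    (hlam : lam ∈ Ioo (1 / 2 : ℝ) 1) (hp : 2 * lam / (1 + lam) < 1)
    (hs : Summable fun j => b j ^ (2 * lam / (1 + lam))) :
    ∃ M : ℝ, ∀ s m : ℕ, 0 ≤ M ∧ errorFactor b (2 ^ m) lam (podWeights b lam s) ≤
      ENNReal.ofReal (M * (2 ^ m : ℝ) ^ (-(1 / (2 * lam)))) := by
  have hl : 0 < lam := by linarith [hlam.1]
  have ht := vartheta_pos hlam.1
  have hct : 0 ≤ vartheta lam ^ (1 / (2 * lam)) := Real.rpow_nonneg ht.le _
  -- The powers of `ϑ(λ)` are absorbed into the sequence as a constant factor, which does not affect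
  -- summability.
  have hs' : Summable fun j => (b j * vartheta lam ^ (1 / (2 * lam))) ^ (2 * lam / (1 + lam)) := by
    refine (hs.mul_right ((vartheta lam ^ (1 / (2 * lam))) ^ (2 * lam / (1 + lam)))).congr
      fun j => ?_
    rw [Real.mul_rpow (hb j) hct]
  obtain ⟨M, hM⟩ := exists_bound_sum_factorialProd_rpow (fun j => mul_nonneg (hb j) hct) hp hs'
  have hM0 : 0 ≤ M := le_trans (Finset.sum_nonneg fun u _ => Real.rpow_nonneg
    (factorialProd_nonneg (fun j => mul_nonneg (hb j) hct) u) _) (hM 0)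
  refine ⟨2 ^ (1 / (2 * lam)) * M ^ ((1 + lam) / (2 * lam)), fun s m => ⟨by positivity, ?_⟩⟩
  rw [errorFactor_podWeights hlam.1 hb]
  refine ENNReal.ofReal_le_ofReal ?_
  have h1 : ∑ u : Finset (Fin s), optimalTerm lam (factorialProd b u) (vartheta lam ^ u.card) ≤
      M := by
    refine le_of_eq_of_le (Finset.sum_congr rfl fun u _ => ?_) (hM s)
    exact (factorialProd_mul_const_rpow hl ht hb u).symm
  have h0 : 0 ≤ ∑ u : Finset (Fin s), optimalTerm lam (factorialProd b u)
      (vartheta lam ^ u.card) := Finset.sum_nonneg fun u _ =>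
    optimalTerm_nonneg (factorialProd_nonneg hb u) (pow_nonneg ht.le _)
  have h2 := Real.rpow_le_rpow h0 h1 (show 0 ≤ (1 + lam) / (2 * lam) by positivity)
  rw [Real.div_rpow two_pos.le (by positivity), Real.rpow_neg (by positivity)]
  push_cast
  calc _ ≤ (2 : ℝ) ^ (1 / (2 * lam)) / (2 ^ m : ℝ) ^ (1 / (2 * lam)) *
        M ^ ((1 + lam) / (2 * lam)) := by gcongr
    _ = _ := by ring

end Assembly

end QMCPDE

end

theorem mainTheorem2 {d : ℕ} (hd : d = 1 ∨ d = 2 ∨ d = 3)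
    (D : Set (QMCPDE.Space d)) (hD : QMCPDE.IsConvexPolyhedralDomain D)
    (a₀ : QMCPDE.Space d → ℝ) (ha₀ : MemLp a₀ ⊤ (volume.restrict D))
    (ψ : ℕ → QMCPDE.Space d → ℝ) (hψ : ∀ j, MemLp (ψ j) ⊤ (volume.restrict D))
    (amin amax : ℝ) (hamin : 0 < amin)
    (hbounds : ∀ y : ℕ → ℝ, (∀ j, y j ∈ Icc (-1 / 2 : ℝ) (1 / 2)) →
      ∀ᵐ x ∂(volume.restrict D), QMCPDE.coeff a₀ ψ y x ∈ Icc amin amax)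
    (p₀ : ℝ) (hp₀ : p₀ ∈ Ioo (0 : ℝ) 1)
    (hsum : Summable fun j => QMCPDE.linfNorm D (ψ j) ^ p₀)
    (κ G : QMCPDE.H10 D →L[ℝ] ℝ) :
    -- the integrand is well defined and smooth, and its weighted Sobolev norm is bounded
    (∀ (V : Submodule ℝ (QMCPDE.H10 D)) [FiniteDimensional ℝ V] (s : ℕ),
      (∀ y : Fin s → ℝ, (∀ j, y j ∈ Icc (-1 / 2 : ℝ) (1 / 2)) →
        QMCPDE.IsGalerkinSolution a₀ ψ κ V y (QMCPDE.galerkinSolution a₀ ψ κ V y)) ∧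
      ContDiffOn ℝ ∞ (QMCPDE.integrand a₀ ψ κ G V s) (Icc 0 1) ∧
      ∀ γ : Finset (Fin s) → ℝ, (∀ u, 0 ≤ γ u) →
        QMCPDE.sobolevNorm γ (QMCPDE.integrand a₀ ψ κ G V s) ≤
          ENNReal.ofReal (‖κ‖ * ‖G‖ / amin) *
            QMCPDE.derivSum (QMCPDE.bSeq D ψ amin) γ ^ (1 / 2 : ℝ)) ∧
    -- the error bound for CBC-constructed rules with general weights
    (∀ (V : Submodule ℝ (QMCPDE.H10 D)) [FiniteDimensional ℝ V] (s m : ℕ)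
      (γ : Finset (Fin s) → ℝ), QMCPDE.AdmissibleWeights (QMCPDE.bSeq D ψ amin) γ →
      ∀ z : Fin s → ℕ, QMCPDE.IsCBC (2 ^ m) γ z → ∀ lam ∈ Ioc (1 / 2 : ℝ) 1,
        QMCPDE.rmsError (2 ^ m) z (QMCPDE.integrand a₀ ψ κ G V s) ≤
          ENNReal.ofReal (‖κ‖ * ‖G‖ / amin) *
            QMCPDE.errorFactor (QMCPDE.bSeq D ψ amin) (2 ^ m) lam γ) ∧
    -- the POD weights minimise this bound, and the minimal value
    (∀ s m : ℕ, ∀ lam ∈ Ioc (1 / 2 : ℝ) 1,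
      QMCPDE.AdmissibleWeights (QMCPDE.bSeq D ψ amin)
        (QMCPDE.podWeights (QMCPDE.bSeq D ψ amin) lam s) ∧
      (∀ γ : Finset (Fin s) → ℝ, QMCPDE.AdmissibleWeights (QMCPDE.bSeq D ψ amin) γ →
        QMCPDE.errorFactor (QMCPDE.bSeq D ψ amin) (2 ^ m) lam
            (QMCPDE.podWeights (QMCPDE.bSeq D ψ amin) lam s) ≤
          QMCPDE.errorFactor (QMCPDE.bSeq D ψ amin) (2 ^ m) lam γ) ∧
      QMCPDE.errorFactor (QMCPDE.bSeq D ψ amin) (2 ^ m) lam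
          (QMCPDE.podWeights (QMCPDE.bSeq D ψ amin) lam s) =
        ENNReal.ofReal ((2 / (2 ^ m : ℝ)) ^ (1 / (2 * lam)) *
          (∑ u : Finset (Fin s), (((u.card ! : ℕ) : ℝ) * ∏ j ∈ u,
            (QMCPDE.bSeq D ψ amin j * QMCPDE.vartheta lam ^ (1 / (2 * lam))))
              ^ (2 * lam / (1 + lam))) ^ ((1 + lam) / (2 * lam)))) ∧
    -- the convergence rate, uniformly in the dimension `s` (and in the finite element space)
    (∀ δ ∈ Ioo (0 : ℝ) (1 / 2), ∃ C : ℝ, ∀ s m : ℕ,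
      (∃ z : Fin s → ℕ, QMCPDE.IsCBC (2 ^ m) (QMCPDE.podWeights (QMCPDE.bSeq D ψ amin)
        (QMCPDE.lambdaChoice p₀ δ) s) z) ∧
      ∀ z : Fin s → ℕ, QMCPDE.IsCBC (2 ^ m) (QMCPDE.podWeights (QMCPDE.bSeq D ψ amin)
        (QMCPDE.lambdaChoice p₀ δ) s) z →
      ∀ (V : Submodule ℝ (QMCPDE.H10 D)) [FiniteDimensional ℝ V],
        QMCPDE.rmsError (2 ^ m) z (QMCPDE.integrand a₀ ψ κ G V s) ≤
          ENNReal.ofReal (C * (2 ^ m : ℝ) ^ (-(min (1 / p₀ - 1 / 2) (1 - δ))))) := by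
  have hb : ∀ j, 0 ≤ QMCPDE.bSeq D ψ amin j := QMCPDE.bSeq_nonneg hamin
  have hc : 0 ≤ ‖κ‖ * ‖G‖ / amin := by positivity
  refine ⟨fun V _ s => ?_, fun V _ s m γ hγ z hz lam hlam => ?_, fun s m lam hlam => ?_,
    fun δ hδ => ?_⟩
  · obtain ⟨hsol, U, hU, hsub, hsmooth, -, hbound⟩ :=
      QMCPDE.exists_smooth_neighborhood hamin ha₀ hψ hbounds κ G V s
    refine ⟨hsol, ?_, fun γ _ => ?_⟩
    · simpa [QMCPDE.mixedPartial] using (hsmooth ∅).mono hsub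
    · rw [← QMCPDE.sum_ofReal_mul_sq_div_rpow_half _ γ hc]
      exact QMCPDE.sobolevNorm_le_of_mixedPartial_le γ hbound
  · exact QMCPDE.rmsError_integrand_le hamin ha₀ hψ hbounds κ G V hγ hz hlam
  · refine ⟨QMCPDE.admissible_podWeights hlam.1 hb,
      fun γ hγ => QMCPDE.errorFactor_podWeights_le hlam.1 hb _ hγ, ?_⟩
    have hl : 0 < lam := by linarith [hlam.1]
    rw [QMCPDE.errorFactor_podWeights hlam.1 hb]
    simp only [QMCPDE.factorialProd_mul_const_rpow hl (QMCPDE.vartheta_pos hlam.1) hb,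
      Nat.cast_pow, Nat.cast_ofNat]
  · obtain ⟨hlam, hp1, hp0, hrate⟩ := QMCPDE.lambdaChoice_spec hp₀ hδ
    set lam := QMCPDE.lambdaChoice p₀ δ
    obtain ⟨M, hM⟩ := QMCPDE.exists_bound_errorFactor_podWeights hb hlam hp1
      (QMCPDE.summable_rpow_of_le hb hp₀.1 hp0 (QMCPDE.summable_bSeq_rpow hamin hsum))
    refine ⟨‖κ‖ * ‖G‖ / amin * M, fun s m => ⟨QMCPDE.exists_isCBC _, fun z hz V _ => ?_⟩⟩
    refine (QMCPDE.rmsError_integrand_le hamin ha₀ hψ hbounds κ G V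
      (QMCPDE.admissible_podWeights hlam.1 hb) hz ⟨hlam.1, hlam.2.le⟩).trans ?_
    refine (mul_le_mul_right (hM s m).2 _).trans ?_
    rw [← ENNReal.ofReal_mul hc, ← mul_assoc]
    refine ENNReal.ofReal_le_ofReal (mul_le_mul_of_nonneg_left ?_ (mul_nonneg hc (hM s m).1))
    exact Real.rpow_le_rpow_of_exponent_le (one_le_pow₀ one_le_two) (neg_le_neg hrate)
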